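/- **Setting.** Let $z_0=(0,0)$, $z_1=(1,0)$, $z_2=(\frac12,\frac{\sqrt3}{2})$ in $\mathbb R^2$, let $f_i(p)=\frac12p+\frac12z_i$ for $i\in M=\{0,1,2\}$, let $S$ be the Sierpinski gasket, i.e. the unique nonempty compact set with $S=f_0(S)\cup f_1(S)\cup f_2(S)$, and let $s=\frac{\log 3}{\log 2}$ be its similarity dimension. $B(x,d)$ denotes the closed Euclidean ball of centre $x$ and radius $d>0$. *Metric measures.* For $A\subset\mathbb R^2$ let $$C_0^s(A)=\lim_{\delta\to0}\inf\Big\{\sum_i(2d_i)^s\Big\},$$ the infimum being over all countable coverings of $A$ by balls $B(x_i,d_i)$ with $x_i\in A$, $2d_i\le\delta$, and let $C^s(A)=\sup\{C_0^s(F):F\subset A,\ F\text{ closed}\}$ (centred Hausdorff measure). Let $$P_0^s(A)=\lim_{\delta\to0}\sup\Big\{\sum_i(2d_i)^s\Big\},$$ the supremum being over all countable families of pairwise disjoint balls $B(x_i,d_i)$ with $x_i\in A$, $2d_i\le\delta$, and let $P^s(A)=\inf\{\sum_{i}P_0^s(F_i)\}$, the infimum being over all countable coverings $\{F_i\}$ of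 $A$ by closed sets (packing measure). $\mathcal H^s$ is the Hausdorff measure, and $\mathcal H^s_{Sph}$ is the spherical Hausdorff measure, defined as $C_0^s$ but without requiring the centres $x_i$ to lie in $A$. The natural probability measure $\mu$ is the compactly supported Borel probability measure on $\mathbb R^2$ with $\mu=\sum_{i\in M}2^{-s}\,\mu\circ f_i^{-1}$. Let $\alpha$ be an $s$-dimensional metric measure on $S$, i.e. $\alpha$ is one of $\mu$, $\mathcal H^s\lfloor_S$, $\mathcal H^s_{Sph}\lfloor_S$, $C^s\lfloor_S$, $P^s\lfloor_S$. *Densities.* Put $\theta_\alpha^s(x,d)=\dfrac{\alpha(B(x,d))}{(2d)^s}$, $\underline\theta_\alpha^s(x)=\liminf_{d\to0}\theta_\alpha^s(x,d)$, $\overline\theta_\alpha^s(x)=\limsup_{d\to0}\theta_\alpha^s(x,d)$, and, for $A\subset\mathbb R^2$, let $Spec(\alpha,A)$ be the set of all limits $\lim_{k\to\infty}\theta_\alpha^s(x,d_k)$ with $x\in A$, $d_k>0$ and $d_k\to0$; $Spec(\alpha,y)=Spec(\alpha,\{y\})$. *Feasible sets and typical balls.* An open set $\mathcal R\subset\mathbb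 R^2$ is feasible if $\mathcal R\cap S\ne\varnothing$, $f_i(\mathcal R)\subset\mathcal R$ for all $i$, and $f_i(\mathcal R)\cap f_j(\mathcal R)=\varnothing$ for $i\ne j$. A ball $B(x,d)$ is typical if $x\in S$ and $B(x,d)$ is contained in some feasible open set; $\mathcal B$ is the set of typical balls and $Im(\theta_\alpha^s,\mathcal B)=\{\theta_\alpha^s(x,d):B(x,d)\in\mathcal B\}$. *Dense shift orbits.* For $i=i_1i_2\dots\in M^{\mathbb N}$ let $\pi(i)$ be the point of $\bigcap_kf_{i_1}\circ\dots\circ f_{i_k}(S)$, let $\sigma$ be the left shift on $M^{\mathbb N}$, let $\mathcal T=\pi\circ\sigma\circ\pi^{-1}$ (a correspondence on $S$), and let $\widehat S$ be the set of $y\in S$ for which $\bigcup_k\mathcal T^k(y)$ is dense in $S$. **Theorem.** The numbers $\alpha(S)$, $P^s(S)$, $C^s(S)$ are positive and finite, and the following hold. (i) For every $y\in\widehat S$ and every feasible open set $\mathcal R$, $$Spec(\alpha,y)=Spec(\alpha,\widehat S)=Spec(\alpha,\mathcal R\cap S)=Im(\theta_\alpha^s,\mathcal B)=\Big[\frac{\alpha(S)}{P^s(S)},\frac{\alpha(S)}{C^s(S)}\Big];$$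 the equalities not involving $y$ or $\mathcal R$ hold without reference to them. (ii) $Spec(\alpha,S)$ is the union of two closed intervals of positive length, $$Spec(\alpha,S)=\big[\underline\theta_\alpha^s(z_0),\overline\theta_\alpha^s(z_0)\big]\cup\Big[\frac{\alpha(S)}{P^s(S)},\frac{\alpha(S)}{C^s(S)}\Big],$$ where $$\underline\theta_\alpha^s(z_0)=\min\{\theta_\alpha^s(z_0,d):\tfrac12\le d\le1\},\qquad\overline\theta_\alpha^s(z_0)=\max\{\theta_\alpha^s(z_0,d):\tfrac12\le d\le1\}.$$ -/

import Mathlib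

open Set Filter Topology MeasureTheory
open scoped ENNReal NNReal

noncomputable section

namespace SierpinskiGasket

/-- The Euclidean plane. -/
abbrev Plane : Type := EuclideanSpace ℝ (Fin 2)

/-! ### The iterated function system and the gasket -/

/-- The vertices `z₀ = (0,0)`, `z₁ = (1,0)`, `z₂ = (1/2, √3/2)`. -/
def vertex : Fin 3 → Plane := ![!₂[0, 0], !₂[1, 0], !₂[1 / 2, Real.sqrt 3 / 2]]

/-- The similitudes `fᵢ(p) = p/2 + zᵢ/2`, of contraction ratio `1/2` and with fixed point `zᵢ`. -/
def simil (i : Fin 3) (p : Plane) : Plane := (1 / 2 : ℝ) • p + (1 / 2 : ℝ) • vertex i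

/-- `K` is the nonempty compact set generated by the system: `K = f₀(K) ∪ f₁(K) ∪ f₂(K)`. -/
def IsAttractor (K : Set Plane) : Prop :=
  K.Nonempty ∧ IsCompact K ∧ K = ⋃ i : Fin 3, simil i '' K

theorem edist_simil (i : Fin 3) (x y : Plane) :
    edist (simil i x) (simil i y) = ((1 / 2 : ℝ≥0) : ℝ≥0∞) * edist x y := by
  unfold simil
  rw [edist_add_right, edist_smul₀, ENNReal.smul_def, smul_eq_mul]
  congr 2
  ext
  simp

theorem continuous_simil (i : Fin 3) : Continuous (simil i) := by
  unfold simil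
  fun_prop

theorem hausdorffEDist_simil_le (i : Fin 3) (K L : Set Plane) :
    Metric.hausdorffEDist (simil i '' K) (simil i '' L)
      ≤ ((1 / 2 : ℝ≥0) : ℝ≥0∞) * Metric.hausdorffEDist K L := by
  have key : ∀ A B : Set Plane, ∀ x ∈ simil i '' A,
      Metric.infEDist x (simil i '' B) ≤ ((1 / 2 : ℝ≥0) : ℝ≥0∞) * Metric.hausdorffEDist A B := by
    rintro A B _ ⟨a, ha, rfl⟩
    refine le_trans ?_ (mul_le_mul_right (Metric.infEDist_le_hausdorffEDist_of_mem ha) _)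
    have hc : ((1 / 2 : ℝ≥0) : ℝ≥0∞) ≠ ⊤ := ENNReal.coe_ne_top
    have hc0 : ((1 / 2 : ℝ≥0) : ℝ≥0∞) ≠ 0 := by simp
    rw [Metric.infEDist, Metric.infEDist, ENNReal.mul_iInf_of_ne hc0 hc]
    refine le_iInf fun b => ?_
    rw [ENNReal.mul_iInf_of_ne hc0 hc]
    refine le_iInf fun hb => ?_
    rw [← edist_simil]
    exact iInf₂_le _ (mem_image_of_mem _ hb)
  refine Metric.hausdorffEDist_le_of_infEDist (key K L) fun x hx => ?_
  rw [Metric.hausdorffEDist_comm]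
  exact key L K x hx

/-- The set map `K ↦ f₀(K) ∪ f₁(K) ∪ f₂(K)` on nonempty compact sets. -/
def setMap (K : TopologicalSpace.NonemptyCompacts Plane) :
    TopologicalSpace.NonemptyCompacts Plane :=
  ⟨⟨⋃ i : Fin 3, simil i '' K, isCompact_iUnion fun i => K.isCompact.image (continuous_simil i)⟩,
    nonempty_iUnion.2 ⟨0, K.nonempty.image _⟩⟩

theorem contracting_setMap : ContractingWith (1 / 2) setMap := by
  refine ⟨by rw [← NNReal.coe_lt_coe]; norm_num, fun K L => ?_⟩
  change Metric.hausdorffEDist (⋃ i : Fin 3, simil i '' (K : Set Plane))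
    (⋃ i : Fin 3, simil i '' (L : Set Plane)) ≤ _ * Metric.hausdorffEDist (K : Set Plane) L
  exact Metric.hausdorffEDist_iUnion_le.trans (iSup_le fun i => hausdorffEDist_simil_le i _ _)

theorem existsUnique_attractor : ∃! K : Set Plane, IsAttractor K := by
  have : Nonempty (TopologicalSpace.NonemptyCompacts Plane) := ⟨{0}⟩
  have hf := contracting_setMap
  refine ⟨(ContractingWith.fixedPoint setMap hf : TopologicalSpace.NonemptyCompacts Plane),
    ⟨TopologicalSpace.NonemptyCompacts.nonempty _,
      TopologicalSpace.NonemptyCompacts.isCompact _, ?_⟩, ?_⟩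
  · exact (congrArg (fun K : TopologicalSpace.NonemptyCompacts Plane => (K : Set Plane))
      hf.fixedPoint_isFixedPt).symm
  · rintro L ⟨hne, hc, hL⟩
    have hfix : Function.IsFixedPt setMap ⟨⟨L, hc⟩, hne⟩ :=
      TopologicalSpace.NonemptyCompacts.ext hL.symm
    exact congrArg (fun K : TopologicalSpace.NonemptyCompacts Plane => (K : Set Plane))
      (hf.fixedPoint_unique hfix)

/-- The Sierpinski gasket `S`. -/
def gasket : Set Plane := Classical.choose existsUnique_attractor.exists

theorem gasket_spec : IsAttractor gasket := Classical.choose_spec existsUnique_attractor.exists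

theorem eq_gasket {K : Set Plane} (hK : IsAttractor K) : K = gasket :=
  existsUnique_attractor.unique hK gasket_spec

/-- The similarity dimension `s = log 3 / log 2`, i.e. the solution of `3 · (1/2)^s = 1`. -/
def dimS : ℝ := Real.log 3 / Real.log 2

/-! ### Geometric shift and points with dense shift orbit -/

/-- `wordMap i k = f_{i₀} ∘ ⋯ ∘ f_{i_{k-1}}`. -/
def wordMap (i : ℕ → Fin 3) : ℕ → Plane → Plane
  | 0 => id
  | k + 1 => wordMap i k ∘ simil (i k)

/-- `i` is a code of `x`: `x` lies in all the cylinders `f_{i₀ ⋯ i_{k-1}}(S)`, whose intersection is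
the single point `π(i)`. Thus `IsCode i x` says `π(i) = x`. -/
def IsCode (i : ℕ → Fin 3) (x : Plane) : Prop := ∀ k, x ∈ wordMap i k '' gasket

/-- The geometric shift `T = π ∘ σ ∘ π⁻¹`, a correspondence, acting on sets of points. -/
def geomShift (A : Set Plane) : Set Plane :=
  {z | ∃ x ∈ A, ∃ i : ℕ → Fin 3, IsCode i x ∧ IsCode (fun n => i (n + 1)) z}

/-- The set `Ŝ` of those points of `S` whose shift orbit `⋃ₖ Tᵏ(y)` is dense in `S`. -/
def denseOrbitPoints : Set Plane :=
  {y | y ∈ gasket ∧ gasket ⊆ closure (⋃ k : ℕ, geomShift^[k] {y})}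

/-! ### Feasible open sets and typical balls -/

/-- Feasible open sets: those of the (strong) open set condition. -/
def IsFeasible (O : Set Plane) : Prop :=
  IsOpen O ∧ (∀ i, simil i '' O ⊆ O) ∧
    (∀ i j, i ≠ j → Disjoint (simil i '' O) (simil j '' O)) ∧ (O ∩ gasket).Nonempty

/-- The closed ball `B(x,d)` is typical: centred in `S` and contained in a feasible open set. -/
def IsTypical (x : Plane) (d : ℝ) : Prop :=
  x ∈ gasket ∧ 0 < d ∧ ∃ O, IsFeasible O ∧ Metric.closedBall x d ⊆ O

/-! ### Metric measures

These are set functions with values in `[0,∞]`; they will be evaluated on compact sets only. -/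

/-- A countable family of closed balls `B(x,d)`, `d > 0`, encoded by the pairs `(x,d)`, with all
the diameters `2d` at most `δ`. -/
def IsFineFamily (δ : ℝ) (t : Set (Plane × ℝ)) : Prop :=
  t.Countable ∧ ∀ p ∈ t, 0 < p.2 ∧ 2 * p.2 ≤ δ

/-- The balls of the family `t` cover `A`. -/
def Covers (t : Set (Plane × ℝ)) (A : Set Plane) : Prop :=
  A ⊆ ⋃ p ∈ t, Metric.closedBall p.1 p.2

/-- The sum `∑ (2d)^s` over the balls of the family. -/
def diamSum (s : ℝ) (t : Set (Plane × ℝ)) : ℝ≥0∞ :=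
  ∑' p : t, ENNReal.ofReal ((2 * (p : Plane × ℝ).2) ^ s)

/-- The spherical Hausdorff measure (the limit as `δ → 0` is a supremum by monotonicity). -/
def sphericalHausdorff (s : ℝ) (A : Set Plane) : ℝ≥0∞ :=
  ⨆ (δ : ℝ) (_ : 0 < δ), ⨅ (t : Set (Plane × ℝ)) (_ : IsFineFamily δ t ∧ Covers t A), diamSum s t

/-- The premeasure `C₀ˢ`: coverings by closed balls centred in the set. -/
def centredPre (s : ℝ) (A : Set Plane) : ℝ≥0∞ :=
  ⨆ (δ : ℝ) (_ : 0 < δ), ⨅ (t : Set (Plane × ℝ))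
    (_ : IsFineFamily δ t ∧ (∀ p ∈ t, p.1 ∈ A) ∧ Covers t A), diamSum s t

/-- The centred Hausdorff measure `Cˢ`. -/
def centredHausdorff (s : ℝ) (A : Set Plane) : ℝ≥0∞ :=
  ⨆ (F : Set Plane) (_ : F ⊆ A ∧ IsClosed F), centredPre s F

/-- The premeasure `P₀ˢ`: packings by disjoint closed balls centred in the set (the limit as
`δ → 0` is an infimum by monotonicity). -/
def packingPre (s : ℝ) (A : Set Plane) : ℝ≥0∞ :=
  ⨅ (δ : ℝ) (_ : 0 < δ), ⨆ (t : Set (Plane × ℝ))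
    (_ : IsFineFamily δ t ∧ (∀ p ∈ t, p.1 ∈ A) ∧
      t.PairwiseDisjoint (fun p => Metric.closedBall p.1 p.2)), diamSum s t

/-- The packing measure `Pˢ`. -/
def packing (s : ℝ) (A : Set Plane) : ℝ≥0∞ :=
  ⨅ (F : ℕ → Set Plane) (_ : (∀ n, IsClosed (F n)) ∧ A ⊆ ⋃ n, F n), ∑' n, packingPre s (F n)

/-- The natural probability measure: the compactly supported Borel probability measure that is
fixed by the Markov operator with weights `rᵢˢ = (1/2)ˢ`. -/
def IsNaturalMeasure (μ : Measure Plane) : Prop :=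
  IsProbabilityMeasure μ ∧ (∃ K : Set Plane, IsCompact K ∧ μ Kᶜ = 0) ∧
    μ = ∑ i : Fin 3, ENNReal.ofReal ((1 / 2 : ℝ) ^ dimS) • μ.map (simil i)

/-- Restriction of a set function to `S`. -/
def restrictGasket (β : Set Plane → ℝ≥0∞) : Set Plane → ℝ≥0∞ := fun A => β (A ∩ gasket)

/-- The `s`-dimensional metric measures on `S`: the natural probability measure and the restrictions
to `S` of the Hausdorff, spherical Hausdorff, centred Hausdorff and packing measures. -/
def metricMeasures : Set (Set Plane → ℝ≥0∞) :=
  {α | (∃ μ : Measure Plane, IsNaturalMeasure μ ∧ α = fun A => μ A) ∨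
    α = restrictGasket (fun A => μH[dimS] A) ∨
    α = restrictGasket (sphericalHausdorff dimS) ∨
    α = restrictGasket (centredHausdorff dimS) ∨
    α = restrictGasket (packing dimS)}

/-! ### Densities and spectra -/

/-- The `s`-density `α(B(x,d)) / (2d)^s` of the closed ball `B(x,d)`, for `d > 0`. -/
def density (α : Set Plane → ℝ≥0∞) (x : Plane) (d : ℝ) : ℝ≥0∞ :=
  α (Metric.closedBall x d) / ENNReal.ofReal ((2 * d) ^ dimS)

/-- The lower density at `x`. -/
def lowerDensity (α : Set Plane → ℝ≥0∞) (x : Plane) : ℝ≥0∞ :=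
  liminf (fun d : ℝ => density α x d) (𝓝[>] 0)

/-- The upper density at `x`. -/
def upperDensity (α : Set Plane → ℝ≥0∞) (x : Plane) : ℝ≥0∞ :=
  limsup (fun d : ℝ => density α x d) (𝓝[>] 0)

/-- `Spec(α,A)`: all limits of densities of balls centred at a point of `A`, radii tending to `0`. -/
def densitySpectrum (α : Set Plane → ℝ≥0∞) (A : Set Plane) : Set ℝ≥0∞ :=
  {l | ∃ x ∈ A, ∃ d : ℕ → ℝ, (∀ k, 0 < d k) ∧ Tendsto d atTop (𝓝 0) ∧
    Tendsto (fun k => density α x (d k)) atTop (𝓝 l)}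

/-- `Im(θ_α^s, 𝓑)`: the densities of the typical balls. -/
def typicalDensities (α : Set Plane → ℝ≥0∞) : Set ℝ≥0∞ :=
  {l | ∃ x d, IsTypical x d ∧ l = density α x d}

end SierpinskiGasket

end

open SierpinskiGasket

noncomputable section

namespace SierpinskiGasket

/-! ### Barycentric coordinates -/

/-! The argument is carried out for a nonzero finite measure `ν` on the gasket that is fixed by the
Markov operator (`IsSelfSimilar`), and transferred to all the metric measures at the end.

Points and circles are `ν`-null, so `ν (B(x,d))` is continuous in `(x,d)`. A similitude `f_j`
preserves the density of a typical ball, because the other pieces of the gasket miss `f_j(O)` for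
every feasible `O` (`density_simil_of_isTypical`). Densities are also invariant under the homothety
of ratio `1/2` about a junction point of two pieces (`density_junction`). Together these two
invariances move every typical ball to one with radius in `[1/20, 1/10]` and centre in a compact set
away from the vertices, without changing its density. The densities of typical balls therefore form
a compact set, with a least element `a` and a greatest element `b`.

Almost every point has a dense shift orbit. Around such a point every typical density recurs at
arbitrarily small scales: a ball about a nearby orbit point has almost the prescribed density and is
carried back by similitudes (`typicalDensities_subset_densitySpectrum`). Conversely, small balls
about a point of a feasible set are typical. This identifies the spectra in (i), and the
intermediate value theorem at one such point gives the whole interval `[a, b]`.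

The endpoints come from density theorems. Small balls centred away from the vertices have densities
in `[a, b]`, while densities near `a` and near `b` recur at almost every point; Besicovitch
coverings then yield `b * C(S) = ν(S)` and `a * P(S) = ν(S)` (`mul_centredHausdorff_eq`,
`mul_packing_eq`).

For (ii), an open hexagon is feasible and contains every point of the gasket but the three vertices.
By symmetry only `z₀` remains, where the density is invariant under halving of radii up to `1`.
Comparing the radii `1/2` and `33/64` shows that neither interval is degenerate.

The transfer rests on a uniqueness principle (`IsScaling.mul_closedBall`): a finite, monotone,
subadditive set function that each similitude divides by at least `3` is a multiple of `ν` on balls.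
The same principle gives the zero-one law behind dense orbits and the symmetry of the vertices. -/

/-- The barycentric coordinates with respect to the three vertices. -/
def bary (i : Fin 3) (x : Plane) : ℝ :=
  ![1 - x 0 - x 1 / Real.sqrt 3, x 0 - x 1 / Real.sqrt 3, 2 * (x 1 / Real.sqrt 3)] i

theorem continuous_bary (i : Fin 3) : Continuous (bary i) := by
  have h (y : Plane) : bary i y = _ := bary.eq_1 i y
  simp only [funext h]
  fin_cases i <;> simp <;> fun_prop

theorem sum_bary (x : Plane) : bary 0 x + bary 1 x + bary 2 x = 1 := by
  simp [bary]; ring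

theorem bary_simil (i j : Fin 3) (x : Plane) :
    bary j (simil i x) = bary j x / 2 + if i = j then 1 / 2 else 0 := by
  have h : Real.sqrt 3 ≠ 0 := by positivity
  fin_cases i <;> fin_cases j <;> simp [bary, simil, vertex] <;> field_simp <;> ring

theorem bary_vertex (i j : Fin 3) : bary j (vertex i) = if i = j then 1 else 0 := by
  have h : Real.sqrt 3 ≠ 0 := by positivity
  fin_cases i <;> fin_cases j <;> simp [bary, vertex] <;> field_simp <;> ring

/-- Barycentric coordinates map the plane onto the plane of coordinate sum `1` in `ℝ³`, multiplying
distances by `√2` since the triangle has side `1`. -/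
theorem dist_sq_eq (x y : Plane) :
    dist x y ^ 2 = ((bary 0 x - bary 0 y) ^ 2 + (bary 1 x - bary 1 y) ^ 2
      + (bary 2 x - bary 2 y) ^ 2) / 2 := by
  have h3 : Real.sqrt 3 ^ 2 = 3 := Real.sq_sqrt (by norm_num)
  have h : Real.sqrt 3 ≠ 0 := by positivity
  rw [EuclideanSpace.dist_eq, Real.sq_sqrt (by positivity)]
  simp only [Fin.sum_univ_two, Real.dist_eq, sq_abs, bary]
  simp
  have e (t : ℝ) : t ^ 2 = 3 * (t / Real.sqrt 3) ^ 2 := by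
    rw [div_pow, h3]; ring
  rw [e (x 1 - y 1)]
  ring

theorem ext_bary {x y : Plane} (h : ∀ i, bary i x = bary i y) : x = y := by
  have := dist_sq_eq x y
  rw [h 0, h 1, h 2] at this
  simpa using this

theorem sq_bary_sub_le (x y : Plane) (i j : Fin 3) :
    ((bary i x - bary j x) - (bary i y - bary j y)) ^ 2 ≤ (2 * dist x y) ^ 2 := by
  have key (c : Fin 3 → ℝ) : (c i - c j) ^ 2 ≤ 2 ^ 2 * ((c 0 ^ 2 + c 1 ^ 2 + c 2 ^ 2) / 2) := by
    fin_cases i <;> fin_cases j <;> simp <;>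
      nlinarith [sq_nonneg (c 0 + c 1), sq_nonneg (c 0 + c 2), sq_nonneg (c 1 + c 2),
        sq_nonneg (c 0), sq_nonneg (c 1), sq_nonneg (c 2)]
  rw [mul_pow, dist_sq_eq, sub_sub_sub_comm]
  exact key fun k => bary k x - bary k y

/-- A barycentric coordinate is the signed distance to a side divided by the altitude `√3/2`. -/
theorem sq_bary_sub_self_le (x y : Plane) (k : Fin 3) :
    3 / 4 * (bary k x - bary k y) ^ 2 ≤ dist x y ^ 2 := by
  have key (c : Fin 3 → ℝ) (hc : c 0 + c 1 + c 2 = 0) :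
      3 / 4 * c k ^ 2 ≤ (c 0 ^ 2 + c 1 ^ 2 + c 2 ^ 2) / 2 := by
    have e : c 2 = - c 0 - c 1 := by linarith
    fin_cases k <;> simp [e] <;>
      nlinarith [sq_nonneg (c 0 + 2 * c 1), sq_nonneg (2 * c 0 + c 1), sq_nonneg (c 0 - c 1)]
  rw [dist_sq_eq]
  exact key (fun k => bary k x - bary k y) (by linarith [sum_bary x, sum_bary y])

theorem abs_bary_sub_le (x y : Plane) (i j : Fin 3) :
    |(bary i x - bary j x) - (bary i y - bary j y)| ≤ 2 * dist x y :=
  abs_le_of_sq_le_sq (sq_bary_sub_le x y i j) (by positivity)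

/-! ### The similitudes and the gasket -/

theorem dist_simil (i : Fin 3) (x y : Plane) : dist (simil i x) (simil i y) = dist x y / 2 := by
  unfold simil
  rw [dist_add_right, dist_smul₀]
  norm_num
  ring

theorem injective_simil (i : Fin 3) : Function.Injective (simil i) := by
  intro x y h
  have := dist_simil i x y
  rw [h, dist_self] at this
  exact dist_eq_zero.1 (by linarith)

theorem preimage_simil_closedBall (i : Fin 3) (x : Plane) (d : ℝ) :
    simil i ⁻¹' Metric.closedBall (simil i x) (d / 2) = Metric.closedBall x d := by
  ext y
  simp only [mem_preimage, Metric.mem_closedBall, dist_simil]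
  constructor <;> intro h <;> linarith

theorem image_simil_eq_preimage (i : Fin 3) (A : Set Plane) :
    simil i '' A = (fun y => (2 : ℝ) • y - vertex i) ⁻¹' A := by
  refine congrFun (image_eq_preimage_of_inverse ?_ ?_) A
  · intro x; simp only [simil, smul_add, smul_smul]; norm_num
  · intro x; simp only [simil, smul_sub, smul_smul]; norm_num

theorem measurableSet_image_simil (i : Fin 3) {A : Set Plane} (hA : MeasurableSet A) :
    MeasurableSet (simil i '' A) := by
  rw [image_simil_eq_preimage]
  exact (by fun_prop : Continuous fun y : Plane => (2 : ℝ) • y - vertex i).measurable hA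

theorem isOpen_image_simil (i : Fin 3) {A : Set Plane} (hA : IsOpen A) :
    IsOpen (simil i '' A) := by
  rw [image_simil_eq_preimage]
  exact hA.preimage (by fun_prop)

theorem simil_vertex (i : Fin 3) : simil i (vertex i) = vertex i := by
  simp only [simil, ← add_smul]; norm_num

theorem isCompact_gasket : IsCompact gasket := gasket_spec.2.1

theorem isClosed_gasket : IsClosed gasket := isCompact_gasket.isClosed

theorem gasket_nonempty : gasket.Nonempty := gasket_spec.1

theorem simil_mem_gasket (i : Fin 3) {x : Plane} (hx : x ∈ gasket) : simil i x ∈ gasket := by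
  rw [gasket_spec.2.2]
  exact mem_iUnion.2 ⟨i, mem_image_of_mem _ hx⟩

theorem exists_simil_eq {x : Plane} (hx : x ∈ gasket) : ∃ i, ∃ y ∈ gasket, simil i y = x := by
  rw [gasket_spec.2.2] at hx
  exact mem_iUnion.1 hx

/-- If the minimum `m` over the gasket is attained at `f_j(y)`, then `m` is at least half the value
at `y`, hence at least `m/2`. -/
theorem bary_nonneg {x : Plane} (hx : x ∈ gasket) (i : Fin 3) : 0 ≤ bary i x := by
  obtain ⟨m, hm, hmin⟩ := isCompact_gasket.exists_isMinOn gasket_nonempty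
    (continuous_bary i).continuousOn
  obtain ⟨j, y, hy, rfl⟩ := exists_simil_eq hm
  have h1 : bary i (simil j y) ≤ bary i y := hmin hy
  have h2 : bary i (simil j y) ≤ bary i x := hmin hx
  rw [bary_simil] at h1 h2
  split_ifs at h1 h2 <;> linarith

theorem bary_le_one {x : Plane} (hx : x ∈ gasket) (i : Fin 3) : bary i x ≤ 1 := by
  have h := sum_bary x
  have h0 := bary_nonneg hx 0
  have h1 := bary_nonneg hx 1
  have h2 := bary_nonneg hx 2
  fin_cases i <;> simp <;> linarith

theorem vertex_mem_gasket (i : Fin 3) : vertex i ∈ gasket := by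
  obtain ⟨x, hx⟩ := gasket_nonempty
  have h : ∀ n, (simil i)^[n] x ∈ gasket := by
    intro n
    induction n with
    | zero => exact hx
    | succ n ih => rw [Function.iterate_succ_apply']; exact simil_mem_gasket i ih
  have hd : ∀ n, dist ((simil i)^[n] x) (vertex i) = dist x (vertex i) * (1 / 2) ^ n := by
    intro n
    induction n with
    | zero => simp
    | succ n ih =>
      rw [Function.iterate_succ_apply']
      nth_rw 1 [← simil_vertex i]
      rw [dist_simil, ih]; ring
  refine isClosed_gasket.mem_of_tendsto (f := fun n => (simil i)^[n] x) (b := atTop) ?_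
    (Eventually.of_forall h)
  rw [tendsto_iff_dist_tendsto_zero]
  simp_rw [hd]
  simpa using (tendsto_pow_atTop_nhds_zero_of_lt_one (by norm_num : (0 : ℝ) ≤ 1 / 2)
    (by norm_num)).const_mul (dist x (vertex i))

theorem dist_le_one {x y : Plane} (hx : x ∈ gasket) (hy : y ∈ gasket) : dist x y ≤ 1 := by
  have h := dist_sq_eq x y
  have hx0 := bary_nonneg hx 0
  have hx1 := bary_nonneg hx 1
  have hx2 := bary_nonneg hx 2
  have hy0 := bary_nonneg hy 0
  have hy1 := bary_nonneg hy 1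
  have hy2 := bary_nonneg hy 2
  have hxs := sum_bary x
  have hys := sum_bary y
  refine le_of_sq_le_sq (b := 1) ?_ (by norm_num)
  rw [h]
  obtain hx' : bary 0 x = 1 - bary 1 x - bary 2 x := by linarith
  obtain hy' : bary 0 y = 1 - bary 1 y - bary 2 y := by linarith
  have q1 : bary 0 x ^ 2 + bary 1 x ^ 2 + bary 2 x ^ 2 ≤ 1 := by
    nlinarith [mul_nonneg hx0 hx1, mul_nonneg hx0 hx2, mul_nonneg hx1 hx2]
  have q2 : bary 0 y ^ 2 + bary 1 y ^ 2 + bary 2 y ^ 2 ≤ 1 := by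
    nlinarith [mul_nonneg hy0 hy1, mul_nonneg hy0 hy2, mul_nonneg hy1 hy2]
  nlinarith [mul_nonneg hx0 hy0, mul_nonneg hx1 hy1, mul_nonneg hx2 hy2]

theorem bary_eq_one_imp {x : Plane} (hx : x ∈ gasket) {i : Fin 3} (h : bary i x = 1) :
    x = vertex i := by
  have h0 := bary_nonneg hx 0
  have h1 := bary_nonneg hx 1
  have h2 := bary_nonneg hx 2
  have hs := sum_bary x
  apply ext_bary
  intro j
  rw [bary_vertex]
  fin_cases i <;> fin_cases j <;> simp at h ⊢ <;> linarith

/-- Two pieces of the gasket meet at most in a vertex of each. -/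
theorem eq_vertex_of_simil_eq {i j : Fin 3} (hij : i ≠ j) {x y : Plane} (hx : x ∈ gasket)
    (hy : y ∈ gasket) (h : simil i x = simil j y) : y = vertex i := by
  apply bary_eq_one_imp hy
  have h1 := congrArg (bary i) h
  rw [bary_simil, bary_simil, if_pos rfl, if_neg hij.symm] at h1
  linarith [bary_nonneg hx i, bary_le_one hy i]

/-- A piece of the gasket meets the ball of radius `1/2` about a vertex it does not contain at most
in one point. -/
theorem eq_vertex_of_dist_simil_le {i l : Fin 3} (hil : i ≠ l) {y : Plane} (hy : y ∈ gasket)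
    (h : dist (simil i y) (vertex l) ≤ 1 / 2) : y = vertex l := by
  have h2 := dist_sq_eq (simil i y) (vertex l)
  have h3 : dist (simil i y) (vertex l) ^ 2 ≤ 1 / 4 := by
    nlinarith [dist_nonneg (x := simil i y) (y := vertex l)]
  have h0 := bary_nonneg hy 0
  have h1 := bary_nonneg hy 1
  have h2' := bary_nonneg hy 2
  have hs := sum_bary y
  apply bary_eq_one_imp hy
  rw [h2] at h3
  simp only [bary_simil, bary_vertex] at h3
  apply le_antisymm (bary_le_one hy l)
  fin_cases i <;> fin_cases l <;> simp at h3 hil ⊢ <;> nlinarith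

/-- The third piece of the gasket is away from the junction point of two pieces. -/
theorem lt_dist_junction {j l k : Fin 3} (hkj : k ≠ j) (hkl : k ≠ l) {y : Plane}
    (hy : y ∈ gasket) : 2 / 5 < dist (simil k y) (simil j (vertex l)) := by
  have h := sq_bary_sub_self_le (simil k y) (simil j (vertex l)) k
  simp only [bary_simil, bary_vertex, if_neg hkj.symm, if_neg hkl.symm, if_true] at h
  -- Coordinate `k` vanishes at the junction and is at least `1/2` on piece `k`, so the distance is
  -- at least `√3/4 > 2/5`.
  refine lt_of_pow_lt_pow_left₀ 2 dist_nonneg ?_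
  nlinarith [bary_nonneg hy k]

theorem exists_third {j l : Fin 3} (hjl : j ≠ l) :
    ∃ k, k ≠ j ∧ k ≠ l ∧ ∀ f : Fin 3 → ℝ≥0∞, ∑ i, f i = f j + f l + f k := by
  fin_cases j <;> fin_cases l <;> simp at hjl
  · exact ⟨2, by decide, by decide, fun f => by simp [Fin.sum_univ_three]⟩
  · exact ⟨1, by decide, by decide, fun f => by simp [Fin.sum_univ_three]; ring⟩
  · exact ⟨2, by decide, by decide, fun f => by simp [Fin.sum_univ_three]; ring⟩
  · exact ⟨0, by decide, by decide, fun f => by simp [Fin.sum_univ_three]; ring⟩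
  · exact ⟨1, by decide, by decide, fun f => by simp [Fin.sum_univ_three]; ring⟩
  · exact ⟨0, by decide, by decide, fun f => by simp [Fin.sum_univ_three]; ring⟩

/-! ### A feasible hexagon -/

/-- An open hexagon that contains the gasket except for its three vertices. -/
def hexagon : Set Plane := {x | ∀ i j, bary i x - bary j x < 1}

theorem isOpen_hexagon : IsOpen hexagon := by
  simp only [hexagon, ofPred_forall]
  exact isOpen_iInter_of_finite fun i => isOpen_iInter_of_finite fun j =>
    isOpen_lt ((continuous_bary i).sub (continuous_bary j)) continuous_const

theorem mem_hexagon_of_mem_gasket {x : Plane} (hx : x ∈ gasket) (h : ∀ i, x ≠ vertex i) :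
    x ∈ hexagon := by
  intro i j
  have h1 := bary_nonneg hx j
  have h2 := bary_le_one hx i
  rcases h2.lt_or_eq with h2 | h2
  · linarith
  · exact absurd (bary_eq_one_imp hx h2) (h i)

theorem bary_simil_simil_sub_le {x : Plane} (hx : x ∈ gasket) {j l : Fin 3} (hjl : j ≠ l)
    (a b : Fin 3) : bary a (simil j (simil l x)) - bary b (simil j (simil l x)) ≤ 3 / 4 := by
  simp only [bary_simil]
  have h1 := bary_nonneg hx b
  have h2 := bary_le_one hx a
  split_ifs <;> first | linarith | exact absurd (by simp_all) hjl

/-- On `f_j(f_l(S))` with `j ≠ l` the coordinate differences are at most `3/4`, leaving room `1/4`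
below the bound of the hexagon. These differences are `2`-Lipschitz, whence `1/8`. -/
theorem closedBall_subset_hexagon {x : Plane} (hx : x ∈ gasket) {j l : Fin 3} (hjl : j ≠ l)
    {r : ℝ} (hr : r < 1 / 8) : Metric.closedBall (simil j (simil l x)) r ⊆ hexagon := by
  intro y hy a b
  have h1 := bary_simil_simil_sub_le hx hjl a b
  have h2 := abs_bary_sub_le y (simil j (simil l x)) a b
  have h3 := (abs_le.1 h2).2
  have h4 : dist y (simil j (simil l x)) ≤ r := hy
  linarith

theorem isFeasible_hexagon : IsFeasible hexagon := by
  refine ⟨isOpen_hexagon, ?_, ?_, ?_⟩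
  · rintro i _ ⟨x, hx, rfl⟩ a b
    have h1 := hx a b
    have h2 := hx b a
    have h3 := hx i b
    have h4 := hx i a
    simp only [bary_simil]
    split_ifs with h5 h6 h6
    · linarith
    · subst h5; linarith [hx b i]
    · linarith
    · linarith
  · intro i j hij
    rw [Set.disjoint_left]
    rintro _ ⟨x, hx, rfl⟩ ⟨y, hy, hxy⟩
    have h1 := congrArg (bary i) hxy
    have h2 := congrArg (bary j) hxy
    simp only [bary_simil, if_pos, if_neg hij, if_neg hij.symm] at h1 h2
    linarith [hx j i, hy i j]
  · refine ⟨simil 0 (simil 1 (vertex 0)), closedBall_subset_hexagon (j := 0) (l := 1)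
      (vertex_mem_gasket 0) (by decide) (r := 0) (by norm_num) (by simp), ?_⟩
    exact simil_mem_gasket _ (simil_mem_gasket _ (vertex_mem_gasket 0))

theorem isTypical_simil_simil {x : Plane} (hx : x ∈ gasket) {j l : Fin 3} (hjl : j ≠ l)
    {r : ℝ} (h0 : 0 < r) (hr : r < 1 / 8) : IsTypical (simil j (simil l x)) r :=
  ⟨simil_mem_gasket _ (simil_mem_gasket _ hx), h0, hexagon, isFeasible_hexagon,
    closedBall_subset_hexagon hx hjl hr⟩

/-! ### Feasible open sets -/

/-- Since `f_i(O) ⊆ O`, applying `f_i` halves any bound on the distance to `O`; every point of the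
gasket is an image of another one, so the bound can be halved indefinitely. -/
theorem gasket_subset_closure_of_feasible {O : Set Plane} (hO : IsFeasible O) :
    gasket ⊆ closure O := by
  obtain ⟨x₀, hx₀, hx₀'⟩ := hO.2.2.2
  have key : ∀ n : ℕ, ∀ y ∈ gasket, Metric.infDist y O ≤ (1 / 2) ^ n := by
    intro n
    induction n with
    | zero =>
      intro y hy
      simpa using (Metric.infDist_le_dist_of_mem hx₀).trans (dist_le_one hy hx₀')
    | succ n ih =>
      intro y hy
      obtain ⟨i, z, hz, rfl⟩ := exists_simil_eq hy
      refine le_of_forall_pos_le_add fun ε hε => ?_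
      obtain ⟨w, hw, hzw⟩ := (Metric.infDist_lt_iff ⟨x₀, hx₀⟩).1
        (lt_of_le_of_lt (ih z hz) (lt_add_of_pos_right _ hε))
      have := Metric.infDist_le_dist_of_mem (x := simil i z) (hO.2.1 i (mem_image_of_mem _ hw))
      rw [dist_simil] at this
      rw [pow_succ]
      linarith
  intro y hy
  rw [Metric.mem_closure_iff_infDist_zero ⟨x₀, hx₀⟩]
  refine le_antisymm ?_ Metric.infDist_nonneg
  exact ge_of_tendsto' (tendsto_pow_atTop_nhds_zero_of_lt_one (by norm_num : (0 : ℝ) ≤ 1 / 2)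
    (by norm_num)) fun n => key n y hy

/-- The open set `f_j(O)` is disjoint from `f_i(O)`, hence from its closure, and that closure
contains `f_i(S)`. -/
theorem simil_notMem_of_feasible {O : Set Plane} (hO : IsFeasible O) {i j : Fin 3} (hij : i ≠ j)
    {y : Plane} (hy : y ∈ gasket) : simil i y ∉ simil j '' O := by
  intro h
  have hd : Disjoint (simil j '' O) (closure (simil i '' O)) :=
    (hO.2.2.1 j i hij.symm).closure_right (isOpen_image_simil j hO.1)
  refine Set.disjoint_left.1 hd h ?_
  exact image_closure_subset_closure_image (continuous_simil i)
    (mem_image_of_mem _ (gasket_subset_closure_of_feasible hO hy))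

theorem closedBall_simil_subset (i : Fin 3) {x : Plane} {d : ℝ} {O : Set Plane}
    (h : Metric.closedBall x d ⊆ O) : Metric.closedBall (simil i x) (d / 2) ⊆ simil i '' O := by
  have hs : Function.Surjective (simil i) := by
    intro y
    refine ⟨(2 : ℝ) • y - vertex i, ?_⟩
    simp only [simil, smul_sub, smul_smul]; norm_num
  rw [← image_preimage_eq (Metric.closedBall (simil i x) (d / 2)) hs, preimage_simil_closedBall]
  exact image_mono h

theorem IsTypical.simil {x : Plane} {d : ℝ} (h : IsTypical x d) (i : Fin 3) :
    IsTypical (simil i x) (d / 2) := by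
  obtain ⟨hx, hd, O, hO, hB⟩ := h
  exact ⟨simil_mem_gasket i hx, by positivity, O, hO,
    (closedBall_simil_subset i hB).trans (hO.2.1 i)⟩

/-! ### Powers of diameters -/

/-- The power `(2d)^s` as an extended nonnegative real. -/
def diamPow (d : ℝ) : ℝ≥0∞ := ENNReal.ofReal ((2 * d) ^ dimS)

theorem two_rpow_dimS : (2 : ℝ) ^ dimS = 3 :=
  Real.rpow_logb (by norm_num) (by norm_num) (by norm_num)

theorem one_le_dimS : 1 ≤ dimS := by
  rw [dimS, le_div_iff₀ (Real.log_pos (by norm_num)), one_mul]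
  exact Real.log_le_log (by norm_num) (by norm_num)

theorem half_rpow_dimS : (1 / 2 : ℝ) ^ dimS = 1 / 3 := by
  rw [Real.div_rpow (by norm_num) (by norm_num), two_rpow_dimS, Real.one_rpow]

theorem ofReal_half_rpow_dimS : ENNReal.ofReal ((1 / 2 : ℝ) ^ dimS) = 3⁻¹ := by
  rw [half_rpow_dimS, one_div, ENNReal.ofReal_inv_of_pos (by norm_num)]
  norm_num

theorem diamPow_half (d : ℝ) (hd : 0 < d) : diamPow (d / 2) = 3⁻¹ * diamPow d := by
  rw [diamPow, diamPow, ← ofReal_half_rpow_dimS, ← ENNReal.ofReal_mul (by positivity),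
    ← Real.mul_rpow (by norm_num) (by positivity)]
  congr 2
  ring

theorem diamPow_ne_zero {d : ℝ} (hd : 0 < d) : diamPow d ≠ 0 := by
  rw [diamPow, Ne, ENNReal.ofReal_eq_zero, not_le]
  positivity

theorem diamPow_ne_top (d : ℝ) : diamPow d ≠ ⊤ := ENNReal.ofReal_ne_top

theorem continuous_diamPow : Continuous diamPow := by
  refine ENNReal.continuous_ofReal.comp ((continuous_const.mul continuous_id).rpow_const ?_)
  intro x
  exact Or.inr (zero_le_one.trans one_le_dimS)

theorem diamPow_mono {a b : ℝ} (ha : 0 ≤ a) (h : a ≤ b) : diamPow a ≤ diamPow b :=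
  ENNReal.ofReal_le_ofReal (Real.rpow_le_rpow (by positivity) (by linarith)
    (zero_le_one.trans one_le_dimS))

theorem density_def (α : Set Plane → ℝ≥0∞) (x : Plane) (d : ℝ) :
    density α x d = α (Metric.closedBall x d) / diamPow d := rfl

theorem density_half {α : Set Plane → ℝ≥0∞} {x y : Plane} {d : ℝ} (hd : 0 < d)
    (h : α (Metric.closedBall x (d / 2)) = 3⁻¹ * α (Metric.closedBall y d)) :
    density α x (d / 2) = density α y d := by
  rw [density_def, density_def, h, diamPow_half d hd]
  exact ENNReal.mul_div_mul_left _ _ (by simp) (by simp)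

theorem density_half_ge {α : Set Plane → ℝ≥0∞} {x y : Plane} {d : ℝ} (hd : 0 < d)
    (h : 3⁻¹ * α (Metric.closedBall y d) ≤ α (Metric.closedBall x (d / 2))) :
    density α y d ≤ density α x (d / 2) := by
  rw [density_def, density_def, diamPow_half d hd,
    ← ENNReal.mul_div_mul_left (α (Metric.closedBall y d)) _ (c := 3⁻¹) (by simp) (by simp)]
  gcongr

/-! ### Self-similar measures -/

/-- The nonzero finite measures on the gasket that are fixed by the Markov operator. -/
structure IsSelfSimilar (ν : Measure Plane) : Prop where
  isFiniteMeasure : IsFiniteMeasure ν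
  measure_compl : ν gasketᶜ = 0
  measure_pos : 0 < ν gasket
  eq_sum : ν = ∑ i : Fin 3, (3⁻¹ : ℝ≥0∞) • ν.map (simil i)

namespace IsSelfSimilar

variable {ν : Measure Plane}

theorem apply (hν : IsSelfSimilar ν) {A : Set Plane} (hA : MeasurableSet A) :
    ν A = 3⁻¹ * ∑ i, ν (simil i ⁻¹' A) := by
  conv_lhs => rw [hν.eq_sum]
  rw [Measure.finsetSum_apply, Finset.mul_sum]
  refine Finset.sum_congr rfl fun i _ => ?_
  rw [Measure.smul_apply, Measure.map_apply (continuous_simil i).measurable hA, smul_eq_mul]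

theorem measure_inter (hν : IsSelfSimilar ν) (A : Set Plane) : ν (A ∩ gasket) = ν A := by
  refine le_antisymm (measure_mono inter_subset_left) ?_
  calc ν A ≤ ν (A ∩ gasket) + ν (A \ gasket) := measure_le_inter_add_sdiff _ _ _
    _ ≤ ν (A ∩ gasket) + ν gasketᶜ := by gcongr; exact sdiff_subset_compl A gasket
    _ = _ := by rw [hν.measure_compl, add_zero]

theorem le_measure_gasket (hν : IsSelfSimilar ν) (A : Set Plane) : ν A ≤ ν gasket := by
  rw [← hν.measure_inter]; exact measure_mono inter_subset_right

theorem measure_ne_top (hν : IsSelfSimilar ν) (A : Set Plane) : ν A ≠ ⊤ :=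
  haveI := hν.isFiniteMeasure
  MeasureTheory.measure_ne_top ν A

theorem inv_three_mul_le (hν : IsSelfSimilar ν) {A : Set Plane} (hA : MeasurableSet A)
    (i : Fin 3) : 3⁻¹ * ν (simil i ⁻¹' A) ≤ ν A := by
  rw [hν.apply hA]
  gcongr
  exact Finset.single_le_sum (f := fun i => ν (simil i ⁻¹' A)) (fun _ _ => zero_le)
    (Finset.mem_univ i)

/-! ### Null sets: points and circles -/

/-- If a family of almost disjoint sets of which one has positive measure is permuted by the inverse
similitudes, then those of maximal measure form a finite subfamily with the same property. -/
theorem exists_finite_invariant (hν : IsSelfSimilar ν) {ι : Type*} (As : ι → Set Plane)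
    (hm : ∀ a, MeasurableSet (As a)) (hd : Pairwise (Function.onFun (AEDisjoint ν) As)) (g : Fin 3 → ι → ι)
    (hg : ∀ i a, simil i ⁻¹' As a = As (g i a)) {a₀ : ι} (ha₀ : ν (As a₀) ≠ 0) :
    ∃ M : Set ι, M.Finite ∧ M.Nonempty ∧ ∀ i, ∀ a ∈ M, g i a ∈ M := by
  have hfin : {a | ν (As a₀) ≤ ν (As a)}.Finite :=
    Measure.finite_const_le_meas_of_disjoint_iUnion₀ ν (pos_iff_ne_zero.2 ha₀)
      (fun a => (hm a).nullMeasurableSet) hd (hν.measure_ne_top _)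
  obtain ⟨b, hb, hbmax⟩ := hfin.exists_maximalFor (fun a => ν (As a)) _ ⟨a₀, mem_ofPred.2 le_rfl⟩
  have hmax : ∀ a, ν (As a) ≤ ν (As b) := by
    intro a
    by_contra! h
    exact absurd (hbmax (mem_ofPred.2 (le_trans hb h.le)) h.le) (not_le.2 h)
  refine ⟨{a | ν (As a) = ν (As b)}, hfin.subset fun a ha => ?_, ⟨b, rfl⟩, fun i a ha => ?_⟩
  · exact le_of_le_of_eq hb (Eq.symm ha)
  · have h1 := hν.apply (hm a)
    simp only [hg] at h1
    refine le_antisymm (hmax _) ?_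
    by_contra! h
    rw [ha] at h1
    have h2 := congrArg ENNReal.toReal h1
    rw [ENNReal.toReal_mul, ENNReal.toReal_sum fun i _ => hν.measure_ne_top _] at h2
    have h3 : ∑ i, (ν (As (g i a))).toReal < ∑ _i : Fin 3, (ν (As b)).toReal :=
      Finset.sum_lt_sum (fun i _ => ENNReal.toReal_mono (hν.measure_ne_top _) (hmax _))
        ⟨i, Finset.mem_univ i, (ENNReal.toReal_lt_toReal (hν.measure_ne_top _)
          (hν.measure_ne_top _)).2 h⟩
    simp at h2 h3
    linarith

theorem measure_singleton (hν : IsSelfSimilar ν) (x : Plane) : ν {x} = 0 := by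
  by_contra h
  obtain ⟨M, hfin, hne, hM⟩ := hν.exists_finite_invariant (fun x : Plane => {x})
    (fun x => measurableSet_singleton x)
    (fun a b hab => (disjoint_singleton.2 hab).aedisjoint)
    (fun i x => (2 : ℝ) • x - vertex i) (fun i x => by
      ext y
      simp only [mem_preimage, mem_singleton_iff, simil]
      constructor
      · rintro rfl; simp only [smul_add, smul_smul]; norm_num
      · rintro rfl; simp only [smul_sub, smul_smul]; norm_num) h
  have hb (i : Fin 3) (x : Plane) : bary 0 ((2 : ℝ) • x - vertex i)
      = 2 * bary 0 x - if i = 0 then 1 else 0 := by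
    have h1 : simil i ((2 : ℝ) • x - vertex i) = x := by
      simp only [simil, smul_sub, smul_smul]; norm_num
    have h2 := bary_simil i 0 ((2 : ℝ) • x - vertex i)
    rw [h1] at h2
    split_ifs at h2 ⊢ <;> linarith
  -- The inverse of `f₁` doubles coordinate `0`, so on the finite invariant set this coordinate must
  -- vanish; the inverse of `f₀` would then give it the value `-1`.
  obtain ⟨m, hm, hmax⟩ := hfin.exists_maximalFor (fun x => |bary 0 x|) _ hne
  have h0 : ∀ x ∈ M, bary 0 x = 0 := by
    have h1 : |bary 0 m| = 0 := by
      by_contra h1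
      have h2 : 0 < |bary 0 m| := lt_of_le_of_ne (abs_nonneg _) (Ne.symm h1)
      have h3 := hb 1 m
      rw [if_neg (by decide), sub_zero] at h3
      have h4 := hmax (hM 1 m hm) (by simp only [h3, abs_mul, abs_two]; linarith)
      simp only [h3, abs_mul, abs_two] at h4
      linarith
    intro x hx
    have h2 : |bary 0 x| ≤ |bary 0 m| := by
      by_contra! h3
      exact absurd (hmax hx h3.le) (not_le.2 h3)
    exact abs_eq_zero.1 (le_antisymm (h2.trans_eq h1) (abs_nonneg _))
  have h1 := h0 _ (hM 0 m hm)
  rw [hb, h0 m hm] at h1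
  simp at h1

theorem measure_eq_zero_of_inter_subset (hν : IsSelfSimilar ν) {A : Set Plane} {p : Plane}
    (h : ∀ x ∈ A, x ∈ gasket → x = p) : ν A = 0 := by
  rw [← hν.measure_inter]
  exact measure_mono_null (fun x hx => h x hx.1 hx.2) (hν.measure_singleton p)

theorem measure_eq_zero_of_disjoint (hν : IsSelfSimilar ν) {A : Set Plane}
    (h : ∀ x ∈ gasket, x ∉ A) : ν A = 0 :=
  hν.measure_eq_zero_of_inter_subset (p := 0) fun x hx hx' => absurd hx (h x hx')

theorem finite_sphere_inter {c₁ c₂ : Plane} {r₁ r₂ : ℝ} (h : (c₁, r₁) ≠ (c₂, r₂)) :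
    (Metric.sphere c₁ r₁ ∩ Metric.sphere c₂ r₂).Finite := by
  by_cases hc : c₁ = c₂
  · subst hc
    have hr : r₁ ≠ r₂ := fun hr => h (by rw [hr])
    convert Set.finite_empty
    rw [eq_empty_iff_forall_notMem]
    rintro x ⟨h1, h2⟩
    exact hr (h1.symm.trans h2)
  · by_cases hs : (Metric.sphere c₁ r₁ ∩ Metric.sphere c₂ r₂).Subsingleton
    · exact hs.finite
    · obtain ⟨p₁, h₁, p₂, h₂, hp⟩ := not_subsingleton_iff.1 hs
      refine (Set.toFinite {p₁, p₂}).subset fun p hp' => ?_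
      exact EuclideanGeometry.eq_of_dist_eq_of_dist_eq_of_finrank_eq_two
        (by simp : Module.finrank ℝ Plane = 2) hc hp h₁.1 h₂.1 hp'.1 h₁.2 h₂.2 hp'.2

/-- Distinct circles meet in finitely many points, so they form an almost disjoint family. The
inverse similitudes double radii, which no finite nonempty invariant subfamily allows. -/
theorem measure_sphere (hν : IsSelfSimilar ν) (x : Plane) {r : ℝ} (hr : 0 < r) :
    ν (Metric.sphere x r) = 0 := by
  have : NullSingletonClass ν := ⟨hν.measure_singleton⟩
  by_contra h
  obtain ⟨M, hfin, hne, hM⟩ := hν.exists_finite_invariant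
    (fun p : Plane × Ioi (0 : ℝ) => Metric.sphere p.1 (p.2 : ℝ))
    (fun p => Metric.isClosed_sphere.measurableSet)
    (fun a b hab => (finite_sphere_inter (fun he => hab (by
      rw [Prod.ext_iff] at he ⊢; exact ⟨he.1, Subtype.ext he.2⟩))).measure_zero ν)
    (fun i p => ((2 : ℝ) • p.1 - vertex i, ⟨2 * (p.2 : ℝ), by
      have : 0 < (p.2 : ℝ) := p.2.2
      exact mem_Ioi.2 (by positivity)⟩)) (fun i p => by
      ext y
      have h1 : simil i ((2 : ℝ) • p.1 - vertex i) = p.1 := by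
        simp only [simil, smul_sub, smul_smul]; norm_num
      have h2 := dist_simil i y ((2 : ℝ) • p.1 - vertex i)
      rw [h1] at h2
      simp only [mem_preimage, Metric.mem_sphere, h2]
      constructor <;> intro h <;> linarith) (a₀ := (x, ⟨r, hr⟩)) h
  obtain ⟨m, hm, hmax⟩ := hfin.exists_maximalFor (fun p => (p.2 : ℝ)) _ hne
  have h0 : 0 < (m.2 : ℝ) := m.2.2
  have h1 := hmax (hM 0 m hm) (by simp only; linarith)
  simp only at h1
  linarith

/-! ### Continuity of densities in centre and radius -/

theorem continuousAt_measure_closedBall (hν : IsSelfSimilar ν) (x : Plane) {d : ℝ} (hd : 0 < d) :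
    ContinuousAt (fun p : Plane × ℝ => ν (Metric.closedBall p.1 p.2)) (x, d) := by
  have := hν.isFiniteMeasure
  refine tendsto_measure_of_ae_tendsto_indicator_of_isFiniteMeasure _
    Metric.isClosed_closedBall.measurableSet
    (fun p => Metric.isClosed_closedBall.measurableSet) ?_
  -- Off the null circle, membership of a point in the ball is unchanged by small changes of centre
  -- and radius.
  have h0 : ∀ᵐ y ∂ν, y ∉ Metric.sphere x d := measure_eq_zero_iff_ae_notMem.1
    (hν.measure_sphere x hd)
  filter_upwards [h0] with y hy
  have hc : Continuous fun p : Plane × ℝ => dist y p.1 - p.2 := by fun_prop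
  rcases lt_or_gt_of_ne (fun h => hy h : dist y x ≠ d) with h | h
  · filter_upwards [(hc.tendsto (x, d)).eventually_lt_const (sub_neg.2 h)] with p hp
    exact ⟨fun _ => h.le, fun _ => by simp only [Metric.mem_closedBall]; linarith⟩
  · filter_upwards [(hc.tendsto (x, d)).eventually_const_lt (sub_pos.2 h)] with p hp
    exact ⟨fun h' => absurd h' (by simp only [Metric.mem_closedBall]; linarith),
      fun h' => absurd h' (by simp only [Metric.mem_closedBall]; linarith)⟩

theorem continuousAt_density (hν : IsSelfSimilar ν) (x : Plane) {d : ℝ} (hd : 0 < d) :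
    ContinuousAt (fun p : Plane × ℝ => density ν p.1 p.2) (x, d) :=
  ENNReal.Tendsto.div (hν.continuousAt_measure_closedBall x hd) (Or.inr (diamPow_ne_zero hd))
    (continuous_diamPow.comp continuous_snd).continuousAt (Or.inl (diamPow_ne_top _))

theorem continuousOn_density (hν : IsSelfSimilar ν) (x : Plane) :
    ContinuousOn (fun d : ℝ => density ν x d) (Ioi 0) := fun d hd =>
  (ContinuousAt.comp (f := fun d : ℝ => (x, d)) (hν.continuousAt_density x hd)
    (by fun_prop)).continuousWithinAt

/-! ### Lower bounds -/

theorem pow_mul_le_measure_closedBall (hν : IsSelfSimilar ν) (k : ℕ) :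
    ∀ x ∈ gasket, 3⁻¹ ^ k * ν gasket ≤ ν (Metric.closedBall x ((1 / 2) ^ k)) := by
  induction k with
  | zero =>
    intro x hx
    rw [pow_zero, pow_zero, one_mul]
    exact measure_mono fun y hy => dist_le_one hy hx
  | succ k ih =>
    intro x hx
    obtain ⟨i, y, hy, rfl⟩ := exists_simil_eq hx
    have h1 := hν.inv_three_mul_le (A := Metric.closedBall (simil i y) ((1 / 2) ^ k / 2))
      Metric.isClosed_closedBall.measurableSet i
    rw [preimage_simil_closedBall] at h1
    rw [pow_succ' (3⁻¹ : ℝ≥0∞), mul_assoc, pow_succ, mul_one_div]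
    exact le_trans (by gcongr; exact ih y hy) h1

theorem diamPow_half_pow (k : ℕ) : diamPow ((1 / 2) ^ k) = 3⁻¹ ^ k * 3 := by
  induction k with
  | zero => simp [diamPow, two_rpow_dimS]
  | succ k ih => rw [pow_succ, mul_one_div, diamPow_half _ (by positivity), ih, pow_succ']; ring

/-- With `d` between `(1/2)^(k+1)` and `(1/2)^k`, one factor `3` is lost in passing between these
two radii and the other is `2^s`, from using diameters; this makes the `9`. -/
theorem mul_diamPow_le (hν : IsSelfSimilar ν) {x : Plane} (hx : x ∈ gasket) {d : ℝ} (hd : 0 < d)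
    (hd1 : d ≤ 1) : ν gasket / 9 * diamPow d ≤ ν (Metric.closedBall x d) := by
  obtain ⟨k, hk, hk'⟩ := exists_nat_pow_near_of_lt_one hd hd1 (by norm_num : (0 : ℝ) < 1 / 2)
    (by norm_num)
  calc ν gasket / 9 * diamPow d ≤ ν gasket / 9 * diamPow ((1 / 2) ^ k) := by
        gcongr; exact diamPow_mono hd.le hk'
    _ = 3⁻¹ ^ (k + 1) * ν gasket := by
        have : (9 : ℝ≥0∞)⁻¹ * 3 = 3⁻¹ := by
          rw [show (9 : ℝ≥0∞) = 3 * 3 by norm_num, ENNReal.mul_inv (by simp) (by simp), mul_assoc,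
            ENNReal.inv_mul_cancel (by simp) (by simp), mul_one]
        rw [diamPow_half_pow, pow_succ, ← this, ENNReal.div_eq_inv_mul]
        ring
    _ ≤ ν (Metric.closedBall x ((1 / 2) ^ (k + 1))) := hν.pow_mul_le_measure_closedBall _ x hx
    _ ≤ _ := measure_mono (Metric.closedBall_subset_closedBall hk.le)

theorem measure_closedBall_pos (hν : IsSelfSimilar ν) {x : Plane} (hx : x ∈ gasket) {d : ℝ}
    (hd : 0 < d) : 0 < ν (Metric.closedBall x d) := by
  refine lt_of_lt_of_le ?_ ((hν.mul_diamPow_le hx (d := min d 1) (by positivity)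
    (min_le_right _ _)).trans (measure_mono (Metric.closedBall_subset_closedBall (min_le_left _ _))))
  exact ENNReal.mul_pos (ENNReal.div_pos hν.measure_pos.ne' (by simp)).ne'
    (diamPow_ne_zero (by positivity))

theorem density_pos (hν : IsSelfSimilar ν) {x : Plane} (hx : x ∈ gasket) {d : ℝ}
    (hd : 0 < d) : 0 < density ν x d :=
  ENNReal.div_pos (hν.measure_closedBall_pos hx hd).ne' (diamPow_ne_top d)

theorem density_ne_top (hν : IsSelfSimilar ν) {x : Plane} {d : ℝ} (hd : 0 < d) :
    density ν x d ≠ ⊤ :=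
  ENNReal.div_ne_top (hν.measure_ne_top _) (diamPow_ne_zero hd)

/-! ### Scaling of densities -/

theorem measure_closedBall_simil (hν : IsSelfSimilar ν) {j : Fin 3} {x : Plane} {d : ℝ}
    (h : ∀ i ≠ j, ν (simil i ⁻¹' Metric.closedBall (simil j x) (d / 2)) = 0) :
    ν (Metric.closedBall (simil j x) (d / 2)) = 3⁻¹ * ν (Metric.closedBall x d) := by
  rw [hν.apply Metric.isClosed_closedBall.measurableSet,
    Finset.sum_eq_single j (fun i _ hi => h i hi) (by simp), preimage_simil_closedBall]

theorem density_simil_of_isTypical (hν : IsSelfSimilar ν) {x : Plane} {d : ℝ}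
    (h : IsTypical x d) (j : Fin 3) : density ν (simil j x) (d / 2) = density ν x d := by
  obtain ⟨hx, hd, O, hO, hB⟩ := h
  refine density_half hd (hν.measure_closedBall_simil fun i hi => ?_)
  exact hν.measure_eq_zero_of_disjoint fun y hy hy' =>
    simil_notMem_of_feasible hO hi hy (closedBall_simil_subset j hB hy')

/-- No ball condition is needed here: in the self-similarity identity the other pieces can only add
mass. -/
theorem density_le_density_simil (hν : IsSelfSimilar ν) {x : Plane} {d : ℝ}
    (hd : 0 < d) (j : Fin 3) : density ν x d ≤ density ν (simil j x) (d / 2) := by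
  refine density_half_ge hd ?_
  have h1 := hν.inv_three_mul_le (A := Metric.closedBall (simil j x) (d / 2))
      Metric.isClosed_closedBall.measurableSet j
  rwa [preimage_simil_closedBall] at h1

/-- The halved ball lies in the ball of radius `1/2` about the vertex, which each other piece meets
in at most the image of that vertex, a null set. -/
theorem measure_closedBall_simil_corner (hν : IsSelfSimilar ν) {l : Fin 3} {x : Plane} {d : ℝ}
    (h : dist x (vertex l) + d ≤ 1) :
    ν (Metric.closedBall (simil l x) (d / 2)) = 3⁻¹ * ν (Metric.closedBall x d) := by
  refine hν.measure_closedBall_simil fun i hi => ?_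
  refine hν.measure_eq_zero_of_inter_subset (p := vertex l) fun y hy hy' => ?_
  refine eq_vertex_of_dist_simil_le hi hy' ?_
  have h1 : dist (simil i y) (simil l x) ≤ d / 2 := hy
  have h2 := dist_simil l x (vertex l)
  rw [simil_vertex] at h2
  linarith [dist_triangle (simil i y) (simil l x) (vertex l)]

theorem measure_closedBall_junction (hν : IsSelfSimilar ν) {j l : Fin 3} (hjl : j ≠ l)
    {x x' y : Plane} {r : ℝ} (hx : simil j x = y) (hx' : simil l x' = y)
    (h : dist y (simil j (vertex l)) + r ≤ 2 / 5) :
    ν (Metric.closedBall y r)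
      = 3⁻¹ * (ν (Metric.closedBall x (2 * r)) + ν (Metric.closedBall x' (2 * r))) := by
  obtain ⟨k, hkj, hkl, hk⟩ := exists_third hjl
  have e1 : simil j ⁻¹' Metric.closedBall y r = Metric.closedBall x (2 * r) := by
    rw [← hx, ← preimage_simil_closedBall j x (2 * r)]; congr 2; ring
  have e2 : simil l ⁻¹' Metric.closedBall y r = Metric.closedBall x' (2 * r) := by
    rw [← hx', ← preimage_simil_closedBall l x' (2 * r)]; congr 2; ring
  have e3 : ν (simil k ⁻¹' Metric.closedBall y r) = 0 := by
    refine hν.measure_eq_zero_of_disjoint fun z hz hz' => ?_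
    have h1 : dist (simil k z) y ≤ r := hz'
    linarith [dist_triangle (simil k z) y (simil j (vertex l)), lt_dist_junction hkj hkl hz]
  rw [hν.apply Metric.isClosed_closedBall.measurableSet, hk, e1, e2, e3, add_zero]

/-- Densities are invariant under the homothety of ratio `1/2` about a junction point. -/
theorem density_junction (hν : IsSelfSimilar ν) {j l : Fin 3} (hjl : j ≠ l) {x : Plane} {r : ℝ}
    (hr : 0 < r) (h : dist x (vertex l) / 2 + r ≤ 2 / 5) :
    density ν (simil j (simil l x)) (r / 2) = density ν (simil j x) r := by
  -- The same centre seen from the other piece; `x'` need not lie in the gasket. Near the junction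
  -- the mass of a ball is the sum of two corner contributions, and each of them scales.
  set x' := x + vertex j - vertex l with hx'
  have e1 : simil l x' = simil j x := by
    simp only [simil, hx', ← smul_add]; congr 1; abel
  have e2 : simil l (simil j x') = simil j (simil l x) := by
    rw [hx']; simp only [simil]; module
  have e3 : dist x' (vertex j) = dist x (vertex l) := by
    rw [dist_eq_norm, dist_eq_norm, hx']; congr 1; abel
  have d1 := dist_simil j x (vertex l)
  have d2 := dist_simil j (simil l x) (vertex l)
  have d3 := dist_simil l x (vertex l)
  rw [simil_vertex] at d3
  have hd : 0 ≤ dist x (vertex l) := dist_nonneg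
  refine density_half hr ?_
  rw [hν.measure_closedBall_junction hjl (x := simil l x) (x' := simil j x') rfl e2
      (by linarith), hν.measure_closedBall_junction hjl (x := x) (x' := x') rfl e1 (by linarith),
    show 2 * (r / 2) = (2 * r) / 2 by ring,
    hν.measure_closedBall_simil_corner (by linarith),
    hν.measure_closedBall_simil_corner (by linarith), mul_add, mul_add, mul_add]

end IsSelfSimilar

/-! ### Reduction of typical balls to a compact family -/

/-- A compact set of (centre, radius) pairs of typical balls, which realizes all the densities of
typical balls. -/
def coreBalls : Set (Plane × ℝ) :=
  (⋃ p : {p : Fin 3 × Fin 3 // p.1 ≠ p.2}, simil p.1.1 '' (simil p.1.2 '' gasket)) ×ˢ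
    Icc (1 / 20) (1 / 10)

theorem isCompact_coreBalls : IsCompact coreBalls :=
  (isCompact_iUnion fun _ => (isCompact_gasket.image (continuous_simil _)).image
    (continuous_simil _)).prod isCompact_Icc

theorem mem_coreBalls {j l : Fin 3} (hjl : j ≠ l) {x : Plane} (hx : x ∈ gasket) {r : ℝ}
    (hr : r ∈ Icc (1 / 20 : ℝ) (1 / 10)) : (simil j (simil l x), r) ∈ coreBalls :=
  ⟨mem_iUnion.2 ⟨⟨(j, l), hjl⟩, mem_image_of_mem _ (mem_image_of_mem _ hx)⟩, hr⟩

theorem isTypical_of_mem_coreBalls {p : Plane × ℝ} (hp : p ∈ coreBalls) : IsTypical p.1 p.2 := by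
  obtain ⟨h1, h2⟩ := hp
  obtain ⟨⟨⟨j, l⟩, hjl⟩, y, ⟨x, hx, rfl⟩, h⟩ := mem_iUnion.1 h1
  rw [← h]
  exact isTypical_simil_simil hx hjl (by linarith [h2.1]) (by linarith [h2.2])

namespace IsSelfSimilar

variable {ν : Measure Plane}

/-- Each halving of the radius is undone by deleting one letter of the code of the centre. For `j l
i ⋯` with `l ≠ i` the first letter goes, by invariance under `f_j`; for `j l l ⋯` one of the two
equal letters goes, by the homothety about the junction. Either way the first two letters remain
distinct. -/
theorem density_mem_image_coreBalls (hν : IsSelfSimilar ν) (k : ℕ) :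
    ∀ {j l : Fin 3}, j ≠ l → ∀ x ∈ gasket, ∀ r ∈ Icc (1 / 20 : ℝ) (1 / 10),
      density ν (simil j (simil l x)) ((1 / 2) ^ k * r)
        ∈ (fun p : Plane × ℝ => density ν p.1 p.2) '' coreBalls := by
  induction k with
  | zero =>
    intro j l hjl x hx r hr
    rw [pow_zero, one_mul]
    exact ⟨_, mem_coreBalls hjl hx hr, rfl⟩
  | succ k ih =>
    intro j l hjl x hx r hr
    obtain ⟨i, y, hy, rfl⟩ := exists_simil_eq hx
    have e : (1 / 2 : ℝ) ^ (k + 1) * r = (1 / 2) ^ k * r / 2 := by rw [pow_succ]; ring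
    have hr0 : 0 < r := by linarith [hr.1]
    have h0 : 0 < (1 / 2 : ℝ) ^ k * r := by positivity
    have h1 : (1 / 2 : ℝ) ^ k * r ≤ 1 / 10 :=
      le_trans (mul_le_of_le_one_left hr0.le (pow_le_one₀ (by norm_num) (by norm_num))) hr.2
    rw [e]
    by_cases hil : l = i
    · subst hil
      rw [hν.density_junction hjl h0 ?_]
      · exact ih hjl y hy r hr
      · have h2 := dist_simil l y (vertex l)
        rw [simil_vertex] at h2
        linarith [dist_le_one hy (vertex_mem_gasket l)]
    · rw [hν.density_simil_of_isTypical (isTypical_simil_simil hy hil h0 (by linarith))]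
      exact ih hil y hy r hr

theorem typicalDensities_eq_image (hν : IsSelfSimilar ν) :
    typicalDensities ν = (fun p : Plane × ℝ => density ν p.1 p.2) '' coreBalls := by
  apply subset_antisymm
  · rintro _ ⟨x, d, h, rfl⟩
    have key : ∀ n : ℕ, IsTypical ((simil 1)^[n] x) ((1 / 2) ^ n * d) ∧
        density ν ((simil 1)^[n] x) ((1 / 2) ^ n * d) = density ν x d := by
      intro n
      induction n with
      | zero => simpa using h
      | succ n ih =>
        have e : (1 / 2 : ℝ) ^ (n + 1) * d = (1 / 2) ^ n * d / 2 := by rw [pow_succ]; ring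
        rw [Function.iterate_succ_apply', e]
        exact ⟨ih.1.simil 1, (hν.density_simil_of_isTypical ih.1 1).trans ih.2⟩
    -- Shrink by `f₁` until the radius is below `2/5`; then `f₀ ∘ f₁` puts two distinct letters in
    -- front and brings the radius below `1/10`.
    obtain ⟨n, hn⟩ := exists_pow_lt_of_lt_one (div_pos (by norm_num : (0 : ℝ) < 2 / 5) h.2.1)
      (by norm_num : (1 / 2 : ℝ) < 1)
    obtain ⟨ht, he⟩ := key n
    rw [lt_div_iff₀ h.2.1] at hn
    set y := (simil 1)^[n] x
    set r := (1 / 2 : ℝ) ^ n * d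
    rw [← he, ← hν.density_simil_of_isTypical ht 1,
      ← hν.density_simil_of_isTypical (ht.simil 1) 0]
    -- This `k` is the one for which `2^k * (r/4)` falls in `(1/20, 1/10]`.
    obtain ⟨k, hk, hk'⟩ := exists_nat_pow_near_of_lt_one (x := r / 4 * 10) (y := (1 / 2 : ℝ))
      (by have := ht.2.1; positivity) (by linarith) (by norm_num) (by norm_num)
    have e : r / 2 / 2 = (1 / 2) ^ k * (r / 4 * 2 ^ k) := by
      rw [div_pow, one_pow]; field_simp; norm_num
    rw [e]
    refine hν.density_mem_image_coreBalls k (by decide) y ht.1 _ ?_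
    have h2 : (0 : ℝ) < 2 ^ k := by positivity
    rw [div_pow, one_pow] at hk hk'
    rw [le_div_iff₀ h2] at hk'
    rw [div_lt_iff₀ (by positivity), pow_succ] at hk
    constructor <;> nlinarith
  · rintro _ ⟨p, hp, rfl⟩
    exact ⟨p.1, p.2, isTypical_of_mem_coreBalls hp, rfl⟩

theorem isCompact_typicalDensities (hν : IsSelfSimilar ν) : IsCompact (typicalDensities ν) := by
  rw [hν.typicalDensities_eq_image]
  refine isCompact_coreBalls.image_of_continuousOn fun p hp => ?_
  exact (hν.continuousAt_density p.1 (isTypical_of_mem_coreBalls hp).2.1).continuousWithinAt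

theorem typicalDensities_nonempty : (typicalDensities ν).Nonempty :=
  ⟨_, _, _, isTypical_of_mem_coreBalls (mem_coreBalls (j := 0) (l := 1) (by decide)
    (vertex_mem_gasket 0) (r := 1 / 10) (by norm_num)), rfl⟩

/-- An upper bound of the densities of typical balls bounds the densities of all small balls. -/
theorem density_le_of_mem_upperBounds (hν : IsSelfSimilar ν) {b : ℝ≥0∞}
    (hb : b ∈ upperBounds (typicalDensities ν)) {x : Plane} (hx : x ∈ gasket) {d : ℝ}
    (hd : 0 < d) (hd' : d ≤ 2 / 5) : density ν x d ≤ b :=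
  (hν.density_le_density_simil hd 1).trans <|
    (hν.density_le_density_simil (half_pos hd) 0).trans <|
      hb ⟨_, _, isTypical_simil_simil hx (by decide) (by positivity) (by linarith), rfl⟩

end IsSelfSimilar

/-! ### Uniqueness of scaling set functions -/

/-- The set functions on the plane that are monotone, finitely subadditive on closed sets, finite on
the gasket, and at most divided by `3` by the similitudes. -/
structure IsScaling (β : Set Plane → ℝ≥0∞) : Prop where
  mono : ∀ A B, A ⊆ B → β A ≤ β B
  union_le : ∀ A B, IsClosed A → IsClosed B → β (A ∪ B) ≤ β A + β B
  image_le : ∀ i A, IsClosed A → A ⊆ gasket → β (simil i '' A) ≤ 3⁻¹ * β A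
  ne_top : β gasket ≠ ⊤

namespace IsScaling

variable {β : Set Plane → ℝ≥0∞} {ν : Measure Plane}

theorem empty (hβ : IsScaling β) : β ∅ = 0 := by
  have h1 := hβ.image_le 0 ∅ isClosed_empty (empty_subset _)
  rw [image_empty] at h1
  have h2 : β ∅ ≠ ⊤ := ne_top_of_le_ne_top hβ.ne_top (hβ.mono _ _ (empty_subset _))
  by_contra h
  refine absurd h1 (not_le.2 ?_)
  rw [mul_comm, ← div_eq_mul_inv]
  exact ENNReal.div_lt_of_lt_mul' (by
    calc β ∅ = 1 * β ∅ := (one_mul _).symm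
      _ < 3 * β ∅ := ENNReal.mul_lt_mul_left h h2 (by norm_num))

/-- Cutting `F` into its three pieces gives an inequality for `β` where `ν` has an equality, and
`f_i` halves the width of a neighbourhood. The induction starts at width `1`, where the
neighbourhood of a nonempty `F` contains the whole gasket. -/
theorem mul_le_mul_cthickening (hβ : IsScaling β) (hν : IsSelfSimilar ν) (k : ℕ) :
    ∀ F, IsClosed F → F ⊆ gasket →
      ν gasket * β F ≤ β gasket * ν (Metric.cthickening ((1 / 2) ^ k) F) := by
  induction k with
  | zero =>
    intro F _ hFS
    rcases F.eq_empty_or_nonempty with rfl | ⟨x, hx⟩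
    · rw [hβ.empty, mul_zero]; exact zero_le
    · rw [mul_comm]
      gcongr ?_ * ?_
      · exact hβ.mono _ _ hFS
      · refine measure_mono fun y hy => ?_
        exact Metric.mem_cthickening_of_dist_le y x _ _ hx
          (by simpa using dist_le_one hy (hFS hx))
  | succ k ih =>
    intro F hF hFS
    set G : Fin 3 → Set Plane := fun i => simil i ⁻¹' F ∩ gasket with hG
    have hGc (i) : IsClosed (G i) := (hF.preimage (continuous_simil i)).inter isClosed_gasket
    have hGi (i) : IsClosed (simil i '' G i) :=
      ((isCompact_gasket.inter_left (hF.preimage (continuous_simil i))).image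
        (continuous_simil i)).isClosed
    have hcov : F ⊆ simil 0 '' G 0 ∪ (simil 1 '' G 1 ∪ simil 2 '' G 2) := by
      intro x hx
      obtain ⟨i, y, hy, rfl⟩ := exists_simil_eq (hFS hx)
      fin_cases i
      · exact Or.inl ⟨y, ⟨hx, hy⟩, rfl⟩
      · exact Or.inr (Or.inl ⟨y, ⟨hx, hy⟩, rfl⟩)
      · exact Or.inr (Or.inr ⟨y, ⟨hx, hy⟩, rfl⟩)
    have h1 : β F ≤ ∑ i, 3⁻¹ * β (G i) := by
      rw [Fin.sum_univ_three]
      calc β F ≤ β (simil 0 '' G 0) + (β (simil 1 '' G 1) + β (simil 2 '' G 2)) := by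
            refine (hβ.mono _ _ hcov).trans ((hβ.union_le _ _ (hGi 0)
              ((hGi 1).union (hGi 2))).trans ?_)
            gcongr
            exact hβ.union_le _ _ (hGi 1) (hGi 2)
        _ ≤ 3⁻¹ * β (G 0) + (3⁻¹ * β (G 1) + 3⁻¹ * β (G 2)) := by
            gcongr <;> exact hβ.image_le _ _ (hGc _) inter_subset_right
        _ = _ := by rw [add_assoc]
    calc ν gasket * β F ≤ ν gasket * ∑ i, 3⁻¹ * β (G i) := by gcongr
      _ = 3⁻¹ * ∑ i, ν gasket * β (G i) := by simp only [Finset.mul_sum, mul_left_comm]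
      _ ≤ 3⁻¹ * ∑ i, β gasket * ν (simil i ⁻¹' Metric.cthickening ((1 / 2) ^ (k + 1)) F) := by
          gcongr 3⁻¹ * ?_
          refine Finset.sum_le_sum fun i _ => ?_
          refine (ih _ (hGc i) inter_subset_right).trans ?_
          gcongr β gasket * ν ?_
          intro y hy
          rw [(isCompact_gasket.inter_left (hF.preimage (continuous_simil i)))
            |>.cthickening_eq_biUnion_closedBall (by positivity)] at hy
          obtain ⟨z, hz, hyz⟩ := mem_iUnion₂.1 hy
          refine Metric.mem_cthickening_of_dist_le _ (simil i z) _ _ hz.1 ?_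
          rw [dist_simil, pow_succ, mul_one_div]
          exact div_le_div_of_nonneg_right hyz (by norm_num)
      _ = β gasket * ν (Metric.cthickening ((1 / 2) ^ (k + 1)) F) := by
          rw [hν.apply Metric.isClosed_cthickening.measurableSet, ← Finset.mul_sum, mul_left_comm]

theorem mul_le_mul (hβ : IsScaling β) (hν : IsSelfSimilar ν) {F : Set Plane} (hF : IsClosed F)
    (hFS : F ⊆ gasket) : ν gasket * β F ≤ β gasket * ν F := by
  have h1 : Tendsto (fun k : ℕ => ν (Metric.cthickening ((1 / 2 : ℝ) ^ k) F)) atTop (𝓝 (ν F)) :=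
    (tendsto_measure_cthickening_of_isClosed ⟨1, one_pos, hν.measure_ne_top _⟩ hF).comp
      (tendsto_pow_atTop_nhds_zero_of_lt_one (by norm_num) (by norm_num))
  exact ge_of_tendsto' (ENNReal.Tendsto.const_mul h1 (Or.inr hβ.ne_top))
    fun k => hβ.mul_le_mul_cthickening hν k F hF hFS

/-- A scaling set function is proportional to the self-similar measure on balls. -/
theorem mul_closedBall (hβ : IsScaling β) (hν : IsSelfSimilar ν) (x : Plane) {d : ℝ}
    (hd : 0 < d) : ν gasket * β (Metric.closedBall x d ∩ gasket)
      = β gasket * ν (Metric.closedBall x d) := by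
  apply le_antisymm
  · rw [← hν.measure_inter (Metric.closedBall x d)]
    exact hβ.mul_le_mul hν (Metric.isClosed_closedBall.inter isClosed_gasket) inter_subset_right
  -- The reverse inequality comes from the bound for the complement: as the circle is null, the ball
  -- and `E` share the mass of `ν` exactly.
  · set E := gasket \ Metric.ball x d with hE
    have hEc : IsClosed E := isClosed_gasket.sdiff Metric.isOpen_ball
    have h1 : β gasket ≤ β (Metric.closedBall x d ∩ gasket) + β E := by
      refine le_trans (hβ.mono _ _ fun y hy => ?_)
        (hβ.union_le _ _ (Metric.isClosed_closedBall.inter isClosed_gasket) hEc)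
      by_cases h : y ∈ Metric.ball x d
      · exact Or.inl ⟨Metric.ball_subset_closedBall h, hy⟩
      · exact Or.inr ⟨hy, h⟩
    have h2 : ν (Metric.closedBall x d) + ν E = ν gasket := by
      have h3 : ν (Metric.closedBall x d) = ν (Metric.ball x d) := by
        refine le_antisymm ?_ (measure_mono Metric.ball_subset_closedBall)
        rw [← Metric.ball_union_sphere]
        exact (measure_union_le _ _).trans_eq (by rw [hν.measure_sphere x hd, add_zero])
      rw [h3, ← hν.measure_inter (Metric.ball x d), hE, inter_comm]
      exact measure_inter_add_sdiff _ Metric.isOpen_ball.measurableSet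
    have h3 : β gasket * ν (Metric.closedBall x d) + β gasket * ν E
        ≤ ν gasket * β (Metric.closedBall x d ∩ gasket) + β gasket * ν E := by
      rw [← mul_add, h2, mul_comm]
      calc ν gasket * β gasket
          ≤ ν gasket * (β (Metric.closedBall x d ∩ gasket) + β E) := by gcongr
        _ ≤ _ := by
          rw [mul_add]
          gcongr _ + ?_
          exact hβ.mul_le_mul hν hEc sdiff_subset
    exact (ENNReal.add_le_add_iff_right (ENNReal.mul_ne_top hβ.ne_top (hν.measure_ne_top _))).1 h3

end IsScaling

/-! ### Images of small sets and the zero-one law -/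

namespace IsSelfSimilar

variable {ν : Measure Plane}

theorem measure_image_simil_le_of_measurable (hν : IsSelfSimilar ν) (i : Fin 3) {A : Set Plane}
    (hA : MeasurableSet A) (hAS : A ⊆ gasket) : ν (simil i '' A) ≤ 3⁻¹ * ν A := by
  rw [hν.apply (measurableSet_image_simil i hA),
    Finset.sum_eq_single i (fun j _ hj => ?_) (by simp),
    preimage_image_eq _ (injective_simil i)]
  refine hν.measure_eq_zero_of_inter_subset (p := vertex i) ?_
  rintro y ⟨x, hx, hxy⟩ hy
  exact eq_vertex_of_simil_eq hj.symm (hAS hx) hy hxy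

theorem measure_image_simil_le (hν : IsSelfSimilar ν) (i : Fin 3) {A : Set Plane}
    (hAS : A ⊆ gasket) : ν (simil i '' A) ≤ 3⁻¹ * ν A := by
  calc ν (simil i '' A) ≤ ν (simil i '' (toMeasurable ν A ∩ gasket)) :=
        measure_mono (image_mono (subset_inter (subset_toMeasurable ν A) hAS))
    _ ≤ 3⁻¹ * ν (toMeasurable ν A ∩ gasket) := hν.measure_image_simil_le_of_measurable i
        ((measurableSet_toMeasurable ν A).inter isClosed_gasket.measurableSet) inter_subset_right
    _ ≤ 3⁻¹ * ν A := by
        gcongr 3⁻¹ * ?_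
        exact (measure_mono inter_subset_left).trans_eq (measure_toMeasurable A)

/-- Zero-one law. -/
theorem measure_eq_zero_of_invariant (hν : IsSelfSimilar ν) {D U : Set Plane} (hDS : D ⊆ gasket)
    (hD : ∀ i, ∀ x ∈ gasket, simil i x ∈ D → x ∈ D) (hU : IsOpen U) (hUS : (U ∩ gasket).Nonempty)
    (hDU : Disjoint D U) : ν D = 0 := by
  -- Stability of `D` under deletion of the first letter makes this restriction scaling, hence equal
  -- on balls to `ν(D)/ν(S)` times `ν`. A ball inside `U` has positive mass but misses `D`, so the
  -- factor is `0`.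
  have hβ : IsScaling fun A => ν (A ∩ D) := by
    refine ⟨fun A B h => measure_mono (inter_subset_inter_left _ h), fun A B _ _ => ?_,
      fun i A _ hA => ?_, hν.measure_ne_top _⟩
    · rw [union_inter_distrib_right]; exact measure_union_le _ _
    · refine le_trans (measure_mono ?_) (hν.measure_image_simil_le i (inter_subset_right.trans hDS))
      rintro _ ⟨⟨x, hx, rfl⟩, hxD⟩
      exact ⟨x, ⟨hx, hD i x (hA hx) hxD⟩, rfl⟩
  obtain ⟨x, hxU, hx⟩ := hUS
  obtain ⟨d, hd, hB⟩ := Metric.nhds_basis_closedBall.mem_iff.1 (hU.mem_nhds hxU)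
  have h1 := hβ.mul_closedBall hν x hd
  have h2 : Metric.closedBall x d ∩ gasket ∩ D = ∅ := by
    rw [eq_empty_iff_forall_notMem]
    rintro y ⟨⟨hy, _⟩, hyD⟩
    exact Set.disjoint_left.1 hDU hyD (hB hy)
  rw [h2, measure_empty, mul_zero, eq_comm, mul_eq_zero,
    inter_eq_self_of_subset_right hDS] at h1
  exact h1.resolve_right (hν.measure_closedBall_pos hx hd).ne'

end IsSelfSimilar

/-! ### Symmetry -/

theorem bary_combination {c : Fin 3 → ℝ} (hc : c 0 + c 1 + c 2 = 1) (k : Fin 3) :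
    bary k (∑ j, c j • vertex j) = c k := by
  have h : Real.sqrt 3 ≠ 0 := by positivity
  rw [Fin.sum_univ_three]
  fin_cases k <;> simp [bary, vertex] <;> field_simp <;> linarith

/-- The isometry that permutes the barycentric coordinates. -/
def permute (σ : Equiv.Perm (Fin 3)) (x : Plane) : Plane := ∑ j, bary (σ j) x • vertex j

theorem bary_permute (σ : Equiv.Perm (Fin 3)) (k : Fin 3) (x : Plane) :
    bary k (permute σ x) = bary (σ k) x := by
  refine bary_combination (c := fun j => bary (σ j) x) ?_ k
  have h1 := Equiv.sum_comp σ fun j => bary j x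
  rw [Fin.sum_univ_three, Fin.sum_univ_three] at h1
  rw [h1, sum_bary]

theorem dist_permute (σ : Equiv.Perm (Fin 3)) (x y : Plane) :
    dist (permute σ x) (permute σ y) = dist x y := by
  have h1 := Equiv.sum_comp σ fun j => (bary j x - bary j y) ^ 2
  rw [Fin.sum_univ_three, Fin.sum_univ_three] at h1
  have h2 : dist (permute σ x) (permute σ y) ^ 2 = dist x y ^ 2 := by
    rw [dist_sq_eq, dist_sq_eq]
    simp only [bary_permute]
    rw [h1]
  exact (sq_eq_sq₀ dist_nonneg dist_nonneg).1 h2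

theorem permute_permute_symm (σ : Equiv.Perm (Fin 3)) (x : Plane) :
    permute σ (permute σ.symm x) = x :=
  ext_bary fun i => by simp [bary_permute]

theorem permute_symm_permute (σ : Equiv.Perm (Fin 3)) (x : Plane) :
    permute σ.symm (permute σ x) = x :=
  ext_bary fun i => by simp [bary_permute]

theorem permute_simil (σ : Equiv.Perm (Fin 3)) (i : Fin 3) (x : Plane) :
    permute σ (simil i x) = simil (σ.symm i) (permute σ x) :=
  ext_bary fun k => by simp only [bary_permute, bary_simil, Equiv.symm_apply_eq]

theorem permute_vertex (σ : Equiv.Perm (Fin 3)) (i : Fin 3) :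
    permute σ (vertex i) = vertex (σ.symm i) :=
  ext_bary fun k => by simp only [bary_permute, bary_vertex, Equiv.symm_apply_eq]

theorem permute_image_gasket (σ : Equiv.Perm (Fin 3)) : permute σ '' gasket = gasket := by
  refine eq_gasket ⟨gasket_nonempty.image _, isCompact_gasket.image
    (Isometry.of_dist_eq (dist_permute σ)).continuous, ?_⟩
  ext x
  simp only [mem_iUnion]
  constructor
  · rintro ⟨y, hy, rfl⟩
    obtain ⟨i, z, hz, rfl⟩ := exists_simil_eq hy
    exact ⟨σ.symm i, permute σ z, mem_image_of_mem _ hz, (permute_simil σ i z).symm⟩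
  · rintro ⟨i, _, ⟨z, hz, rfl⟩, rfl⟩
    refine ⟨simil (σ i) z, simil_mem_gasket _ hz, ?_⟩
    rw [permute_simil, Equiv.symm_apply_apply]

theorem permute_mem_gasket (σ : Equiv.Perm (Fin 3)) {x : Plane} (hx : x ∈ gasket) :
    permute σ x ∈ gasket := by
  rw [← permute_image_gasket σ]; exact mem_image_of_mem _ hx

theorem permute_preimage_gasket (σ : Equiv.Perm (Fin 3)) : permute σ ⁻¹' gasket = gasket := by
  ext x
  refine ⟨fun h => ?_, fun h => permute_mem_gasket σ h⟩
  rw [← permute_symm_permute σ x]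
  exact permute_mem_gasket _ h

/-- The image of `ν` under the symmetry exchanging the two vertices is again scaling with the same
total mass, so it agrees with `ν` on balls. -/
theorem IsSelfSimilar.measure_closedBall_vertex {ν : Measure Plane} (hν : IsSelfSimilar ν)
    (i : Fin 3) {d : ℝ} (hd : 0 < d) :
    ν (Metric.closedBall (vertex i) d) = ν (Metric.closedBall (vertex 0) d) := by
  set σ : Equiv.Perm (Fin 3) := Equiv.swap 0 i
  have hβ : IsScaling fun A => ν (permute σ ⁻¹' A) := by
    refine ⟨fun A B h => measure_mono (preimage_mono h), fun A B _ _ => measure_union_le _ _,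
      fun j A _ hA => ?_, hν.measure_ne_top _⟩
    have hA' : permute σ ⁻¹' A ⊆ gasket := by
      rw [← permute_preimage_gasket σ]; exact preimage_mono hA
    refine le_trans (measure_mono ?_) (hν.measure_image_simil_le (σ j) hA')
    rintro x ⟨a, ha, hax⟩
    refine ⟨permute σ.symm a, ?_, ?_⟩
    · rwa [mem_preimage, permute_permute_symm]
    · rw [← permute_symm_permute σ x, ← hax, permute_simil, Equiv.symm_symm]
  have h := hβ.mul_closedBall hν (vertex 0) hd
  have e : permute σ ⁻¹' (Metric.closedBall (vertex 0) d ∩ gasket)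
      = Metric.closedBall (vertex i) d ∩ gasket := by
    rw [preimage_inter, permute_preimage_gasket]
    congr 1
    ext x
    have h1 : vertex 0 = permute σ (vertex i) := by
      rw [permute_vertex]; simp [σ]
    rw [mem_preimage, Metric.mem_closedBall, h1, dist_permute, Metric.mem_closedBall]
  rw [e, permute_preimage_gasket, hν.measure_inter] at h
  exact (ENNReal.mul_right_inj hν.measure_pos.ne' (hν.measure_ne_top _)).1 h

/-! ### Codes and the geometric shift -/

theorem wordMap_succ' (i : ℕ → Fin 3) (k : ℕ) (x : Plane) :
    wordMap i (k + 1) x = simil (i 0) (wordMap (fun n => i (n + 1)) k x) := by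
  induction k generalizing x with
  | zero => rfl
  | succ k ih =>
    change wordMap i (k + 1) (simil (i (k + 1)) x) = _
    rw [ih]
    rfl

theorem dist_wordMap (i : ℕ → Fin 3) (k : ℕ) (x y : Plane) :
    dist (wordMap i k x) (wordMap i k y) = (1 / 2) ^ k * dist x y := by
  induction k generalizing x y with
  | zero => simp [wordMap]
  | succ k ih =>
    change dist (wordMap i k (simil (i k) x)) (wordMap i k (simil (i k) y)) = _
    rw [ih, dist_simil, pow_succ]
    ring

theorem IsCode.mem_gasket {i : ℕ → Fin 3} {x : Plane} (h : IsCode i x) : x ∈ gasket := by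
  simpa [wordMap] using h 0

theorem IsCode.unique {i : ℕ → Fin 3} {x y : Plane} (hx : IsCode i x) (hy : IsCode i y) :
    x = y := by
  have key : ∀ k : ℕ, dist x y ≤ (1 / 2) ^ k := by
    intro k
    obtain ⟨a, ha, rfl⟩ := hx k
    obtain ⟨b, hb, rfl⟩ := hy k
    rw [dist_wordMap]
    exact mul_le_of_le_one_right (by positivity) (dist_le_one ha hb)
  exact dist_le_zero.1 (ge_of_tendsto' (tendsto_pow_atTop_nhds_zero_of_lt_one
    (by norm_num : (0 : ℝ) ≤ 1 / 2) (by norm_num)) key)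

theorem IsCode.simil {i : ℕ → Fin 3} {x : Plane} (h : IsCode (fun n => i (n + 1)) x) :
    IsCode i (simil (i 0) x) := by
  intro k
  cases k with
  | zero => exact ⟨_, simil_mem_gasket _ h.mem_gasket, rfl⟩
  | succ k =>
    obtain ⟨a, ha, rfl⟩ := h k
    exact ⟨a, ha, wordMap_succ' i k a⟩

theorem exists_isCode {x : Plane} (hx : x ∈ gasket) : ∃ i, IsCode i x := by
  choose i y hy h using fun x : gasket => exists_simil_eq x.2
  set g : gasket → gasket := fun x => ⟨y x, hy x⟩
  refine ⟨fun n => i (g^[n] ⟨x, hx⟩), fun k => ⟨g^[k] ⟨x, hx⟩, Subtype.coe_prop _, ?_⟩⟩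
  induction k with
  | zero => rfl
  | succ k ih =>
    change wordMap _ k (SierpinskiGasket.simil _ _) = x
    rw [Function.iterate_succ_apply']
    change wordMap _ k (SierpinskiGasket.simil _ (y _)) = x
    rw [h, ih]

/-- This eliminates codes: a step of the shift is the inverse of some similitude. -/
theorem mem_geomShift_iff {A : Set Plane} {z : Plane} :
    z ∈ geomShift A ↔ z ∈ gasket ∧ ∃ i, simil i z ∈ A := by
  constructor
  · rintro ⟨x, hx, i, hi, hz⟩
    exact ⟨hz.mem_gasket, i 0, (hz.simil.unique hi) ▸ hx⟩
  · rintro ⟨hz, j, hj⟩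
    obtain ⟨i, hi⟩ := exists_isCode hz
    let c : ℕ → Fin 3 := fun n => Nat.casesOn n j i
    exact ⟨_, hj, c, IsCode.simil (i := c) hi, hi⟩

theorem geomShift_mono : Monotone geomShift := fun A B h z hz => by
  rw [mem_geomShift_iff] at hz ⊢
  exact ⟨hz.1, hz.2.imp fun i hi => h hi⟩

theorem orbit_subset_orbit_simil {x : Plane} (hx : x ∈ gasket) (i : Fin 3) :
    (⋃ k : ℕ, geomShift^[k] {x}) ⊆ ⋃ k : ℕ, geomShift^[k] {simil i x} := by
  refine iUnion_subset fun k => subset_iUnion_of_subset (k + 1) ?_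
  rw [Function.iterate_succ_apply]
  refine geomShift_mono.iterate k ?_
  rw [singleton_subset_iff, mem_geomShift_iff]
  exact ⟨hx, i, rfl⟩

theorem mem_of_mem_iterate_geomShift {O : Set Plane} (hO : ∀ i, simil i '' O ⊆ O) {y z : Plane}
    {k : ℕ} (hz : z ∈ geomShift^[k] {y}) (hzO : z ∈ O) : y ∈ O := by
  induction k generalizing z with
  | zero => rwa [← mem_singleton_iff.1 hz]
  | succ k ih =>
    rw [Function.iterate_succ_apply', mem_geomShift_iff] at hz
    obtain ⟨_, i, hi⟩ := hz
    exact ih hi (hO i (mem_image_of_mem _ hzO))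

theorem exists_orbit_mem {y : Plane} (hy : y ∈ denseOrbitPoints) {U : Set Plane} (hU : IsOpen U)
    (hUS : (U ∩ gasket).Nonempty) : ∃ k, ∃ z ∈ geomShift^[k] {y}, z ∈ U := by
  obtain ⟨x, hxU, hx⟩ := hUS
  obtain ⟨z, hzU, hz⟩ := mem_closure_iff.1 (hy.2 hx) U hU hxU
  obtain ⟨k, hk⟩ := mem_iUnion.1 hz
  exact ⟨k, z, hk, hzU⟩

/-- A dense orbit enters `O`, and `f_i(O) ⊆ O` carries membership back along the orbit to its
starting point. -/
theorem denseOrbitPoints_subset {O : Set Plane} (hO : IsFeasible O) : denseOrbitPoints ⊆ O := by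
  intro y hy
  obtain ⟨k, z, hz, hzO⟩ := exists_orbit_mem hy hO.1 hO.2.2.2
  exact mem_of_mem_iterate_geomShift hO.2.1 hz hzO

/-! ### Spectra as sets of cluster points -/

theorem mem_densitySpectrum_iff {α : Set Plane → ℝ≥0∞} {A : Set Plane} {l : ℝ≥0∞} :
    l ∈ densitySpectrum α A ↔ ∃ x ∈ A, l ∈ densitySpectrum α {x} := by
  simp [densitySpectrum]

theorem mem_densitySpectrum_singleton {α : Set Plane → ℝ≥0∞} {x : Plane} {l : ℝ≥0∞} :
    l ∈ densitySpectrum α {x} ↔ MapClusterPt l (𝓝[>] 0) (fun d : ℝ => density α x d) := by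
  constructor
  · rintro ⟨_, rfl, d, hd, hd0, hl⟩
    exact MapClusterPt.of_comp (tendsto_nhdsWithin_iff.2 ⟨hd0, Eventually.of_forall hd⟩)
      hl.mapClusterPt
  · intro h
    -- This filter is countably generated, so it yields a sequence. Its terms are only eventually
    -- positive, hence the shift by `N` below.
    have hne : (𝓝[>] (0 : ℝ) ⊓ comap (fun d : ℝ => density α x d) (𝓝 l)).NeBot := by
      refine (Filter.map_neBot_iff fun d : ℝ => density α x d).1 ?_
      rw [Filter.push_pull, inf_comm]
      exact h
    obtain ⟨d, hd⟩ := Filter.exists_seq_tendsto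
      (𝓝[>] (0 : ℝ) ⊓ comap (fun d : ℝ => density α x d) (𝓝 l))
    rw [tendsto_inf, tendsto_comap_iff, tendsto_nhdsWithin_iff] at hd
    obtain ⟨⟨h0, hpos⟩, hl⟩ := hd
    obtain ⟨N, hN⟩ := eventually_atTop.1 hpos
    exact ⟨x, rfl, fun n => d (n + N), fun n => hN _ (Nat.le_add_left _ _),
      h0.comp (tendsto_add_atTop_nat N), hl.comp (tendsto_add_atTop_nat N)⟩

theorem frequently_nhdsGT_zero_iff {p : ℝ → Prop} :
    (∃ᶠ d in 𝓝[>] (0 : ℝ), p d) ↔ ∀ ε > 0, ∃ d, 0 < d ∧ d < ε ∧ p d := by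
  rw [(nhdsGT_basis (0 : ℝ)).frequently_iff]
  simp only [mem_Ioo, and_assoc]

theorem densitySpectrum_subset_of_eventually {α : Set Plane → ℝ≥0∞} {x : Plane} {V : Set ℝ≥0∞}
    (hV : IsClosed V) (h : ∀ᶠ d in 𝓝[>] (0 : ℝ), density α x d ∈ V) :
    densitySpectrum α {x} ⊆ V := by
  intro l hl
  rw [mem_densitySpectrum_singleton] at hl
  by_contra hlV
  obtain ⟨d, hd, hd'⟩ := ((hl.frequently (hV.isOpen_compl.mem_nhds hlV)).and_eventually h).exists
  exact hd hd'

theorem eventually_isTypical {O : Set Plane} (hO : IsFeasible O) {x : Plane} (hx : x ∈ O ∩ gasket) :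
    ∀ᶠ d in 𝓝[>] (0 : ℝ), IsTypical x d := by
  obtain ⟨ε, hε, hB⟩ := Metric.nhds_basis_closedBall.mem_iff.1 (hO.1.mem_nhds hx.1)
  filter_upwards [Ioc_mem_nhdsGT hε] with d hd
  exact ⟨hx.2, hd.1, O, hO, (Metric.closedBall_subset_closedBall hd.2).trans hB⟩

theorem IsTypical.iterate_simil {x : Plane} {d : ℝ} (h : IsTypical x d) (i : Fin 3) (n : ℕ) :
    IsTypical ((SierpinskiGasket.simil i)^[n] x) ((1 / 2) ^ n * d) := by
  induction n with
  | zero => simpa using h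
  | succ n ih =>
    have e : (1 / 2 : ℝ) ^ (n + 1) * d = (1 / 2) ^ n * d / 2 := by rw [pow_succ]; ring
    rw [Function.iterate_succ_apply', e]
    exact ih.simil i

/-! ### Spectra at points with dense shift orbit -/

namespace IsSelfSimilar

variable {ν : Measure Plane}

theorem density_iterate_simil (hν : IsSelfSimilar ν) {x : Plane} {d : ℝ} (h : IsTypical x d)
    (i : Fin 3) (n : ℕ) :
    density ν ((simil i)^[n] x) ((1 / 2) ^ n * d) = density ν x d := by
  induction n with
  | zero => simp
  | succ n ih =>
    have e : (1 / 2 : ℝ) ^ (n + 1) * d = (1 / 2) ^ n * d / 2 := by rw [pow_succ]; ring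
    rw [Function.iterate_succ_apply', e, hν.density_simil_of_isTypical (h.iterate_simil i n), ih]

theorem density_of_mem_iterate_geomShift (hν : IsSelfSimilar ν) {y z : Plane} {k : ℕ}
    (hz : z ∈ geomShift^[k] {y}) {d : ℝ} (h : IsTypical z d) :
    density ν y ((1 / 2) ^ k * d) = density ν z d := by
  induction k generalizing z d with
  | zero => rw [← mem_singleton_iff.1 hz]; simp
  | succ k ih =>
    rw [Function.iterate_succ_apply', mem_geomShift_iff] at hz
    obtain ⟨_, i, hi⟩ := hz
    have e : (1 / 2 : ℝ) ^ (k + 1) * d = (1 / 2) ^ k * (d / 2) := by rw [pow_succ]; ring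
    rw [e, ih hi (h.simil i), hν.density_simil_of_isTypical h]

/-- Almost every point has a dense shift orbit. -/
theorem measure_diff_denseOrbitPoints (hν : IsSelfSimilar ν) : ν (gasket \ denseOrbitPoints) = 0 := by
  -- `D U` collects the points whose orbit avoids `U`. Countably many basic open sets suffice, and
  -- each `D U` is null by the zero-one law since deleting a letter only shrinks the orbit.
  set D : Set Plane → Set Plane :=
    fun U => {x | x ∈ gasket ∧ Disjoint (⋃ k : ℕ, geomShift^[k] {x}) U} with hD
  set B := TopologicalSpace.countableBasis Plane
  have hB := TopologicalSpace.isBasis_countableBasis Plane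
  have h1 : gasket \ denseOrbitPoints ⊆ ⋃ U ∈ {U | U ∈ B ∧ (U ∩ gasket).Nonempty}, D U := by
    rintro x ⟨hx, hx'⟩
    have h2 : ¬ gasket ⊆ closure (⋃ k : ℕ, geomShift^[k] {x}) := fun h => hx' ⟨hx, h⟩
    obtain ⟨p, hp, hp'⟩ := not_subset.1 h2
    rw [hB.mem_closure_iff] at hp'
    push Not at hp'
    obtain ⟨U, hU, hpU, hdis⟩ := hp'
    refine mem_biUnion (show U ∈ {U | U ∈ B ∧ (U ∩ gasket).Nonempty} from ⟨hU, p, hpU, hp⟩)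
      ⟨hx, ?_⟩
    rw [disjoint_comm, Set.disjoint_iff_inter_eq_empty]
    exact hdis
  refine measure_mono_null h1 ((measure_biUnion_null_iff
    ((TopologicalSpace.countable_countableBasis Plane).mono fun U hU => hU.1)).2 ?_)
  rintro U ⟨hUB, hUS⟩
  refine hν.measure_eq_zero_of_invariant (U := U) (fun x hx => hx.1) ?_ (hB.isOpen hUB) hUS ?_
  · rintro i x hx ⟨_, h⟩
    exact ⟨hx, h.mono_left (orbit_subset_orbit_simil hx i)⟩
  · rw [Set.disjoint_left]
    rintro x ⟨_, h⟩ hxU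
    exact Set.disjoint_left.1 h (mem_iUnion.2 ⟨0, rfl⟩) hxU

theorem denseOrbitPoints_nonempty (hν : IsSelfSimilar ν) : denseOrbitPoints.Nonempty := by
  by_contra h
  have h1 := hν.measure_diff_denseOrbitPoints
  rw [not_nonempty_iff_eq_empty.1 h, sdiff_empty] at h1
  exact hν.measure_pos.ne' h1

theorem measure_inter_denseOrbitPoints (hν : IsSelfSimilar ν) (A : Set Plane) :
    ν (A ∩ denseOrbitPoints) = ν A := by
  refine le_antisymm (measure_mono inter_subset_left) ?_
  rw [← hν.measure_inter A]
  have h : A ∩ gasket ⊆ (A ∩ denseOrbitPoints) ∪ (gasket \ denseOrbitPoints) := by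
    rintro x ⟨hA, hx⟩
    by_cases h : x ∈ denseOrbitPoints
    · exact Or.inl ⟨hA, h⟩
    · exact Or.inr ⟨hx, h⟩
  refine (measure_mono h).trans ((measure_union_le _ _).trans_eq ?_)
  rw [hν.measure_diff_denseOrbitPoints, add_zero]

/-- Every typical density is seen at arbitrarily small scales around a point with dense orbit. -/
theorem typicalDensities_subset_densitySpectrum (hν : IsSelfSimilar ν) {y : Plane}
    (hy : y ∈ denseOrbitPoints) : typicalDensities ν ⊆ densitySpectrum ν {y} := by
  rintro _ ⟨x, d, h, rfl⟩
  rw [mem_densitySpectrum_singleton, mapClusterPt_iff_frequently]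
  intro s hs
  rw [frequently_nhdsGT_zero_iff]
  intro ε hε
  -- The ball is made smaller than `ε` first, keeping its density; carrying it back to `y` can only
  -- shrink it further.
  obtain ⟨n, hn⟩ := exists_pow_lt_of_lt_one (div_pos hε h.2.1) (by norm_num : (1 / 2 : ℝ) < 1)
  rw [lt_div_iff₀ h.2.1] at hn
  rw [← hν.density_iterate_simil h 0 n] at hs
  have ht := h.iterate_simil 0 n
  set x₁ := (simil 0)^[n] x
  set d₁ := (1 / 2 : ℝ) ^ n * d
  obtain ⟨hx₁, hd₁, O, hO, hB⟩ := ht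
  -- Room around the ball inside `O`, so that moving the centre to a nearby orbit point keeps it
  -- typical.
  obtain ⟨δ, hδ, hδO⟩ := (isCompact_closedBall x₁ d₁).exists_cthickening_subset_open hO.1 hB
  rw [cthickening_closedBall hδ.le hd₁.le] at hδO
  have hc : ContinuousAt (fun z : Plane => density ν z d₁) x₁ :=
    ContinuousAt.comp (f := fun z : Plane => (z, d₁)) (hν.continuousAt_density x₁ hd₁)
      (by fun_prop)
  obtain ⟨U, hU, hUo, hxU⟩ := mem_nhds_iff.1 (inter_mem (hc hs) (Metric.ball_mem_nhds x₁ hδ))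
  obtain ⟨k, z, hz, hzU⟩ := exists_orbit_mem hy hUo ⟨x₁, hxU, hx₁⟩
  have hzS : z ∈ gasket := by
    cases k with
    | zero => rw [mem_singleton_iff.1 hz]; exact hy.1
    | succ k =>
      rw [Function.iterate_succ_apply', mem_geomShift_iff] at hz
      exact hz.1
  have hzt : IsTypical z d₁ := by
    refine ⟨hzS, hd₁, O, hO, (Metric.closedBall_subset_closedBall' ?_).trans hδO⟩
    have : dist z x₁ < δ := (hU hzU).2
    linarith
  refine ⟨(1 / 2) ^ k * d₁, by positivity, ?_, ?_⟩
  · exact lt_of_le_of_lt (mul_le_of_le_one_left hd₁.le (pow_le_one₀ (by norm_num) (by norm_num))) hn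
  · rw [hν.density_of_mem_iterate_geomShift hz hzt]
    exact (hU hzU).1

theorem densitySpectrum_subset_typicalDensities (hν : IsSelfSimilar ν) {O : Set Plane}
    (hO : IsFeasible O) {x : Plane} (hx : x ∈ O ∩ gasket) :
    densitySpectrum ν {x} ⊆ typicalDensities ν :=
  densitySpectrum_subset_of_eventually hν.isCompact_typicalDensities.isClosed
    ((eventually_isTypical hO hx).mono fun d hd => ⟨x, d, hd, rfl⟩)

theorem densitySpectrum_of_mem_denseOrbitPoints (hν : IsSelfSimilar ν) {y : Plane}
    (hy : y ∈ denseOrbitPoints) : densitySpectrum ν {y} = typicalDensities ν :=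
  subset_antisymm (hν.densitySpectrum_subset_typicalDensities isFeasible_hexagon
    ⟨denseOrbitPoints_subset isFeasible_hexagon hy, hy.1⟩)
    (hν.typicalDensities_subset_densitySpectrum hy)

theorem densitySpectrum_denseOrbitPoints (hν : IsSelfSimilar ν) :
    densitySpectrum ν denseOrbitPoints = typicalDensities ν := by
  ext l
  rw [mem_densitySpectrum_iff]
  constructor
  · rintro ⟨y, hy, hl⟩
    rwa [hν.densitySpectrum_of_mem_denseOrbitPoints hy] at hl
  · intro hl
    obtain ⟨y, hy⟩ := hν.denseOrbitPoints_nonempty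
    exact ⟨y, hy, by rwa [hν.densitySpectrum_of_mem_denseOrbitPoints hy]⟩

theorem densitySpectrum_feasible (hν : IsSelfSimilar ν) {O : Set Plane} (hO : IsFeasible O) :
    densitySpectrum ν (O ∩ gasket) = typicalDensities ν := by
  ext l
  rw [mem_densitySpectrum_iff]
  constructor
  · rintro ⟨y, hy, hl⟩
    exact hν.densitySpectrum_subset_typicalDensities hO hy hl
  · intro hl
    obtain ⟨y, hy⟩ := hν.denseOrbitPoints_nonempty
    exact ⟨y, ⟨denseOrbitPoints_subset hO hy, hy.1⟩,
      by rwa [hν.densitySpectrum_of_mem_denseOrbitPoints hy]⟩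

theorem typicalDensities_eq_Icc (hν : IsSelfSimilar ν) {a b : ℝ≥0∞}
    (ha : IsLeast (typicalDensities ν) a) (hb : IsGreatest (typicalDensities ν) b) :
    typicalDensities ν = Icc a b := by
  refine subset_antisymm (fun v hv => ⟨ha.2 hv, hb.2 hv⟩) fun v hv => ?_
  rcases hv.1.eq_or_lt with rfl | hav
  · exact ha.1
  rcases hv.2.eq_or_lt with rfl | hvb
  · exact hb.1
  obtain ⟨y, hy⟩ := hν.denseOrbitPoints_nonempty
  have hsub := hν.typicalDensities_subset_densitySpectrum hy
  have h1 := mem_densitySpectrum_singleton.1 (hsub ha.1)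
  have h2 := mem_densitySpectrum_singleton.1 (hsub hb.1)
  -- Below radius `ρ` all balls about `y` are typical, so the intermediate radius found between `r₁`
  -- and `r₂` gives a typical ball.
  obtain ⟨ρ, hρ, hty⟩ := (nhdsGT_basis (0 : ℝ)).eventually_iff.1
    (eventually_isTypical isFeasible_hexagon ⟨denseOrbitPoints_subset isFeasible_hexagon hy, hy.1⟩)
  obtain ⟨r₁, hr₁, hr₁', hv₁⟩ := frequently_nhdsGT_zero_iff.1 (h1.frequently (Iio_mem_nhds hav)) ρ hρ
  obtain ⟨r₂, hr₂, hr₂', hv₂⟩ := frequently_nhdsGT_zero_iff.1 (h2.frequently (Ioi_mem_nhds hvb)) ρ hρ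
  have hsub : uIcc r₁ r₂ ⊆ Ioo 0 ρ := by
    rw [uIcc]
    exact Icc_subset_Ioo (lt_min hr₁ hr₂) (max_lt hr₁' hr₂')
  have hc : ContinuousOn (fun d : ℝ => density ν y d) (uIcc r₁ r₂) :=
    (hν.continuousOn_density y).mono fun d hd => (hsub hd).1
  obtain ⟨r, hr, hrv⟩ := intermediate_value_uIcc hc
    (Icc_subset_uIcc ⟨le_of_lt hv₁, le_of_lt hv₂⟩)
  exact ⟨y, r, hty (hsub hr), hrv.symm⟩

end IsSelfSimilar

/-! ### Densities at the vertices -/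

theorem densitySpectrum_congr {α α' : Set Plane → ℝ≥0∞} {x y : Plane}
    (h : ∀ d > 0, density α x d = density α' y d) :
    densitySpectrum α {x} = densitySpectrum α' {y} := by
  have e (d : ℕ → ℝ) (hd : ∀ k, 0 < d k) :
      (fun k => density α x (d k)) = fun k => density α' y (d k) :=
    funext fun k => h _ (hd k)
  ext l
  constructor
  · rintro ⟨_, rfl, d, hd, h0, hl⟩
    exact ⟨y, rfl, d, hd, h0, e d hd ▸ hl⟩
  · rintro ⟨_, rfl, d, hd, h0, hl⟩
    exact ⟨x, rfl, d, hd, h0, (e d hd).symm ▸ hl⟩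

/-- If a point of the gasket is close to `z₀` after moving it into another piece, then it was close
to `z₀` already. -/
theorem dist_vertex_zero_le {i : Fin 3} (hi : i ≠ 0) {y : Plane} (hy : y ∈ gasket)
    (h : dist (simil i y) (vertex 0) ≤ 33 / 64) : dist y (vertex 0) ≤ 1 / 16 := by
  have h0 := bary_nonneg hy 0
  have h1 := bary_nonneg hy 1
  have h2 := bary_nonneg hy 2
  have hs : bary 0 y = 1 - bary 1 y - bary 2 y := by linarith [sum_bary y]
  have hD := dist_sq_eq y (vertex 0)
  have hE := dist_sq_eq (simil i y) (vertex 0)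
  have hE' : dist (simil i y) (vertex 0) ^ 2 ≤ (33 / 64) ^ 2 := pow_le_pow_left₀ dist_nonneg h 2
  have hD0 : 0 ≤ dist y (vertex 0) := dist_nonneg
  rw [hE] at hE'
  simp only [bary_simil, bary_vertex, hs] at hD hE'
  generalize dist y (vertex 0) = D at *
  generalize bary 1 y = u at *
  generalize bary 2 y = v at *
  -- For `i = 1` take `w = 2u + v`: then `D² = u² + uv + v² ≤ w²`, and four times the squared
  -- distance of `f₁(y)` from `z₀` is `1 + w + D²`. Here `65/1024 = 4 * (33/64)² - 1`.
  have key (w : ℝ) (hw : 0 ≤ w) (h1 : D ^ 2 ≤ w ^ 2) (h2 : w + D ^ 2 ≤ 65 / 1024) :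
      D ≤ 1 / 16 := by
    have h3 : D ≤ w := (sq_le_sq₀ hD0 hw).1 h1
    nlinarith
  fin_cases i
  · exact absurd rfl hi
  · refine key (2 * u + v) (by positivity) ?_ ?_ <;> simp at hD hE' <;> nlinarith [mul_nonneg h1 h2]
  · refine key (2 * v + u) (by positivity) ?_ ?_ <;> simp at hD hE' <;> nlinarith [mul_nonneg h1 h2]

/-- The densities at `z₀` of the balls with radii between `1/2` and `1`. -/
def vertexDensities (α : Set Plane → ℝ≥0∞) : Set ℝ≥0∞ :=
  {l | ∃ d ∈ Icc (1 / 2 : ℝ) 1, l = density α (vertex 0) d}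

theorem vertexDensities_eq_image (α : Set Plane → ℝ≥0∞) :
    vertexDensities α = (fun d : ℝ => density α (vertex 0) d) '' Icc (1 / 2) 1 := by
  ext l
  exact ⟨fun ⟨d, hd, h⟩ => ⟨d, hd, h.symm⟩, fun ⟨d, hd, h⟩ => ⟨d, hd, h.symm⟩⟩

namespace IsSelfSimilar

variable {ν : Measure Plane}

theorem measure_closedBall_vertex_half (hν : IsSelfSimilar ν) {d : ℝ} (hd : d ≤ 1) :
    ν (Metric.closedBall (vertex 0) (d / 2)) = 3⁻¹ * ν (Metric.closedBall (vertex 0) d) := by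
  have h := hν.measure_closedBall_simil_corner (l := 0) (x := vertex 0) (d := d)
    (by rw [dist_self, zero_add]; exact hd)
  rwa [simil_vertex] at h

theorem density_vertex_pow (hν : IsSelfSimilar ν) {d : ℝ} (hd : 0 < d) (hd1 : d ≤ 1) (n : ℕ) :
    density ν (vertex 0) ((1 / 2) ^ n * d) = density ν (vertex 0) d := by
  induction n with
  | zero => simp
  | succ n ih =>
    have e : (1 / 2 : ℝ) ^ (n + 1) * d = (1 / 2) ^ n * d / 2 := by rw [pow_succ]; ring
    rw [e, density_half (by positivity) (hν.measure_closedBall_vertex_half ?_), ih]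
    exact (mul_le_of_le_one_left hd.le (pow_le_one₀ (by norm_num) (by norm_num))).trans hd1

theorem density_mem_vertexDensities (hν : IsSelfSimilar ν) {d : ℝ} (hd : 0 < d) (hd1 : d ≤ 1) :
    density ν (vertex 0) d ∈ vertexDensities ν := by
  obtain ⟨n, hn, hn'⟩ := exists_nat_pow_near_of_lt_one hd hd1 (by norm_num : (0 : ℝ) < 1 / 2)
    (by norm_num)
  have h2 : (0 : ℝ) < 2 ^ n := by positivity
  have e : d = (1 / 2) ^ n * (2 ^ n * d) := by rw [← mul_assoc, ← mul_pow]; norm_num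
  rw [div_pow, one_pow] at hn hn'
  rw [le_div_iff₀ h2] at hn'
  rw [div_lt_iff₀ (by positivity), pow_succ] at hn
  have hle : 2 ^ n * d ≤ 1 := by linarith
  refine ⟨2 ^ n * d, ⟨by linarith, hle⟩, ?_⟩
  rw [← hν.density_vertex_pow (by positivity) hle n, ← e]

theorem eventually_density_mem_vertexDensities (hν : IsSelfSimilar ν) :
    ∀ᶠ d in 𝓝[>] (0 : ℝ), density ν (vertex 0) d ∈ vertexDensities ν := by
  filter_upwards [Ioc_mem_nhdsGT (zero_lt_one' ℝ)] with d hd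
  exact hν.density_mem_vertexDensities hd.1 hd.2

theorem frequently_density_eq (hν : IsSelfSimilar ν) {l : ℝ≥0∞} (hl : l ∈ vertexDensities ν) :
    ∃ᶠ d in 𝓝[>] (0 : ℝ), density ν (vertex 0) d = l := by
  obtain ⟨d, hd, rfl⟩ := hl
  have hd0 : 0 < d := by linarith [hd.1]
  rw [frequently_nhdsGT_zero_iff]
  intro ε hε
  obtain ⟨n, hn⟩ := exists_pow_lt_of_lt_one (div_pos hε hd0) (by norm_num : (1 / 2 : ℝ) < 1)
  rw [lt_div_iff₀ hd0] at hn
  exact ⟨_, by positivity, hn, hν.density_vertex_pow hd0 hd.2 n⟩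

theorem isCompact_vertexDensities (hν : IsSelfSimilar ν) : IsCompact (vertexDensities ν) := by
  rw [vertexDensities_eq_image]
  exact isCompact_Icc.image_of_continuousOn ((hν.continuousOn_density _).mono fun d hd => by
    have := hd.1; exact mem_Ioi.2 (by linarith))

theorem densitySpectrum_vertex_zero (hν : IsSelfSimilar ν) :
    densitySpectrum ν {vertex 0} = vertexDensities ν := by
  refine subset_antisymm (densitySpectrum_subset_of_eventually
    hν.isCompact_vertexDensities.isClosed hν.eventually_density_mem_vertexDensities) fun l hl => ?_
  rw [mem_densitySpectrum_singleton, mapClusterPt_iff_frequently]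
  intro s hs
  exact (hν.frequently_density_eq hl).mono fun d hd => by rw [hd]; exact mem_of_mem_nhds hs

theorem densitySpectrum_vertex (hν : IsSelfSimilar ν) (i : Fin 3) :
    densitySpectrum ν {vertex i} = vertexDensities ν := by
  rw [← hν.densitySpectrum_vertex_zero]
  refine densitySpectrum_congr fun d hd => ?_
  rw [density_def, density_def, hν.measure_closedBall_vertex i hd]

/-- Halving invariance makes every value on `[1/2, 1]` recur at arbitrarily small radii, so the
lower limit is the minimum. -/
theorem isLeast_lowerDensity (hν : IsSelfSimilar ν) :
    IsLeast (vertexDensities ν) (lowerDensity ν (vertex 0)) := by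
  obtain ⟨a, ha⟩ := hν.isCompact_vertexDensities.exists_isLeast
    ⟨_, 1, by norm_num, rfl⟩
  suffices h : lowerDensity ν (vertex 0) = a by rwa [h]
  refine le_antisymm (liminf_le_of_frequently_le
    ((hν.frequently_density_eq ha.1).mono fun d hd => hd.le)) ?_
  exact le_liminf_of_le (h := hν.eventually_density_mem_vertexDensities.mono fun d hd => ha.2 hd)

theorem isGreatest_upperDensity (hν : IsSelfSimilar ν) :
    IsGreatest (vertexDensities ν) (upperDensity ν (vertex 0)) := by
  obtain ⟨a, ha⟩ := hν.isCompact_vertexDensities.exists_isGreatest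
    ⟨_, 1, by norm_num, rfl⟩
  suffices h : upperDensity ν (vertex 0) = a by rwa [h]
  refine le_antisymm ?_ (le_limsup_of_frequently_le
    ((hν.frequently_density_eq ha.1).mono fun d hd => hd.ge))
  exact limsup_le_of_le (h := hν.eventually_density_mem_vertexDensities.mono fun d hd => ha.2 hd)

theorem vertexDensities_eq_Icc (hν : IsSelfSimilar ν) :
    vertexDensities ν = Icc (lowerDensity ν (vertex 0)) (upperDensity ν (vertex 0)) := by
  refine subset_antisymm (fun l hl => ⟨hν.isLeast_lowerDensity.2 hl,
    hν.isGreatest_upperDensity.2 hl⟩) ?_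
  have h : IsPreconnected (vertexDensities ν) := by
    rw [vertexDensities_eq_image]
    exact isPreconnected_Icc.image _ ((hν.continuousOn_density _).mono fun d hd => by
      have := hd.1; exact mem_Ioi.2 (by linarith))
  exact h.Icc_subset hν.isLeast_lowerDensity.1 hν.isGreatest_upperDensity.1

theorem densitySpectrum_gasket (hν : IsSelfSimilar ν) :
    densitySpectrum ν gasket = vertexDensities ν ∪ typicalDensities ν := by
  ext l
  rw [mem_densitySpectrum_iff]
  constructor
  · rintro ⟨x, hx, hl⟩
    by_cases h : ∃ i, x = vertex i
    · obtain ⟨i, rfl⟩ := h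
      exact Or.inl (hν.densitySpectrum_vertex i ▸ hl)
    · push Not at h
      exact Or.inr (hν.densitySpectrum_subset_typicalDensities isFeasible_hexagon
        ⟨mem_hexagon_of_mem_gasket hx h, hx⟩ hl)
  · rintro (hl | hl)
    · exact ⟨vertex 0, vertex_mem_gasket 0, (hν.densitySpectrum_vertex 0).symm ▸ hl⟩
    · obtain ⟨y, hy⟩ := hν.denseOrbitPoints_nonempty
      exact ⟨y, hy.1, by rwa [hν.densitySpectrum_of_mem_denseOrbitPoints hy]⟩

theorem measure_closedBall_vertex_pow (hν : IsSelfSimilar ν) (n : ℕ) :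
    ν (Metric.closedBall (vertex 0) ((1 / 2) ^ n)) = 3⁻¹ ^ n * ν gasket := by
  induction n with
  | zero =>
    rw [pow_zero, pow_zero, one_mul]
    exact le_antisymm (hν.le_measure_gasket _)
      (measure_mono fun y hy => dist_le_one hy (vertex_mem_gasket 0))
  | succ n ih =>
    rw [pow_succ, mul_one_div, hν.measure_closedBall_vertex_half
      (pow_le_one₀ (by norm_num) (by norm_num)), ih, pow_succ', mul_assoc]

/-- The density at `z₀` is not constant. -/
theorem density_vertex_lt (hν : IsSelfSimilar ν) :
    density ν (vertex 0) (33 / 64) < density ν (vertex 0) (1 / 2) := by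
  have e1 : density ν (vertex 0) (1 / 2) = 3⁻¹ * ν gasket := by
    have h := hν.measure_closedBall_vertex_pow 1
    rw [pow_one, pow_one] at h
    rw [density_def, h]
    simp [diamPow]
  have h1 : ν (Metric.closedBall (vertex 0) (33 / 64))
      ≤ 3⁻¹ * (ν gasket + 3⁻¹ ^ 4 * ν gasket + 3⁻¹ ^ 4 * ν gasket) := by
    have h2 (i : Fin 3) (hi : i ≠ 0) :
        ν (simil i ⁻¹' Metric.closedBall (vertex 0) (33 / 64)) ≤ 3⁻¹ ^ 4 * ν gasket := by
      rw [← hν.measure_closedBall_vertex_pow, ← hν.measure_inter]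
      refine measure_mono fun y hy => ?_
      have := dist_vertex_zero_le hi hy.2 hy.1
      rw [Metric.mem_closedBall]
      norm_num
      linarith
    rw [hν.apply Metric.isClosed_closedBall.measurableSet, Fin.sum_univ_three]
    gcongr 3⁻¹ * (?_ + ?_ + ?_)
    · exact hν.le_measure_gasket _
    · exact h2 1 (by decide)
    · exact h2 2 (by decide)
  have e2 : (3⁻¹ * (ν gasket + 3⁻¹ ^ 4 * ν gasket + 3⁻¹ ^ 4 * ν gasket) : ℝ≥0∞)
      = 3⁻¹ * ν gasket * ENNReal.ofReal (83 / 81) := by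
    have h3 : (3⁻¹ : ℝ≥0∞) = ENNReal.ofReal (1 / 3) := by
      rw [one_div, ENNReal.ofReal_inv_of_pos (by norm_num)]; norm_num
    have h4 : ENNReal.ofReal (83 / 81) = 1 + 3⁻¹ ^ 4 + 3⁻¹ ^ 4 := by
      rw [h3, ← ENNReal.ofReal_pow (by norm_num), ← ENNReal.ofReal_one,
        ← ENNReal.ofReal_add (by norm_num) (by norm_num),
        ← ENNReal.ofReal_add (by norm_num) (by norm_num)]
      norm_num
    rw [h4]
    ring
  -- Enlarging the radius from `1/2` to `33/64` adds at most the fraction `2/81` of the mass, less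
  -- than the growth `33/32` of the diameter provides, as `s ≥ 1`.
  have h3 : ENNReal.ofReal (83 / 81) < diamPow (33 / 64) := by
    rw [diamPow, ENNReal.ofReal_lt_ofReal_iff (by positivity)]
    calc (83 / 81 : ℝ) < 2 * (33 / 64) := by norm_num
      _ = (2 * (33 / 64)) ^ (1 : ℝ) := (Real.rpow_one _).symm
      _ ≤ _ := Real.rpow_le_rpow_of_exponent_le (by norm_num) one_le_dimS
  rw [e1, density_def]
  refine ENNReal.div_lt_of_lt_mul (lt_of_le_of_lt (h1.trans_eq e2) ?_)
  exact ENNReal.mul_lt_mul_right (mul_ne_zero (by simp) hν.measure_pos.ne')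
    (ENNReal.mul_ne_top (by simp) (hν.measure_ne_top _)) h3

theorem lowerDensity_lt_upperDensity (hν : IsSelfSimilar ν) :
    lowerDensity ν (vertex 0) < upperDensity ν (vertex 0) :=
  (hν.isLeast_lowerDensity.2 ⟨33 / 64, by norm_num, rfl⟩).trans_lt
    (hν.density_vertex_lt.trans_le (hν.isGreatest_upperDensity.2 ⟨1 / 2, by norm_num, rfl⟩))

theorem density_midpoint (hν : IsSelfSimilar ν) {d : ℝ} (hd : 0 < d) (hd' : d ≤ 4 / 5) :
    density ν (simil 0 (vertex 1)) (d / 2) = 2 * density ν (vertex 0) d := by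
  have h := hν.measure_closedBall_junction (j := 0) (l := 1) (by decide) (x := vertex 1)
    (x' := vertex 0) (y := simil 0 (vertex 1)) (r := d / 2) rfl
    (by simp only [simil]; module) (by rw [dist_self]; linarith)
  rw [mul_div_cancel₀ _ (two_ne_zero' ℝ), hν.measure_closedBall_vertex 1 hd] at h
  rw [density_def, density_def, h, diamPow_half d hd,
    ENNReal.mul_div_mul_left _ _ (by simp) (by simp), ← two_mul, mul_div_assoc]

theorem lt_of_isLeast_of_isGreatest (hν : IsSelfSimilar ν) {a b : ℝ≥0∞}
    (ha : IsLeast (typicalDensities ν) a) (hb : IsGreatest (typicalDensities ν) b) : a < b := by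
  -- Two corners meet at the midpoint of a side, doubling the density at a vertex. Three halvings
  -- make the ball about the midpoint small enough to be typical.
  have key {d : ℝ} (hd : 0 < d) (hd1 : d ≤ 1) :
      2 * density ν (vertex 0) d ∈ typicalDensities ν := by
    have h0 : 0 < (1 / 2 : ℝ) ^ 3 * d := by positivity
    have h1 : (1 / 2 : ℝ) ^ 3 * d ≤ 1 / 8 := by norm_num; linarith
    rw [← hν.density_vertex_pow hd hd1 3, ← hν.density_midpoint h0 (by linarith)]
    have ht := isTypical_simil_simil (vertex_mem_gasket 1) (j := 0) (l := 1) (by decide)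
      (half_pos h0) (by linarith)
    rw [simil_vertex] at ht
    exact ⟨_, _, ht, rfl⟩
  refine (ha.2 (key (d := 33 / 64) (by norm_num) (by norm_num))).trans_lt
    (lt_of_lt_of_le ?_ (hb.2 (key (d := 1 / 2) (by norm_num) (by norm_num))))
  exact ENNReal.mul_lt_mul_right two_ne_zero (by simp) hν.density_vertex_lt

end IsSelfSimilar

/-! ### Families of balls -/

theorem diamSum_def (t : Set (Plane × ℝ)) : diamSum dimS t = ∑' p : t, diamPow (p : Plane × ℝ).2 :=
  rfl

theorem diamSum_union_le (t u : Set (Plane × ℝ)) :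
    diamSum dimS (t ∪ u) ≤ diamSum dimS t + diamSum dimS u :=
  ENNReal.tsum_union_le (fun p : Plane × ℝ => diamPow p.2) t u

theorem IsFineFamily.union {δ : ℝ} {t u : Set (Plane × ℝ)} (ht : IsFineFamily δ t)
    (hu : IsFineFamily δ u) : IsFineFamily δ (t ∪ u) :=
  ⟨ht.1.union hu.1, fun p hp => hp.elim (ht.2 p) (hu.2 p)⟩

theorem IsFineFamily.mono {δ δ' : ℝ} {t : Set (Plane × ℝ)} (ht : IsFineFamily δ t) (h : δ ≤ δ') :
    IsFineFamily δ' t :=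
  ⟨ht.1, fun p hp => ⟨(ht.2 p hp).1, (ht.2 p hp).2.trans h⟩⟩

theorem Covers.union {t u : Set (Plane × ℝ)} {A B : Set Plane} (ht : Covers t A)
    (hu : Covers u B) : Covers (t ∪ u) (A ∪ B) := by
  rw [Covers, biUnion_union]
  exact union_subset_union ht hu

theorem Covers.measure_le {t : Set (Plane × ℝ)} {A : Set Plane} (h : Covers t A)
    (ht : t.Countable) (ν : Measure Plane) :
    ν A ≤ ∑' p : t, ν (Metric.closedBall (p : Plane × ℝ).1 (p : Plane × ℝ).2) :=
  (measure_mono h).trans (measure_biUnion_le ν ht _)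

/-- The action of the similitudes on balls. -/
def ballMap (i : Fin 3) (p : Plane × ℝ) : Plane × ℝ := (simil i p.1, p.2 / 2)

theorem surjective_simil (i : Fin 3) : Function.Surjective (simil i) := by
  intro y
  refine ⟨(2 : ℝ) • y - vertex i, ?_⟩
  simp only [simil, smul_sub, smul_smul]; norm_num

theorem injective_ballMap (i : Fin 3) : Function.Injective (ballMap i) := by
  rintro ⟨x, d⟩ ⟨y, e⟩ h
  rw [ballMap, ballMap, Prod.mk.injEq] at h
  exact Prod.ext (injective_simil i h.1) (by linarith [h.2])

theorem surjective_ballMap (i : Fin 3) : Function.Surjective (ballMap i) := by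
  rintro ⟨y, e⟩
  obtain ⟨x, rfl⟩ := surjective_simil i y
  exact ⟨(x, 2 * e), Prod.ext rfl (by simp [ballMap])⟩

theorem image_simil_closedBall (i : Fin 3) (x : Plane) (d : ℝ) :
    simil i '' Metric.closedBall x d = Metric.closedBall (simil i x) (d / 2) := by
  rw [← preimage_simil_closedBall i, image_preimage_eq _ (surjective_simil i)]

theorem IsFineFamily.image {δ : ℝ} {t : Set (Plane × ℝ)} (ht : IsFineFamily δ t) (i : Fin 3) :
    IsFineFamily (δ / 2) (ballMap i '' t) := by
  refine ⟨ht.1.image _, ?_⟩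
  rintro _ ⟨p, hp, rfl⟩
  have h := ht.2 p hp
  constructor <;> simp only [ballMap] <;> linarith

theorem Covers.image {t : Set (Plane × ℝ)} {A : Set Plane} (h : Covers t A) (i : Fin 3) :
    Covers (ballMap i '' t) (simil i '' A) := by
  rw [Covers, biUnion_image]
  refine (image_mono h).trans ?_
  rw [image_iUnion₂]
  simp only [image_simil_closedBall]
  rfl

theorem diamSum_image {t : Set (Plane × ℝ)} (ht : ∀ p ∈ t, 0 < p.2) (i : Fin 3) :
    diamSum dimS (ballMap i '' t) = 3⁻¹ * diamSum dimS t := by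
  rw [diamSum_def, diamSum_def, tsum_image (fun p : Plane × ℝ => diamPow p.2)
    (injective_ballMap i).injOn, ← ENNReal.tsum_mul_left]
  exact tsum_congr fun p => diamPow_half _ (ht p p.2)

/-! ### Measures defined by coverings -/

/-- The Hausdorff premeasure of `A` defined by coverings by balls centred in `Q`. -/
def coverPre (Q A : Set Plane) : ℝ≥0∞ :=
  ⨆ (δ : ℝ) (_ : 0 < δ), ⨅ (t : Set (Plane × ℝ))
    (_ : IsFineFamily δ t ∧ (∀ p ∈ t, p.1 ∈ Q) ∧ Covers t A), diamSum dimS t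

/-- Separating the set of centres from the covered set treats the centred and the spherical measure
at once, and allows splitting a set without losing control of the centres. -/
theorem centredPre_eq (A : Set Plane) : centredPre dimS A = coverPre A A := rfl

theorem sphericalHausdorff_eq (A : Set Plane) : sphericalHausdorff dimS A = coverPre univ A := by
  simp [sphericalHausdorff, coverPre]

theorem coverPre_mono {Q Q' A A' : Set Plane} (hQ : Q' ⊆ Q) (hA : A ⊆ A') :
    coverPre Q A ≤ coverPre Q' A' :=
  iSup₂_mono fun _ _ => le_iInf₂ fun t ht => iInf₂_le t
    ⟨ht.1, fun p hp => hQ (ht.2.1 p hp), hA.trans ht.2.2⟩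

theorem coverPre_union_le (Q Q' A A' : Set Plane) :
    coverPre (Q ∪ Q') (A ∪ A') ≤ coverPre Q A + coverPre Q' A' := by
  refine iSup₂_le fun δ hδ => ?_
  refine le_trans ?_ (add_le_add (le_iSup₂ (f := fun (δ : ℝ) (_ : 0 < δ) =>
      ⨅ (t : Set (Plane × ℝ)) (_ : IsFineFamily δ t ∧ (∀ p ∈ t, p.1 ∈ Q) ∧ Covers t A),
        diamSum dimS t) δ hδ)
    (le_iSup₂ (f := fun (δ : ℝ) (_ : 0 < δ) =>
      ⨅ (t : Set (Plane × ℝ)) (_ : IsFineFamily δ t ∧ (∀ p ∈ t, p.1 ∈ Q') ∧ Covers t A'),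
        diamSum dimS t) δ hδ))
  refine ENNReal.le_iInf₂_add_iInf₂ fun t ht u hu => ?_
  refine (iInf₂_le (t ∪ u) ⟨ht.1.union hu.1, ?_, ht.2.2.union hu.2.2⟩).trans
    (diamSum_union_le t u)
  exact fun p hp => hp.elim (fun h => Or.inl (ht.2.1 p h)) fun h => Or.inr (hu.2.1 p h)

theorem coverPre_image_le (i : Fin 3) (Q A : Set Plane) :
    coverPre (simil i '' Q) (simil i '' A) ≤ 3⁻¹ * coverPre Q A := by
  refine iSup₂_le fun δ hδ => ?_
  refine le_trans ?_ (mul_le_mul_right (le_iSup₂ (f := fun (δ : ℝ) (_ : 0 < δ) =>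
      ⨅ (t : Set (Plane × ℝ)) (_ : IsFineFamily δ t ∧ (∀ p ∈ t, p.1 ∈ Q) ∧ Covers t A),
        diamSum dimS t) δ hδ) _)
  simp only [ENNReal.mul_iInf_of_ne (show (3⁻¹ : ℝ≥0∞) ≠ 0 by simp) (by simp)]
  refine le_iInf₂ fun t ht => ?_
  rw [← diamSum_image (fun p hp => (ht.1.2 p hp).1) i]
  refine iInf₂_le _ ⟨(ht.1.image i).mono (by linarith), ?_, ht.2.2.image i⟩
  rintro _ ⟨p, hp, rfl⟩
  exact mem_image_of_mem _ (ht.2.1 p hp)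

theorem le_coverPre {ν : Measure Plane} {Q A : Set Plane} {κ : ℝ≥0∞} (hκ : κ ≠ 0) (hκ' : κ ≠ ⊤)
    {ρ : ℝ} (hρ : 0 < ρ)
    (h : ∀ x ∈ Q, ∀ d, 0 < d → d ≤ ρ → ν (Metric.closedBall x d) ≤ κ * diamPow d) :
    ν A ≤ κ * coverPre Q A := by
  have key : ν A ≤ κ * ⨅ (t : Set (Plane × ℝ)) (_ : IsFineFamily ρ t ∧ (∀ p ∈ t, p.1 ∈ Q) ∧
      Covers t A), diamSum dimS t := by
    simp only [ENNReal.mul_iInf_of_ne hκ hκ']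
    refine le_iInf₂ fun t ht => (ht.2.2.measure_le ht.1.1 ν).trans ?_
    rw [diamSum_def, ← ENNReal.tsum_mul_left]
    refine ENNReal.tsum_le_tsum fun p => ?_
    have h1 := ht.1.2 p p.2
    exact h _ (ht.2.1 p p.2) _ h1.1 (by linarith)
  refine key.trans ?_
  gcongr
  exact le_iSup₂ (f := fun (δ : ℝ) (_ : 0 < δ) => ⨅ (t : Set (Plane × ℝ))
    (_ : IsFineFamily δ t ∧ (∀ p ∈ t, p.1 ∈ Q) ∧ Covers t A), diamSum dimS t) ρ hρ

theorem isScaling_sphericalHausdorff (h : sphericalHausdorff dimS gasket ≠ ⊤) :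
    IsScaling (sphericalHausdorff dimS) := by
  refine ⟨fun A B hAB => ?_, fun A B _ _ => ?_, fun i A _ _ => ?_, h⟩ <;>
    simp only [sphericalHausdorff_eq]
  · exact coverPre_mono subset_rfl hAB
  · simpa using coverPre_union_le univ univ A B
  · simpa [(surjective_simil i).range_eq] using coverPre_image_le i univ A

theorem isClosed_image_simil (i : Fin 3) {A : Set Plane} (hA : IsClosed A) :
    IsClosed (simil i '' A) := by
  rw [image_simil_eq_preimage]
  exact hA.preimage (by fun_prop)

theorem isScaling_centredHausdorff (h : centredHausdorff dimS gasket ≠ ⊤) :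
    IsScaling (centredHausdorff dimS) := by
  refine ⟨fun A B hAB => ?_, fun A B hA hB => ?_, fun i A _ _ => ?_, h⟩
  · exact iSup₂_le fun F hF => le_iSup₂_of_le F ⟨hF.1.trans hAB, hF.2⟩ le_rfl
  · refine iSup₂_le fun F hF => ?_
    -- Both parts are closed, so each competes in the supremum with coverings centred in itself.
    have e : F = (F ∩ A) ∪ (F ∩ B) := by
      rw [← inter_union_distrib_left, inter_eq_self_of_subset_left hF.1]
    rw [centredPre_eq, e]
    refine (coverPre_union_le _ _ _ _).trans (add_le_add ?_ ?_)
    · exact le_iSup₂_of_le (F ∩ A) ⟨inter_subset_right, hF.2.inter hA⟩ le_rfl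
    · exact le_iSup₂_of_le (F ∩ B) ⟨inter_subset_right, hF.2.inter hB⟩ le_rfl
  · refine iSup₂_le fun F hF => ?_
    have e : F = simil i '' (simil i ⁻¹' F) := (image_preimage_eq _ (surjective_simil i)).symm
    rw [centredPre_eq, e]
    refine (coverPre_image_le i _ _).trans ?_
    gcongr
    refine le_iSup₂_of_le (simil i ⁻¹' F) ⟨fun x hx => ?_, hF.2.preimage (continuous_simil i)⟩ le_rfl
    obtain ⟨y, hy, hxy⟩ := hF.1 hx
    exact injective_simil i hxy ▸ hy

/-! ### The packing measure -/

theorem packingPre_empty : packingPre dimS ∅ = 0 := by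
  refine le_antisymm (iInf₂_le_of_le 1 one_pos (iSup₂_le fun t ht => ?_)) zero_le
  have h : t = ∅ := eq_empty_iff_forall_notMem.2 fun p hp => ht.2.1 p hp
  subst h
  simp [diamSum]

theorem packingPre_image_le (i : Fin 3) (F : Set Plane) :
    packingPre dimS (simil i '' F) ≤ 3⁻¹ * packingPre dimS F := by
  conv_rhs => rw [packingPre]
  simp only [ENNReal.mul_iInf_of_ne (show (3⁻¹ : ℝ≥0∞) ≠ 0 by simp) (by simp)]
  refine le_iInf₂ fun δ hδ => iInf₂_le_of_le (δ / 2) (by positivity) (iSup₂_le fun u hu => ?_)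
  obtain ⟨t, rfl⟩ : ∃ t, ballMap i '' t = u :=
    ⟨ballMap i ⁻¹' u, image_preimage_eq _ (surjective_ballMap i)⟩
  have hpos : ∀ p ∈ t, 0 < p.2 ∧ 2 * p.2 ≤ δ := by
    intro p hp
    have h := hu.1.2 _ (mem_image_of_mem _ hp)
    simp only [ballMap] at h
    constructor <;> linarith
  rw [diamSum_image (fun p hp => (hpos p hp).1) i]
  gcongr
  refine le_iSup₂_of_le t ⟨⟨?_, hpos⟩, fun p hp => ?_, ?_⟩ le_rfl
  · exact countable_of_injective_of_countable_image (injective_ballMap i).injOn hu.1.1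
  · obtain ⟨y, hy, hyp⟩ := hu.2.1 _ (mem_image_of_mem _ hp)
    exact injective_simil i hyp ▸ hy
  · intro p hp q hq hpq
    have h := hu.2.2 (mem_image_of_mem _ hp) (mem_image_of_mem _ hq)
      ((injective_ballMap i).ne hpq)
    rw [Function.onFun, Set.disjoint_left] at h ⊢
    intro y hy hy'
    exact h (a := simil i y)
      (by simp only [ballMap, ← image_simil_closedBall]; exact mem_image_of_mem _ hy)
      (by simp only [ballMap, ← image_simil_closedBall]; exact mem_image_of_mem _ hy')

theorem packing_union_le (A B : Set Plane) :
    packing dimS (A ∪ B) ≤ packing dimS A + packing dimS B := by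
  refine ENNReal.le_iInf₂_add_iInf₂ fun F hF G hG => ?_
  -- The two sequences of closed sets are interleaved into one through `ℕ ⊕ ℕ ≃ ℕ`.
  have e : ∑' n, packingPre dimS (F n) + ∑' n, packingPre dimS (G n)
      = ∑' n, packingPre dimS (Sum.elim F G ((Equiv.natSumNatEquivNat).symm n)) := by
    rw [Equiv.tsum_eq Equiv.natSumNatEquivNat.symm fun x => packingPre dimS (Sum.elim F G x),
      ENNReal.summable.tsum_sum ENNReal.summable]
    rfl
  rw [e]
  refine iInf₂_le _ ⟨fun n => ?_, ?_⟩
  · change IsClosed (Sum.elim F G (Equiv.natSumNatEquivNat.symm n))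
    rcases Equiv.natSumNatEquivNat.symm n with m | m
    · exact hF.1 _
    · exact hG.1 _
  · rw [union_subset_iff]
    constructor
    · refine hF.2.trans (iUnion_subset fun n => subset_iUnion_of_subset
        (Equiv.natSumNatEquivNat (Sum.inl n)) ?_)
      simp
    · refine hG.2.trans (iUnion_subset fun n => subset_iUnion_of_subset
        (Equiv.natSumNatEquivNat (Sum.inr n)) ?_)
      simp

theorem packing_le_packingPre {A : Set Plane} (hA : IsClosed A) :
    packing dimS A ≤ packingPre dimS A := by
  refine iInf₂_le_of_le (fun n : ℕ => if n = 0 then A else ∅) ⟨fun n => ?_, ?_⟩ ?_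
  · beta_reduce
    split_ifs
    exacts [hA, isClosed_empty]
  · exact subset_iUnion_of_subset 0 (by simp)
  · rw [tsum_eq_single 0 fun n hn => by simp only [if_neg hn, packingPre_empty]]
    simp

theorem isScaling_packing (h : packing dimS gasket ≠ ⊤) : IsScaling (packing dimS) := by
  refine ⟨fun A B hAB => ?_, fun A B _ _ => packing_union_le A B, fun i A _ _ => ?_, h⟩
  · exact le_iInf₂ fun F hF => iInf₂_le F ⟨hF.1, hAB.trans hF.2⟩
  · conv_rhs => rw [packing]
    simp only [ENNReal.mul_iInf_of_ne (show (3⁻¹ : ℝ≥0∞) ≠ 0 by simp) (by simp)]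
    refine le_iInf₂ fun F hF => ?_
    rw [← ENNReal.tsum_mul_left]
    refine iInf₂_le_of_le (fun n => simil i '' F n) ⟨fun n => isClosed_image_simil i (hF.1 n), ?_⟩
      (ENNReal.tsum_le_tsum fun n => packingPre_image_le i (F n))
    rw [← image_iUnion]
    exact image_mono hF.2

/-! ### The Hausdorff measure -/

theorem isScaling_hausdorffMeasure (h : μH[dimS] gasket ≠ ⊤) :
    IsScaling fun A : Set Plane => μH[dimS] A := by
  refine ⟨fun A B h => measure_mono h, fun A B _ _ => measure_union_le _ _, fun i A _ _ => ?_, h⟩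
  have hL : LipschitzWith (1 / 2) (simil i) := fun x y => (edist_simil i x y).le
  refine (hL.hausdorffMeasure_image_le (zero_le_one.trans one_le_dimS) A).trans_eq ?_
  congr 1
  rw [← ofReal_half_rpow_dimS, ← ENNReal.ofReal_rpow_of_pos (by norm_num)]
  congr 1
  rw [ENNReal.ofReal]
  congr 1
  ext
  simp

theorem ediam_closedBall_le {x : Plane} {d : ℝ} :
    Metric.ediam (Metric.closedBall x d) ≤ ENNReal.ofReal (2 * d) := by
  refine Metric.ediam_le fun y hy z hz => ?_
  rw [edist_dist]
  refine ENNReal.ofReal_le_ofReal ?_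
  have h1 : dist y x ≤ d := hy
  have h2 : dist z x ≤ d := hz
  linarith [dist_triangle_right y z x]

/-- Only finiteness of the Hausdorff measure is wanted from this, so near-optimal ball coverings
with slack `1` are enough. -/
theorem hausdorffMeasure_le_sphericalHausdorff (A : Set Plane)
    (h : sphericalHausdorff dimS A ≠ ⊤) :
    μH[dimS] A ≤ sphericalHausdorff dimS A + 1 := by
  have key : ∀ n : ℕ, ∃ t : Set (Plane × ℝ), (IsFineFamily (1 / (n + 1)) t ∧ Covers t A) ∧
      diamSum dimS t < sphericalHausdorff dimS A + 1 := by
    intro n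
    have h1 : (⨅ (t : Set (Plane × ℝ)) (_ : IsFineFamily (1 / ((n : ℝ) + 1)) t ∧ Covers t A),
        diamSum dimS t) < sphericalHausdorff dimS A + 1 := by
      refine lt_of_le_of_lt ?_ (ENNReal.lt_add_right h one_ne_zero)
      exact le_iSup₂ (f := fun (δ : ℝ) (_ : 0 < δ) => ⨅ (t : Set (Plane × ℝ))
        (_ : IsFineFamily δ t ∧ Covers t A), diamSum dimS t) (1 / ((n : ℝ) + 1)) (by positivity)
    simpa [iInf_lt_iff] using h1
  choose t ht hlt using key
  have (n : ℕ) : Countable (t n) := (ht n).1.1.to_subtype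
  have h2 : Tendsto (fun n : ℕ => ENNReal.ofReal (1 / ((n : ℝ) + 1))) atTop (𝓝 0) := by
    rw [← ENNReal.ofReal_zero]
    exact ENNReal.tendsto_ofReal tendsto_one_div_add_atTop_nhds_zero_nat
  refine (Measure.hausdorffMeasure_le_liminf_tsum dimS A _ h2
    (fun n (p : t n) => Metric.closedBall (p : Plane × ℝ).1 (p : Plane × ℝ).2)
    (Eventually.of_forall fun n p => ?_) (Eventually.of_forall fun n => ?_)).trans ?_
  · have h3 := (ht n).1.2 p p.2
    exact ediam_closedBall_le.trans (ENNReal.ofReal_le_ofReal h3.2)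
  · rw [iUnion_subtype]
    exact (ht n).2
  · refine liminf_le_of_frequently_le (Frequently.of_forall fun n => le_trans ?_ (hlt n).le)
    refine ENNReal.tsum_le_tsum fun p => ?_
    have h3 := (ht n).1.2 p p.2
    rw [← ENNReal.ofReal_rpow_of_pos (by linarith)]
    gcongr
    · exact zero_le_one.trans one_le_dimS
    · exact ediam_closedBall_le

/-! ### Density inequalities and the part of the gasket away from the vertices -/

theorem le_density_iff {α : Set Plane → ℝ≥0∞} {x : Plane} {d : ℝ} (hd : 0 < d) {κ : ℝ≥0∞} :
    κ ≤ density α x d ↔ κ * diamPow d ≤ α (Metric.closedBall x d) := by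
  rw [density_def, ENNReal.le_div_iff_mul_le (Or.inl (diamPow_ne_zero hd))
    (Or.inl (diamPow_ne_top d))]

theorem density_le_iff {α : Set Plane → ℝ≥0∞} {x : Plane} {d : ℝ} (hd : 0 < d) {κ : ℝ≥0∞} :
    density α x d ≤ κ ↔ α (Metric.closedBall x d) ≤ κ * diamPow d := by
  rw [density_def, ENNReal.div_le_iff (diamPow_ne_zero hd) (diamPow_ne_top d)]

/-- The part of the gasket that is away from the vertices. -/
def innerPart (r : ℝ) : Set Plane := gasket \ ⋃ i, Metric.ball (vertex i) r

theorem isClosed_innerPart (r : ℝ) : IsClosed (innerPart r) :=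
  isClosed_gasket.sdiff (isOpen_iUnion fun _ => Metric.isOpen_ball)

/-- The inner part is a compact subset of the feasible hexagon, so one radius works for all centres.
-/
theorem exists_isTypical_of_mem_innerPart {r : ℝ} (hr : 0 < r) :
    ∃ ρ > 0, ∀ x ∈ innerPart r, ∀ d, 0 < d → d ≤ ρ → IsTypical x d := by
  have hc : IsCompact (innerPart r) := isCompact_gasket.of_isClosed_subset (isClosed_innerPart r)
    sdiff_subset
  have hsub : innerPart r ⊆ hexagon := fun x hx => mem_hexagon_of_mem_gasket hx.1 fun i hi =>
    hx.2 (mem_iUnion.2 ⟨i, by rw [hi]; exact Metric.mem_ball_self hr⟩)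
  obtain ⟨ρ, hρ, hρ'⟩ := hc.exists_cthickening_subset_open isOpen_hexagon hsub
  refine ⟨ρ, hρ, fun x hx d hd hdρ => ⟨hx.1, hd, hexagon, isFeasible_hexagon, ?_⟩⟩
  refine Subset.trans (fun y hy => ?_) hρ'
  exact Metric.mem_cthickening_of_dist_le y x _ _ hx ((Metric.mem_closedBall.1 hy).trans hdρ)

namespace IsSelfSimilar

variable {ν : Measure Plane}

theorem measure_iUnion_closedBall_vertex_le (hν : IsSelfSimilar ν) (n : ℕ) :
    ν (⋃ i, Metric.closedBall (vertex i) ((1 / 2) ^ n)) ≤ 3⁻¹ ^ n * (3 * ν gasket) := by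
  refine (measure_iUnion_fintype_le ν _).trans_eq ?_
  simp only [hν.measure_closedBall_vertex _ (by positivity : (0 : ℝ) < (1 / 2) ^ n),
    hν.measure_closedBall_vertex_pow, Finset.sum_const, Finset.card_univ, Fintype.card_fin,
    nsmul_eq_mul]
  push_cast
  ring

theorem measure_gasket_le_innerPart_add (hν : IsSelfSimilar ν) (n : ℕ) :
    ν gasket ≤ ν (innerPart ((1 / 2) ^ n)) + 3⁻¹ ^ n * (3 * ν gasket) := by
  refine le_trans ?_ (add_le_add_right (hν.measure_iUnion_closedBall_vertex_le n) _)
  refine (measure_mono fun x hx => ?_).trans (measure_union_le _ _)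
  by_cases h : x ∈ ⋃ i, Metric.ball (vertex i) ((1 / 2 : ℝ) ^ n)
  · exact Or.inr (iUnion_mono (fun i => Metric.ball_subset_closedBall) h)
  · exact Or.inl ⟨hx, h⟩

theorem _root_.SierpinskiGasket.le_of_forall_le_add_pow_mul {a b K : ℝ≥0∞} (hK : K ≠ ⊤)
    (h : ∀ n : ℕ, a ≤ b + 3⁻¹ ^ n * K) : a ≤ b := by
  have h1 : Tendsto (fun n : ℕ => b + (3⁻¹ : ℝ≥0∞) ^ n * K) atTop (𝓝 (b + 0 * K)) :=
    tendsto_const_nhds.add (ENNReal.Tendsto.mul_const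
      (ENNReal.tendsto_pow_atTop_nhds_zero_of_lt_one (by simp)) (Or.inr hK))
  rw [zero_mul, add_zero] at h1
  exact ge_of_tendsto' h1 h

theorem mem_typicalDensities_pos (hν : IsSelfSimilar ν) {l : ℝ≥0∞} (hl : l ∈ typicalDensities ν) :
    l ≠ 0 := by
  obtain ⟨x, d, h, rfl⟩ := hl
  exact (hν.density_pos h.1 h.2.1).ne'

theorem mem_typicalDensities_ne_top (hν : IsSelfSimilar ν) {l : ℝ≥0∞}
    (hl : l ∈ typicalDensities ν) : l ≠ ⊤ := by
  obtain ⟨x, d, h, rfl⟩ := hl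
  exact hν.density_ne_top h.2.1

/-! ### The centred Hausdorff measure of the gasket -/

/-- Small balls centred in the inner part are typical, so each has mass at most `b (2d)^s`. The
omitted corners have total mass at most `3⁻¹ ^ n * 3 ν(S)`, which tends to `0`. -/
theorem le_mul_centredHausdorff (hν : IsSelfSimilar ν) {b : ℝ≥0∞}
    (hb : IsGreatest (typicalDensities ν) b) :
    ν gasket ≤ b * centredHausdorff dimS gasket := by
  refine le_of_forall_le_add_pow_mul (K := 3 * ν gasket)
    (ENNReal.mul_ne_top (by simp) (hν.measure_ne_top gasket)) fun n =>
    (hν.measure_gasket_le_innerPart_add n).trans ?_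
  gcongr ?_ + _
  obtain ⟨ρ, hρ, h⟩ := exists_isTypical_of_mem_innerPart (r := (1 / 2) ^ n) (by positivity)
  refine (le_coverPre (hν.mem_typicalDensities_pos hb.1) (hν.mem_typicalDensities_ne_top hb.1)
    (Q := innerPart ((1 / 2) ^ n)) hρ fun x hx d hd hdρ => ?_).trans ?_
  · exact (density_le_iff hd).1 (hb.2 ⟨x, d, h x hx d hd hdρ, rfl⟩)
  · gcongr b * ?_
    exact le_iSup₂ (f := fun (F : Set Plane) (_ : F ⊆ gasket ∧ IsClosed F) => centredPre dimS F)
      _ ⟨sdiff_subset, isClosed_innerPart _⟩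

/-- Economical coverings by centred balls of prescribed density. -/
theorem exists_centred_cover (hν : IsSelfSimilar ν) {E : Set Plane} {κ : ℝ≥0∞}
    (hE : ∀ x ∈ E, ∃ᶠ d in 𝓝[>] (0 : ℝ), κ ≤ density ν x d) {η : ℝ≥0∞} (hη : η ≠ 0) {δ : ℝ}
    (hδ : 0 < δ) : ∃ t, IsFineFamily δ t ∧ (∀ p ∈ t, p.1 ∈ E) ∧ Covers t E ∧
      κ * diamSum dimS t ≤ ν E + η := by
  have := hν.isFiniteMeasure
  obtain ⟨T, r, hTc, hTE, hr, hcov, hsum⟩ := Besicovitch.exists_closedBall_covering_tsum_measure_le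
    ν hη (fun x => {d | (0 < d ∧ 2 * d ≤ δ) ∧ κ ≤ density ν x d}) E (fun x hx ε hε => by
      obtain ⟨d, hd, hd', h⟩ := frequently_nhdsGT_zero_iff.1 (hE x hx) (min ε (δ / 2))
        (by positivity)
      have h1 := hd'.trans_le (min_le_left _ _)
      have h2 := hd'.trans_le (min_le_right _ _)
      exact ⟨d, ⟨⟨hd, by linarith⟩, h⟩, hd, h1⟩)
  refine ⟨(fun x => (x, r x)) '' T, ⟨hTc.image _, ?_⟩, ?_, ?_, ?_⟩
  · rintro _ ⟨x, hx, rfl⟩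
    exact (hr x hx).1
  · rintro _ ⟨x, hx, rfl⟩
    exact hTE hx
  · rwa [Covers, biUnion_image]
  · refine le_trans ?_ hsum
    rw [diamSum_def, tsum_image (fun p : Plane × ℝ => diamPow p.2)
      (fun x _ y _ h => (Prod.mk.injEq _ _ _ _ ▸ h).1), ← ENNReal.tsum_mul_left]
    refine ENNReal.tsum_le_tsum fun x => ?_
    have h := hr x x.2
    exact (le_density_iff h.1.1).1 h.2

theorem frequently_le_density (hν : IsSelfSimilar ν) {x : Plane} (hx : x ∈ gasket) :
    ∃ᶠ d in 𝓝[>] (0 : ℝ), ν gasket / 9 ≤ density ν x d := by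
  refine Eventually.frequently ?_
  filter_upwards [Ioc_mem_nhdsGT (zero_lt_one' ℝ)] with d hd
  exact (le_density_iff hd.1).2 (hν.mul_diamPow_le hx hd.1 hd.2)

/-- For `b' < b`, points with dense orbit have arbitrarily small balls of density at least `b'`, and
these cover economically. The remaining points form a null set, which still has to be covered by
centred balls: the uniform lower density bound `ν(S)/9` makes this arbitrarily cheap. -/
theorem mul_centredHausdorff_le (hν : IsSelfSimilar ν) {b : ℝ≥0∞}
    (hb : IsGreatest (typicalDensities ν) b) :
    b * centredHausdorff dimS gasket ≤ ν gasket := by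
  have hc0 : ν gasket / 9 ≠ 0 := (ENNReal.div_pos hν.measure_pos.ne' (by simp)).ne'
  have hc1 : ν gasket / 9 ≠ ⊤ := ENNReal.div_ne_top (hν.measure_ne_top _) (by simp)
  have hb0 := hν.mem_typicalDensities_pos hb.1
  have key : ∀ b' < b, b' * centredHausdorff dimS gasket ≤ ν gasket := by
    intro b' hb'
    have hb'top : b' ≠ ⊤ := hb'.ne_top
    rw [centredHausdorff, ENNReal.mul_iSup]
    refine iSup_le fun F => ?_
    rw [ENNReal.mul_iSup]
    refine iSup_le fun hF => ?_
    rw [centredPre, ENNReal.mul_iSup]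
    refine iSup_le fun δ => ?_
    rw [ENNReal.mul_iSup]
    refine iSup_le fun hδ => ?_
    have hη : ∀ n : ℕ, b' * (⨅ (t : Set (Plane × ℝ)) (_ : IsFineFamily δ t ∧
        (∀ p ∈ t, p.1 ∈ F) ∧ Covers t F), diamSum dimS t)
        ≤ ν gasket + 3⁻¹ ^ n * (1 + b' / (ν gasket / 9)) := by
      intro n
      have hn : (3⁻¹ : ℝ≥0∞) ^ n ≠ 0 := pow_ne_zero _ (by simp)
      obtain ⟨t₁, ht₁, hc₁, hcov₁, hs₁⟩ := hν.exists_centred_cover (E := F ∩ denseOrbitPoints)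
        (κ := b') (fun x hx => by
          have h1 := hν.typicalDensities_subset_densitySpectrum hx.2 hb.1
          exact ((mem_densitySpectrum_singleton.1 h1).frequently (Ioi_mem_nhds hb')).mono
            fun d hd => le_of_lt hd) hn hδ
      obtain ⟨t₂, ht₂, hc₂, hcov₂, hs₂⟩ := hν.exists_centred_cover (E := F \ denseOrbitPoints)
        (κ := ν gasket / 9) (fun x hx => hν.frequently_le_density (hF.1 hx.1)) hn hδ
      have hz : ν (F \ denseOrbitPoints) = 0 :=
        measure_mono_null (sdiff_subset_sdiff_left hF.1) hν.measure_diff_denseOrbitPoints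
      rw [hz, zero_add, mul_comm, ← ENNReal.le_div_iff_mul_le (Or.inl hc0) (Or.inl hc1)] at hs₂
      calc _ ≤ b' * diamSum dimS (t₁ ∪ t₂) := by
            gcongr
            refine iInf₂_le _ ⟨ht₁.union ht₂, ?_, ?_⟩
            · exact fun p hp => hp.elim (fun h => (hc₁ p h).1) fun h => (hc₂ p h).1
            · have h2 := hcov₁.union hcov₂
              rwa [inter_union_sdiff] at h2
        _ ≤ b' * (diamSum dimS t₁ + diamSum dimS t₂) := by
            gcongr
            exact diamSum_union_le _ _
        _ = b' * diamSum dimS t₁ + b' * diamSum dimS t₂ := mul_add _ _ _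
        _ ≤ (ν (F ∩ denseOrbitPoints) + 3⁻¹ ^ n) + b' * (3⁻¹ ^ n / (ν gasket / 9)) := by
            gcongr
        _ ≤ (ν gasket + 3⁻¹ ^ n) + b' * (3⁻¹ ^ n / (ν gasket / 9)) := by
            gcongr ?_ + _ + _
            exact hν.le_measure_gasket _
        _ = _ := by
            simp only [div_eq_mul_inv]; ring
    exact le_of_forall_le_add_pow_mul (ENNReal.add_ne_top.2 ⟨by simp,
      ENNReal.div_ne_top hb'top hc0⟩) hη
  have : (𝓝[<] b).NeBot := nhdsLT_neBot_of_exists_lt ⟨0, pos_iff_ne_zero.2 hb0⟩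
  refine le_of_tendsto (x := 𝓝[<] b) (f := fun b' => b' * centredHausdorff dimS gasket) ?_
    (eventually_nhdsWithin_of_forall key)
  exact (ENNReal.Tendsto.mul_const tendsto_id (Or.inl hb0)).mono_left nhdsWithin_le_nhds

theorem mul_centredHausdorff_eq (hν : IsSelfSimilar ν) {b : ℝ≥0∞}
    (hb : IsGreatest (typicalDensities ν) b) :
    b * centredHausdorff dimS gasket = ν gasket :=
  (hν.mul_centredHausdorff_le hb).antisymm (hν.le_mul_centredHausdorff hb)

/-! ### The packing measure of the gasket -/

/-- Disjoint balls of density at least `κ` have total mass at least `κ` times the diameter sum, and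
all of them lie in the neighbourhood. -/
theorem _root_.SierpinskiGasket.mul_packingPre_le {κ : ℝ≥0∞} {F : Set Plane} {ρ : ℝ} (hρ : 0 < ρ)
    (h : ∀ x ∈ F, ∀ d, 0 < d → d ≤ ρ → κ ≤ density ν x d) :
    κ * packingPre dimS F ≤ ν (Metric.cthickening ρ F) := by
  calc κ * packingPre dimS F ≤ κ * ⨆ (t : Set (Plane × ℝ)) (_ : IsFineFamily ρ t ∧
        (∀ p ∈ t, p.1 ∈ F) ∧ t.PairwiseDisjoint (fun p => Metric.closedBall p.1 p.2)),
          diamSum dimS t := by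
        gcongr
        exact iInf₂_le (f := fun (δ : ℝ) (_ : 0 < δ) => ⨆ (t : Set (Plane × ℝ))
          (_ : IsFineFamily δ t ∧ (∀ p ∈ t, p.1 ∈ F) ∧
            t.PairwiseDisjoint (fun p => Metric.closedBall p.1 p.2)), diamSum dimS t) ρ hρ
    _ ≤ ν (Metric.cthickening ρ F) := by
        simp only [ENNReal.mul_iSup]
        refine iSup₂_le fun t ht => ?_
        rw [diamSum_def, ← ENNReal.tsum_mul_left]
        calc ∑' p : t, κ * diamPow (p : Plane × ℝ).2
            ≤ ∑' p : t, ν (Metric.closedBall (p : Plane × ℝ).1 (p : Plane × ℝ).2) := by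
              refine ENNReal.tsum_le_tsum fun p => ?_
              have h1 := ht.1.2 p p.2
              exact (le_density_iff h1.1).1 (h _ (ht.2.1 p p.2) _ h1.1 (by linarith))
          _ = ν (⋃ p ∈ t, Metric.closedBall p.1 p.2) := (measure_biUnion ht.1.1 ht.2.2
              fun p _ => Metric.isClosed_closedBall.measurableSet).symm
          _ ≤ _ := by
              refine measure_mono (iUnion₂_subset fun p hp y hy => ?_)
              have h1 := ht.1.2 p hp
              have h2 : dist y p.1 ≤ p.2 := hy
              exact Metric.mem_cthickening_of_dist_le y p.1 _ _ (ht.2.1 p hp) (by linarith)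

/-- The bound `a` holds for small balls centred in the inner part but not necessarily near the
vertices. There the cruder bound `ν(S)/9` is enough, because the corners have small mass. -/
theorem mul_packing_le (hν : IsSelfSimilar ν) {a : ℝ≥0∞}
    (ha : IsLeast (typicalDensities ν) a) : a * packing dimS gasket ≤ ν gasket := by
  have hc0 : ν gasket / 9 ≠ 0 := (ENNReal.div_pos hν.measure_pos.ne' (by simp)).ne'
  have hc1 : ν gasket / 9 ≠ ⊤ := ENNReal.div_ne_top (hν.measure_ne_top _) (by simp)
  refine le_of_forall_le_add_pow_mul (K := a * (3 * ν gasket / (ν gasket / 9))) ?_ fun n => ?_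
  · exact ENNReal.mul_ne_top (hν.mem_typicalDensities_ne_top ha.1) (ENNReal.div_ne_top
      (ENNReal.mul_ne_top (by simp) (hν.measure_ne_top gasket)) hc0)
  -- The exponent is `n + 1` because the `r`-neighbourhood of a corner of radius `r` must fit into
  -- radius `2r = (1/2)^n`.
  set r : ℝ := (1 / 2) ^ (n + 1) with hr
  have hr0 : 0 < r := by positivity
  have hr2 : r + r = (1 / 2) ^ n := by rw [hr, pow_succ]; ring
  set G : Set Plane := gasket ∩ ⋃ i, Metric.closedBall (vertex i) r with hG
  have hGc : IsClosed G := isClosed_gasket.inter (isClosed_iUnion_of_finite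
    fun i => Metric.isClosed_closedBall)
  have h1 : gasket ⊆ innerPart r ∪ G := by
    intro x hx
    by_cases h : x ∈ ⋃ i, Metric.ball (vertex i) r
    · exact Or.inr ⟨hx, iUnion_mono (fun i => Metric.ball_subset_closedBall) h⟩
    · exact Or.inl ⟨hx, h⟩
  have h2 : a * packingPre dimS (innerPart r) ≤ ν gasket := by
    obtain ⟨ρ, hρ, h⟩ := exists_isTypical_of_mem_innerPart hr0
    exact (mul_packingPre_le hρ fun x hx d hd hdρ => ha.2 ⟨x, d, h x hx d hd hdρ, rfl⟩).trans
      (hν.le_measure_gasket _)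
  have h3 : packingPre dimS G ≤ 3⁻¹ ^ n * (3 * ν gasket) / (ν gasket / 9) := by
    rw [ENNReal.le_div_iff_mul_le (Or.inl hc0) (Or.inl hc1), mul_comm]
    refine (mul_packingPre_le hr0 fun x hx d hd hdr => (le_density_iff hd).2
      (hν.mul_diamPow_le hx.1 hd (hdr.trans (pow_le_one₀ (by norm_num) (by norm_num))))).trans ?_
    refine le_trans (measure_mono ?_) (hν.measure_iUnion_closedBall_vertex_le n)
    rw [(isCompact_gasket.of_isClosed_subset hGc
      inter_subset_left).cthickening_eq_biUnion_closedBall hr0.le]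
    refine iUnion₂_subset fun x hx y hy => ?_
    obtain ⟨i, hi⟩ := mem_iUnion.1 hx.2
    refine mem_iUnion.2 ⟨i, ?_⟩
    rw [Metric.mem_closedBall] at hi hy ⊢
    linarith [dist_triangle y x (vertex i)]
  calc a * packing dimS gasket
      ≤ a * (packingPre dimS (innerPart r) + packingPre dimS G) := by
        gcongr
        refine le_trans (iInf₂_mono' fun F hF => ⟨F, ⟨hF.1, h1.trans hF.2⟩, le_rfl⟩)
          ((packing_union_le (innerPart r) G).trans ?_)
        exact add_le_add (packing_le_packingPre (isClosed_innerPart r)) (packing_le_packingPre hGc)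
    _ ≤ ν gasket + a * (3⁻¹ ^ n * (3 * ν gasket) / (ν gasket / 9)) := by
        rw [mul_add]
        gcongr
    _ = _ := by simp only [div_eq_mul_inv]; ring

/-- For `a' > a`, almost all of any `F` is covered by disjoint small balls centred in `F` of density
at most `a'`, by Besicovitch at the points with dense orbit. Summing over a closed cover and letting
`a'` decrease to `a` gives the bound. -/
theorem le_mul_packing (hν : IsSelfSimilar ν) {a : ℝ≥0∞}
    (ha : IsLeast (typicalDensities ν) a) : ν gasket ≤ a * packing dimS gasket := by
  have := hν.isFiniteMeasure
  have ha0 := hν.mem_typicalDensities_pos ha.1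
  have hatop := hν.mem_typicalDensities_ne_top ha.1
  have key : ∀ a' > a, a' ≠ ⊤ → ∀ F, ν F ≤ a' * packingPre dimS F := by
    intro a' ha' ha'top F
    have ha'0 : a' ≠ 0 := (pos_of_gt ha').ne'
    rw [packingPre]
    simp only [ENNReal.mul_iInf_of_ne ha'0 ha'top]
    refine le_iInf₂ fun δ hδ => ?_
    rw [← hν.measure_inter_denseOrbitPoints]
    obtain ⟨T, r, hTc, hTE, hr, hcov, hdis⟩ := Besicovitch.exists_disjoint_closedBall_covering_ae
      ν (fun x => {d | 0 < d ∧ density ν x d ≤ a'}) (F ∩ denseOrbitPoints) (fun x hx ε hε => by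
        have h1 := hν.typicalDensities_subset_densitySpectrum hx.2 ha.1
        obtain ⟨d, hd, hd', h⟩ := frequently_nhdsGT_zero_iff.1
          ((mem_densitySpectrum_singleton.1 h1).frequently (Iio_mem_nhds ha')) ε hε
        exact ⟨d, ⟨hd, le_of_lt h⟩, hd, hd'⟩) (fun _ => δ / 2) (fun _ _ => half_pos hδ)
    have hinj : InjOn (fun x => (x, r x)) T :=
      fun x _ y _ h => (Prod.mk.injEq _ _ _ _ ▸ h).1
    calc ν (F ∩ denseOrbitPoints) ≤ ν (⋃ x ∈ T, Metric.closedBall x (r x)) := by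
          refine (measure_le_inter_add_sdiff ν _ (⋃ x ∈ T, Metric.closedBall x (r x))).trans ?_
          rw [hcov, add_zero]
          exact measure_mono inter_subset_right
      _ ≤ ∑' x : T, ν (Metric.closedBall x (r x)) := measure_biUnion_le ν hTc _
      _ ≤ ∑' x : T, a' * diamPow (r x) := ENNReal.tsum_le_tsum fun x =>
          (density_le_iff (hr x x.2).1.1).1 (hr x x.2).1.2
      _ = a' * diamSum dimS ((fun x => (x, r x)) '' T) := by
          rw [diamSum_def, tsum_image (fun p : Plane × ℝ => diamPow p.2) hinj,
            ENNReal.tsum_mul_left]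
      _ ≤ _ := by
          gcongr a' * ?_
          refine le_iSup₂_of_le _ ⟨⟨hTc.image _, ?_⟩, ?_, ?_⟩ le_rfl
          · rintro _ ⟨x, hx, rfl⟩
            have h1 := (hr x hx).2
            exact ⟨h1.1, by linarith [h1.2]⟩
          · rintro _ ⟨x, hx, rfl⟩
            exact (hTE hx).1
          · rw [hinj.pairwiseDisjoint_image]
            exact hdis
  have key2 : ∀ᶠ a' in 𝓝[>] a, ν gasket ≤ a' * packing dimS gasket := by
    filter_upwards [self_mem_nhdsWithin, mem_nhdsWithin_of_mem_nhds
      (Iio_mem_nhds (lt_top_iff_ne_top.2 hatop))] with a' ha' ha'top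
    rw [packing]
    simp only [ENNReal.mul_iInf_of_ne (pos_of_gt ha').ne' (ne_of_lt ha'top)]
    refine le_iInf₂ fun F hF => ?_
    rw [← ENNReal.tsum_mul_left]
    exact (measure_mono hF.2).trans ((measure_iUnion_le F).trans
      (ENNReal.tsum_le_tsum fun n => key a' ha' (ne_of_lt ha'top) (F n)))
  have : (𝓝[>] a).NeBot := nhdsGT_neBot_of_exists_gt ⟨⊤, lt_top_iff_ne_top.2 hatop⟩
  refine ge_of_tendsto (x := 𝓝[>] a) (f := fun a' => a' * packing dimS gasket) ?_ key2
  exact (ENNReal.Tendsto.mul_const tendsto_id (Or.inl ha0)).mono_left nhdsWithin_le_nhds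

theorem mul_packing_eq (hν : IsSelfSimilar ν) {a : ℝ≥0∞}
    (ha : IsLeast (typicalDensities ν) a) : a * packing dimS gasket = ν gasket :=
  (hν.mul_packing_le ha).antisymm (hν.le_mul_packing ha)

end IsSelfSimilar

/-! ### Existence of the natural measure -/

/-- The uniform distribution on three letters. -/
def uniformLetter : Measure (Fin 3) := (3⁻¹ : ℝ≥0∞) • Measure.count

instance : IsProbabilityMeasure uniformLetter :=
  ⟨by simp [uniformLetter, ENNReal.inv_mul_cancel]⟩

theorem uniformLetter_apply (A : Set (Fin 3)) [DecidablePred (· ∈ A)] :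
    uniformLetter A = ∑ i, 3⁻¹ * if i ∈ A then 1 else 0 := by
  rw [← Finset.mul_sum, uniformLetter, Measure.smul_apply, smul_eq_mul,
    Measure.count_apply_finite' A.toFinite (Set.toFinite A).measurableSet]
  congr 1
  rw [Finset.sum_ite, Finset.sum_const_zero, add_zero, Finset.sum_const, nsmul_eq_mul, mul_one]
  congr 2
  ext i
  simp

/-- Prefixing a letter to an infinite word. -/
def consLetter (i : Fin 3) (ω : ℕ → Fin 3) : ℕ → Fin 3 := fun n => Nat.casesOn n i ω

theorem measurable_consLetter (i : Fin 3) : Measurable (consLetter i) := by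
  refine measurable_pi_iff.2 fun n => ?_
  cases n with
  | zero => exact measurable_const
  | succ n => exact measurable_pi_apply n

/-- The uniform Bernoulli measure on infinite words. -/
def bernoulli : Measure (ℕ → Fin 3) := Measure.infinitePi fun _ => uniformLetter

instance : IsProbabilityMeasure bernoulli := by unfold bernoulli; infer_instance

/-- Prefixing a uniform independent letter to an i.i.d. word reproduces its law. It suffices to
compare both sides on finite-dimensional boxes, where the factor at index `0` splits off. -/
theorem bernoulli_eq_sum : bernoulli = ∑ i : Fin 3, (3⁻¹ : ℝ≥0∞) • bernoulli.map (consLetter i) := by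
  classical
  refine (Measure.eq_infinitePi _ fun s t ht => ?_).symm
  have hm : MeasurableSet ((s : Set ℕ).pi t) :=
    MeasurableSet.pi s.countable_toSet fun n _ => ht n
  have hpre (i : Fin 3) : consLetter i ⁻¹' (s : Set ℕ).pi t
      = {_ω | 0 ∈ s → i ∈ t 0} ∩ ((s.preimage Nat.succ Nat.succ_injective.injOn : Finset ℕ) : Set ℕ).pi
          fun n => t (n + 1) := by
    ext ω
    simp only [mem_preimage, Set.mem_pi, mem_inter_iff, Finset.mem_coe, Finset.mem_preimage]
    constructor
    · exact fun h => ⟨fun h0 => h 0 h0, fun n hn => h (n + 1) hn⟩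
    · rintro ⟨h0, h⟩ n hn
      cases n with
      | zero => exact h0 hn
      | succ n => exact h n hn
  set Q := ∏ n ∈ s.preimage Nat.succ Nat.succ_injective.injOn, uniformLetter (t (n + 1)) with hQ
  have h1 (i : Fin 3) : bernoulli.map (consLetter i) ((s : Set ℕ).pi t)
      = (if 0 ∈ s → i ∈ t 0 then 1 else 0) * Q := by
    rw [Measure.map_apply (measurable_consLetter i) hm, hpre]
    split_ifs with h
    · rw [eq_univ_of_forall (s := {_ω : ℕ → Fin 3 | 0 ∈ s → i ∈ t 0}) fun _ => h, univ_inter,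
        one_mul, bernoulli, Measure.infinitePi_pi _ fun n _ => ht (n + 1)]
    · rw [eq_empty_of_forall_notMem (s := {_ω : ℕ → Fin 3 | 0 ∈ s → i ∈ t 0}) fun _ => h,
        empty_inter, measure_empty, zero_mul]
  rw [Measure.finsetSum_apply]
  simp only [Measure.smul_apply, smul_eq_mul, h1, ← mul_assoc]
  rw [← Finset.sum_mul]
  have h2 : Finset.image Nat.succ (s.preimage Nat.succ Nat.succ_injective.injOn) = s.erase 0 := by
    ext n
    cases n <;> simp
  have h3 : Q = ∏ n ∈ s.erase 0, uniformLetter (t n) := by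
    rw [← h2, Finset.prod_image Nat.succ_injective.injOn]
  rw [h3]
  by_cases h0 : 0 ∈ s
  · rw [← Finset.mul_prod_erase s _ h0, uniformLetter_apply]
    simp [h0]
  · simp only [h0, false_imp_iff, if_true, Finset.erase_eq_of_notMem h0, mul_one]
    rw [Finset.sum_const, Finset.card_univ, Fintype.card_fin, nsmul_eq_mul]
    push_cast
    rw [ENNReal.mul_inv_cancel (by simp) (by simp), one_mul]

/-! ### The coding map and its image measure -/

theorem norm_vertex_le (i : Fin 3) : ‖vertex i‖ ≤ 1 := by
  have h0 : vertex 0 = 0 := by ext j; fin_cases j <;> simp [vertex]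
  have h := dist_le_one (vertex_mem_gasket i) (vertex_mem_gasket 0)
  rwa [h0, dist_zero_right] at h

/-- The point of the gasket with a given code. -/
def codePoint (ω : ℕ → Fin 3) : Plane := ∑' n, (1 / 2 : ℝ) ^ (n + 1) • vertex (ω n)

theorem norm_term_le (ω : ℕ → Fin 3) (n : ℕ) :
    ‖(1 / 2 : ℝ) ^ (n + 1) • vertex (ω n)‖ ≤ (1 / 2) ^ (n + 1) := by
  rw [norm_smul, Real.norm_of_nonneg (by positivity)]
  exact mul_le_of_le_one_right (by positivity) (norm_vertex_le _)

theorem hasSum_half_pow : HasSum (fun n : ℕ => (1 / 2 : ℝ) ^ (n + 1)) 1 := by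
  have h := hasSum_geometric_two.mul_left (1 / 2 : ℝ)
  simp only [← pow_succ'] at h
  norm_num at h ⊢
  exact h

theorem summable_codePoint (ω : ℕ → Fin 3) :
    Summable fun n => (1 / 2 : ℝ) ^ (n + 1) • vertex (ω n) :=
  Summable.of_norm_bounded hasSum_half_pow.summable (norm_term_le ω)

theorem norm_codePoint_le (ω : ℕ → Fin 3) : ‖codePoint ω‖ ≤ 1 :=
  tsum_of_norm_bounded hasSum_half_pow (norm_term_le ω)

theorem codePoint_consLetter (i : Fin 3) (ω : ℕ → Fin 3) :
    codePoint (consLetter i ω) = simil i (codePoint ω) := by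
  rw [codePoint, (summable_codePoint _).tsum_eq_zero_add, simil, codePoint,
    ← (summable_codePoint ω).tsum_const_smul, add_comm]
  congr 1
  · refine tsum_congr fun n => ?_
    rw [smul_smul, ← pow_succ']
    rfl
  · simp [consLetter]

theorem measurable_codePoint : Measurable codePoint := by
  refine measurable_of_tendsto_metrizable (f := fun N ω =>
    ∑ n ∈ Finset.range N, (1 / 2 : ℝ) ^ (n + 1) • vertex (ω n)) (fun N => ?_) ?_
  · exact Finset.measurable_sum _ fun n _ =>
      (measurable_of_finite fun i => (1 / 2 : ℝ) ^ (n + 1) • vertex i).comp (measurable_pi_apply n)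
  · rw [tendsto_pi_nhds]
    exact fun ω => (summable_codePoint ω).hasSum.tendsto_sum_nat

theorem exists_isNaturalMeasure : ∃ μ : Measure Plane, IsNaturalMeasure μ := by
  refine ⟨bernoulli.map codePoint, Measure.isProbabilityMeasure_map measurable_codePoint.aemeasurable,
    ⟨Metric.closedBall 0 1, isCompact_closedBall _ _, ?_⟩, ?_⟩
  · rw [Measure.map_apply measurable_codePoint Metric.isClosed_closedBall.measurableSet.compl]
    convert measure_empty (μ := bernoulli)
    refine eq_empty_of_forall_notMem fun ω h => h ?_
    simpa using norm_codePoint_le ω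
  · simp only [ofReal_half_rpow_dimS]
    ext A hA
    rw [Measure.map_apply measurable_codePoint hA]
    conv_lhs => rw [bernoulli_eq_sum]
    rw [Measure.finsetSum_apply, Measure.finsetSum_apply]
    refine Finset.sum_congr rfl fun i _ => ?_
    rw [Measure.smul_apply, Measure.smul_apply,
      Measure.map_apply (measurable_consLetter i) (measurable_codePoint hA),
      Measure.map_apply (continuous_simil i).measurable hA,
      Measure.map_apply measurable_codePoint ((continuous_simil i).measurable hA)]
    congr 2
    ext ω
    simp only [mem_preimage, codePoint_consLetter]

theorem infDist_simil_le (i : Fin 3) (x : Plane) :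
    Metric.infDist (simil i x) gasket ≤ Metric.infDist x gasket / 2 := by
  obtain ⟨y, hy, hxy⟩ := isCompact_gasket.exists_infDist_eq_dist gasket_nonempty x
  rw [hxy, ← dist_simil i]
  exact Metric.infDist_le_dist_of_mem (simil_mem_gasket i hy)

/-- The similitudes at least halve the distance to the gasket, so the mass beyond distance `ε` is at
most the mass beyond `2ε`. Doubling until the compact support is left behind shows that it is `0`.
-/
theorem IsNaturalMeasure.isSelfSimilar {μ : Measure Plane} (hμ : IsNaturalMeasure μ) :
    IsSelfSimilar μ := by
  obtain ⟨hprob, ⟨K, hK, hK0⟩, heq⟩ := hμ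
  simp only [ofReal_half_rpow_dimS] at heq
  set E : ℝ → Set Plane := fun ε => {x | ε < Metric.infDist x gasket} with hE
  have hEm (ε : ℝ) : MeasurableSet (E ε) :=
    (isOpen_lt continuous_const (Metric.continuous_infDist_pt _)).measurableSet
  have step (ε : ℝ) : μ (E ε) ≤ μ (E (2 * ε)) := by
    conv_lhs => rw [heq]
    rw [Measure.finsetSum_apply]
    calc ∑ i : Fin 3, ((3⁻¹ : ℝ≥0∞) • μ.map (simil i)) (E ε)
        ≤ ∑ _i : Fin 3, 3⁻¹ * μ (E (2 * ε)) := by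
          refine Finset.sum_le_sum fun i _ => ?_
          rw [Measure.smul_apply, Measure.map_apply (continuous_simil i).measurable (hEm ε),
            smul_eq_mul]
          gcongr 3⁻¹ * μ ?_
          intro x hx
          have h1 : ε < Metric.infDist (simil i x) gasket := hx
          have h2 := infDist_simil_le i x
          change 2 * ε < Metric.infDist x gasket
          linarith
      _ = μ (E (2 * ε)) := by
          rw [Finset.sum_const, Finset.card_univ, Fintype.card_fin, nsmul_eq_mul, ← mul_assoc]
          push_cast
          rw [ENNReal.mul_inv_cancel (by simp) (by simp), one_mul]
  have steps (k : ℕ) (ε : ℝ) : μ (E ε) ≤ μ (E (2 ^ k * ε)) := by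
    induction k with
    | zero => simp
    | succ k ih => rw [pow_succ', mul_assoc]; exact ih.trans (step _)
  obtain ⟨R, hR⟩ := (hK.image (Metric.continuous_infDist_pt gasket)).bddAbove
  have hnull (ε : ℝ) (hε : 0 < ε) : μ (E ε) = 0 := by
    obtain ⟨k, hk⟩ := pow_unbounded_of_one_lt (R / ε) (one_lt_two (α := ℝ))
    rw [div_lt_iff₀ hε] at hk
    refine le_antisymm ((steps k ε).trans ((measure_mono fun x hx hxK => ?_).trans_eq hK0)) zero_le
    have h1 : 2 ^ k * ε < Metric.infDist x gasket := hx
    linarith [hR (mem_image_of_mem _ hxK)]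
  have hcompl : μ gasketᶜ = 0 := by
    refine measure_mono_null (t := ⋃ n : ℕ, E (1 / (n + 1))) (fun x hx => ?_)
      (measure_iUnion_null fun n => hnull _ (by positivity))
    have h1 := (isClosed_gasket.notMem_iff_infDist_pos gasket_nonempty).1 hx
    obtain ⟨n, hn⟩ := exists_nat_one_div_lt h1
    exact mem_iUnion.2 ⟨n, hn⟩
  refine ⟨inferInstance, hcompl, ?_, heq⟩
  rw [(prob_compl_eq_zero_iff isClosed_gasket.measurableSet).1 hcompl]
  exact one_pos

namespace IsSelfSimilar

variable {ν : Measure Plane}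

theorem smul (hν : IsSelfSimilar ν) {c : ℝ≥0∞} (hc : c ≠ 0) (hc' : c ≠ ⊤) :
    IsSelfSimilar (c • ν) := by
  have := hν.isFiniteMeasure
  refine ⟨Measure.smul_finite ν hc', ?_, ?_, ?_⟩
  · rw [Measure.smul_apply, hν.measure_compl, smul_zero]
  · rw [Measure.smul_apply, smul_eq_mul]
    exact ENNReal.mul_pos hc hν.measure_pos.ne'
  · conv_lhs => rw [hν.eq_sum]
    simp only [Measure.map_smul, Finset.smul_sum]
    exact Finset.sum_congr rfl fun i _ => smul_comm _ _ _

/-! ### Positivity of the Hausdorff measures -/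

/-- A ball with arbitrary centre that meets the gasket at `y` lies in the ball of twice the radius
about `y`; this costs the factor `2^s = 3`. -/
theorem exists_measure_closedBall_le (hν : IsSelfSimilar ν) : ∃ K : ℝ≥0∞, K ≠ 0 ∧ K ≠ ⊤ ∧
    ∀ x d, 0 < d → d ≤ 1 / 5 → ν (Metric.closedBall x d) ≤ K * diamPow d := by
  obtain ⟨b, hb⟩ := hν.isCompact_typicalDensities.exists_isGreatest typicalDensities_nonempty
  refine ⟨b * 3, mul_ne_zero (hν.mem_typicalDensities_pos hb.1) (by simp),
    ENNReal.mul_ne_top (hν.mem_typicalDensities_ne_top hb.1) (by simp), fun x d hd hd' => ?_⟩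
  by_cases h : ∃ y ∈ gasket, y ∈ Metric.closedBall x d
  · obtain ⟨y, hy, hyx⟩ := h
    have e : diamPow (2 * d) = 3 * diamPow d := by
      have h1 := diamPow_half (2 * d) (by positivity)
      rw [mul_div_cancel_left₀ _ (two_ne_zero' ℝ)] at h1
      rw [h1, ← mul_assoc, ENNReal.mul_inv_cancel (by simp) (by simp), one_mul]
    rw [mul_assoc, ← e]
    refine (measure_mono (Metric.closedBall_subset_closedBall' ?_)).trans
      ((density_le_iff (by positivity)).1 (hν.density_le_of_mem_upperBounds hb.2 hy
        (d := 2 * d) (by positivity) (by linarith)))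
    rw [dist_comm]
    linarith [Metric.mem_closedBall.1 hyx]
  · rw [hν.measure_eq_zero_of_disjoint fun y hy hy' => h ⟨y, hy, hy'⟩]
    exact zero_le

theorem sphericalHausdorff_pos (hν : IsSelfSimilar ν) : sphericalHausdorff dimS gasket ≠ 0 := by
  obtain ⟨K, hK0, hK, h⟩ := hν.exists_measure_closedBall_le
  intro h0
  have h1 := le_coverPre (ν := ν) (A := gasket) (Q := univ) hK0 hK (by norm_num : (0 : ℝ) < 1 / 5)
    fun x _ d hd hd' => h x d hd hd'
  rw [← sphericalHausdorff_eq, h0, mul_zero] at h1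
  exact hν.measure_pos.ne' (le_antisymm h1 zero_le)

/-- Mass distribution principle: a set of diameter `D > 0` lies in a ball of radius `D`, and `(2D)^s
= 3 D^s`. Diameter `0` is covered by the absence of atoms. -/
theorem hausdorffMeasure_pos (hν : IsSelfSimilar ν) : μH[dimS] gasket ≠ 0 := by
  obtain ⟨K, hK0, hK, h⟩ := hν.exists_measure_closedBall_le
  have hs0 : 0 < dimS := zero_lt_one.trans_le one_le_dimS
  have h3 : ∀ A : Set Plane, Metric.ediam A ≤ ENNReal.ofReal (1 / 5) →
      ν A ≤ K * 3 * Metric.ediam A ^ dimS := by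
    intro A hA
    have hfin : Metric.ediam A ≠ ⊤ := ne_top_of_le_ne_top ENNReal.ofReal_ne_top hA
    rcases A.eq_empty_or_nonempty with rfl | ⟨x, hx⟩
    · simp
    rcases eq_or_ne (Metric.ediam A) 0 with h0 | h0
    · rw [(Metric.ediam_eq_zero_iff.1 h0).eq_singleton_of_mem hx, hν.measure_singleton]
      exact zero_le
    set D := (Metric.ediam A).toReal with hD
    have hD0 : 0 < D := ENNReal.toReal_pos h0 hfin
    have hD1 : D ≤ 1 / 5 := ENNReal.toReal_le_of_le_ofReal (by norm_num) hA
    have e : K * 3 * Metric.ediam A ^ dimS = K * diamPow D := by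
      rw [diamPow, Real.mul_rpow (by norm_num) hD0.le, two_rpow_dimS,
        ENNReal.ofReal_mul (by norm_num), ← ENNReal.ofReal_rpow_of_pos hD0, hD,
        ENNReal.ofReal_toReal hfin, mul_assoc]
      norm_num
    rw [e]
    refine (measure_mono fun y hy => ?_).trans (h x D hD0 hD1)
    rw [Metric.mem_closedBall, dist_edist]
    exact ENNReal.toReal_mono hfin (Metric.edist_le_ediam_of_mem hy hx)
  have hK3 : K * 3 ≠ 0 := mul_ne_zero hK0 (by simp)
  have hK3' : K * 3 ≠ ⊤ := ENNReal.mul_ne_top hK (by simp)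
  have h4 : (K * 3)⁻¹ • ν ≤ μH[dimS] := by
    refine Measure.le_hausdorffMeasure dimS _ (ENNReal.ofReal (1 / 5)) (by simp) fun A hA => ?_
    rw [Measure.smul_apply, smul_eq_mul, ← ENNReal.div_eq_inv_mul]
    exact ENNReal.div_le_of_le_mul' (h3 A hA)
  intro h0
  have h5 := h4 gasket
  rw [h0, Measure.smul_apply, smul_eq_mul, nonpos_iff_eq_zero, mul_eq_zero] at h5
  exact h5.elim (ENNReal.inv_ne_zero.2 hK3') hν.measure_pos.ne'

/-! ### Values of the measures of the gasket -/

theorem centredHausdorff_pos_lt_top (hν : IsSelfSimilar ν) :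
    0 < centredHausdorff dimS gasket ∧ centredHausdorff dimS gasket < ⊤ := by
  obtain ⟨b, hb⟩ := hν.isCompact_typicalDensities.exists_isGreatest typicalDensities_nonempty
  have h := hν.mul_centredHausdorff_eq hb
  constructor
  · rw [pos_iff_ne_zero]
    rintro h0
    rw [h0, mul_zero] at h
    exact hν.measure_pos.ne h
  · rw [lt_top_iff_ne_top]
    rintro h0
    rw [h0, ENNReal.mul_top (hν.mem_typicalDensities_pos hb.1)] at h
    exact hν.measure_ne_top _ h.symm

theorem packing_pos_lt_top (hν : IsSelfSimilar ν) :
    0 < packing dimS gasket ∧ packing dimS gasket < ⊤ := by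
  obtain ⟨a, ha⟩ := hν.isCompact_typicalDensities.exists_isLeast typicalDensities_nonempty
  have h := hν.mul_packing_eq ha
  constructor
  · rw [pos_iff_ne_zero]
    rintro h0
    rw [h0, mul_zero] at h
    exact hν.measure_pos.ne h
  · rw [lt_top_iff_ne_top]
    rintro h0
    rw [h0, ENNReal.mul_top (hν.mem_typicalDensities_pos ha.1)] at h
    exact hν.measure_ne_top _ h.symm

theorem isGreatest_typicalDensities (hν : IsSelfSimilar ν) :
    IsGreatest (typicalDensities ν) (ν gasket / centredHausdorff dimS gasket) := by
  obtain ⟨b, hb⟩ := hν.isCompact_typicalDensities.exists_isGreatest typicalDensities_nonempty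
  have h := hν.centredHausdorff_pos_lt_top
  rwa [← hν.mul_centredHausdorff_eq hb, ENNReal.mul_div_cancel_right h.1.ne' h.2.ne]

theorem isLeast_typicalDensities (hν : IsSelfSimilar ν) :
    IsLeast (typicalDensities ν) (ν gasket / packing dimS gasket) := by
  obtain ⟨a, ha⟩ := hν.isCompact_typicalDensities.exists_isLeast typicalDensities_nonempty
  have h := hν.packing_pos_lt_top
  rwa [← hν.mul_packing_eq ha, ENNReal.mul_div_cancel_right h.1.ne' h.2.ne]

end IsSelfSimilar

/-! ### Metric measures are self-similar on balls -/

/-- `ν` is a self-similar measure with the same values as `α` on the gasket and on balls. -/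
structure Represents (ν : Measure Plane) (α : Set Plane → ℝ≥0∞) : Prop where
  isSelfSimilar : IsSelfSimilar ν
  apply_gasket : α gasket = ν gasket
  apply_closedBall : ∀ x d, 0 < d → α (Metric.closedBall x d) = ν (Metric.closedBall x d)

/-- By uniqueness, the natural measure multiplied by `β(S)` has the values of `β` on balls. -/
theorem IsScaling.exists_represents {β : Set Plane → ℝ≥0∞} (hβ : IsScaling β)
    (h0 : β gasket ≠ 0) : ∃ ν, Represents ν (restrictGasket β) := by
  obtain ⟨μ, hμ⟩ := exists_isNaturalMeasure
  have hμ' := hμ.isSelfSimilar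
  have := hμ.1
  have h1 : μ gasket = 1 := (prob_compl_eq_zero_iff isClosed_gasket.measurableSet).1
    hμ'.measure_compl
  refine ⟨β gasket • μ, hμ'.smul h0 hβ.ne_top, ?_, fun x d hd => ?_⟩
  · rw [restrictGasket, inter_self, Measure.smul_apply, h1, smul_eq_mul, mul_one]
  · rw [restrictGasket, Measure.smul_apply, smul_eq_mul, ← hβ.mul_closedBall hμ' x hd, h1, one_mul]

theorem exists_represents {α : Set Plane → ℝ≥0∞} (hα : α ∈ metricMeasures) :
    ∃ ν, Represents ν α := by
  obtain ⟨μ, hμ⟩ := exists_isNaturalMeasure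
  have hC := hμ.isSelfSimilar.centredHausdorff_pos_lt_top
  have hP := hμ.isSelfSimilar.packing_pos_lt_top
  -- Coverings centred in the gasket are admissible for the spherical measure, so finiteness passes
  -- from the centred measure to the spherical one and then to the Hausdorff measure.
  have hS : sphericalHausdorff dimS gasket ≠ ⊤ := by
    refine ne_top_of_le_ne_top hC.2.ne ?_
    rw [sphericalHausdorff_eq]
    refine (coverPre_mono (subset_univ gasket) subset_rfl).trans ?_
    exact le_iSup₂ (f := fun (F : Set Plane) (_ : F ⊆ gasket ∧ IsClosed F) => centredPre dimS F)
      gasket ⟨subset_rfl, isClosed_gasket⟩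
  have hH : μH[dimS] gasket ≠ ⊤ := ne_top_of_le_ne_top (ENNReal.add_ne_top.2 ⟨hS, ENNReal.one_ne_top⟩)
    (hausdorffMeasure_le_sphericalHausdorff gasket hS)
  rcases hα with ⟨ν, hν, rfl⟩ | rfl | rfl | rfl | rfl
  · exact ⟨ν, hν.isSelfSimilar, rfl, fun _ _ _ => rfl⟩
  · exact (isScaling_hausdorffMeasure hH).exists_represents hμ.isSelfSimilar.hausdorffMeasure_pos
  · exact (isScaling_sphericalHausdorff hS).exists_represents
      hμ.isSelfSimilar.sphericalHausdorff_pos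
  · exact (isScaling_centredHausdorff hC.2.ne).exists_represents hC.1.ne'
  · exact (isScaling_packing hP.2.ne).exists_represents hP.1.ne'

namespace Represents

variable {ν : Measure Plane} {α : Set Plane → ℝ≥0∞}

theorem density_eq (h : Represents ν α) (x : Plane) {d : ℝ} (hd : 0 < d) :
    density α x d = density ν x d := by
  rw [density_def, density_def, h.apply_closedBall x d hd]

theorem densitySpectrum_eq (h : Represents ν α) (A : Set Plane) :
    densitySpectrum α A = densitySpectrum ν A := by
  ext l
  rw [mem_densitySpectrum_iff, mem_densitySpectrum_iff (α := ν)]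
  simp only [densitySpectrum_congr (α := α) (α' := ν) fun d hd => h.density_eq _ hd]

theorem typicalDensities_eq (h : Represents ν α) : typicalDensities α = typicalDensities ν := by
  ext l
  constructor <;> rintro ⟨x, d, hx, rfl⟩
  · exact ⟨x, d, hx, h.density_eq x hx.2.1⟩
  · exact ⟨x, d, hx, (h.density_eq x hx.2.1).symm⟩

theorem vertexDensities_eq (h : Represents ν α) : vertexDensities α = vertexDensities ν := by
  ext l
  constructor <;> rintro ⟨d, hd, rfl⟩
  · exact ⟨d, hd, h.density_eq _ (by linarith [hd.1])⟩
  · exact ⟨d, hd, (h.density_eq _ (by linarith [hd.1])).symm⟩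

theorem lowerDensity_eq (h : Represents ν α) (x : Plane) :
    lowerDensity α x = lowerDensity ν x :=
  liminf_congr (eventually_nhdsWithin_of_forall fun _ hd => h.density_eq x hd)

theorem upperDensity_eq (h : Represents ν α) (x : Plane) :
    upperDensity α x = upperDensity ν x :=
  limsup_congr (eventually_nhdsWithin_of_forall fun _ hd => h.density_eq x hd)

end Represents

end SierpinskiGasket
end

/-! ### The main theorem -/

theorem theorem4p1 (α : Set Plane → ℝ≥0∞) (hα : α ∈ metricMeasures) :
    -- all the quantities involved are positive and finite
    ((0 < α gasket ∧ α gasket < ⊤) ∧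
      (0 < packing dimS gasket ∧ packing dimS gasket < ⊤) ∧
      (0 < centredHausdorff dimS gasket ∧ centredHausdorff dimS gasket < ⊤)) ∧
    -- (i)
    ((∀ y ∈ denseOrbitPoints,
        densitySpectrum α {y} = densitySpectrum α denseOrbitPoints) ∧
      (∀ R : Set Plane, IsFeasible R →
        densitySpectrum α denseOrbitPoints
          = densitySpectrum α (R ∩ gasket) ∧
        densitySpectrum α (R ∩ gasket) = typicalDensities α) ∧
      densitySpectrum α denseOrbitPoints = typicalDensities α ∧
      typicalDensities α
        = Icc (α gasket / packing dimS gasket) (α gasket / centredHausdorff dimS gasket)) ∧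
    -- (ii)
    (densitySpectrum α gasket
        = Icc (lowerDensity α (vertex 0)) (upperDensity α (vertex 0)) ∪
          Icc (α gasket / packing dimS gasket) (α gasket / centredHausdorff dimS gasket) ∧
      lowerDensity α (vertex 0) < upperDensity α (vertex 0) ∧
      α gasket / packing dimS gasket < α gasket / centredHausdorff dimS gasket ∧
      IsLeast {l | ∃ d ∈ Icc (1 / 2 : ℝ) 1, l = density α (vertex 0) d}
        (lowerDensity α (vertex 0)) ∧
      IsGreatest {l | ∃ d ∈ Icc (1 / 2 : ℝ) 1, l = density α (vertex 0) d}
        (upperDensity α (vertex 0))) := by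
  obtain ⟨ν, h⟩ := exists_represents hα
  have hν := h.isSelfSimilar
  have hIcc := hν.typicalDensities_eq_Icc hν.isLeast_typicalDensities
    hν.isGreatest_typicalDensities
  have hl := hν.isLeast_lowerDensity
  have hu := hν.isGreatest_upperDensity
  -- The set in the last two claims is `vertexDensities α` by definition; it is kept in terms of
  -- `α`, since densities are transferred to `ν` only for positive radii.
  rw [← h.vertexDensities_eq] at hl hu
  simp only [h.densitySpectrum_eq, h.typicalDensities_eq, h.lowerDensity_eq, h.upperDensity_eq,
    h.apply_gasket]
  refine ⟨⟨⟨hν.measure_pos, lt_top_iff_ne_top.2 (hν.measure_ne_top _)⟩, hν.packing_pos_lt_top,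
    hν.centredHausdorff_pos_lt_top⟩, ⟨fun y hy => ?_, fun R hR => ⟨?_, ?_⟩, ?_, hIcc⟩,
    ?_, hν.lowerDensity_lt_upperDensity, ?_, hl, hu⟩
  · rw [hν.densitySpectrum_of_mem_denseOrbitPoints hy, hν.densitySpectrum_denseOrbitPoints]
  · rw [hν.densitySpectrum_denseOrbitPoints, hν.densitySpectrum_feasible hR]
  · exact hν.densitySpectrum_feasible hR
  · exact hν.densitySpectrum_denseOrbitPoints
  · rw [hν.densitySpectrum_gasket, hν.vertexDensities_eq_Icc, hIcc]
  · exact hν.lt_of_isLeast_of_isGreatest hν.isLeast_typicalDensities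
      hν.isGreatest_typicalDensities
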